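/- **Setting.** Let $d\in\{2,3\}$, let $\Omega\subseteq\Omega^\star\subset\mathbb R^d$ be nonempty bounded open convex sets, $\Gamma=\partial\Omega$ with outer unit normal $\mathbf n$, $\partial^\star\Omega^\star=\partial\Omega^\star\setminus\Gamma$, and $0<T<\infty$. For a vector field $\mathbf w$ let $\mathbf w_\tau=\mathbf w-(\mathbf w\cdot\mathbf n)\mathbf n$ on $\Gamma$ and $\mathbf S(\mathbf w)=\frac12(\nabla\mathbf w+\nabla\mathbf w^{\top})$. Let $\gamma,\delta,\alpha,\lambda,\ell_s,\varepsilon_D>0$ and $\theta_s\in\mathbb R$. Let $\rho,\eta,M,K,\beta,\varepsilon:\mathbb R\to\mathbb R$ be continuous functions with values in a compact subset of $(0,\infty)$, with $\rho,\varepsilon\in C^1$. Put $\sigma=\sqrt\rho$, $\varepsilon^\star(\phi)=\varepsilon(\phi)$ in $\Omega$ and $\varepsilon^\star(\phi)=\varepsilon_D$ in $\Omega^\star\setminus\Omega$, $$\mathcal W(\xi)=\begin{cases}(\xi+1)^2,&\xi<-1\\ \frac14(1-\xi^2)^2,&|\xi|\le1\\ (\xi-1)^2,&\xi>1\end{cases},\qquad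 \Theta(\phi)=\tfrac{\cos\theta_s}{2}\sin\tfrac{\pi\phi}{2},\qquad \psi(\phi)=\frac1{\ell_s\delta}e^{-\phi^2/(2\delta)} .$$ The *electrowetting system* for the phase field $\phi$, chemical potential $\mu$, velocity $\mathbf u$, pressure $p$, charge $q$ and voltage $V$ is $$\begin{aligned} &\phi_t+\mathbf u\cdot\nabla\phi=\operatorname{div}(M(\phi)\nabla\mu)\ \text{in }\Omega,\qquad M(\phi)\partial_{\mathbf n}\mu=0\ \text{on }\Gamma,\\ &\mu=\gamma\big(\tfrac1\delta\mathcal W'(\phi)-\delta\Delta\phi\big)-\tfrac12\varepsilon'(\phi)|\nabla V|^2+\tfrac12\rho'(\phi)|\mathbf u|^2\ \text{in }\Omega,\\ &\alpha(\phi_t+\mathbf u_\tau\cdot\mathbf b)+\gamma(\Theta'(\phi)+\delta\partial_{\mathbf n}\phi)=0\ \text{on }\Gamma,\\ &\sigma(\phi)(\sigma(\phi)\mathbf u)_t+\rho(\phi)\mathbf u\cdot\nabla\mathbf u+\tfrac12\operatorname{div}(\rho(\phi)\mathbf u)\mathbf u-\operatorname{div}(\eta(\phi)\mathbf S(\mathbf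 u))+\nabla p\\ &\qquad\qquad=\mu\nabla\phi-q\nabla(V+\lambda q)+\tfrac12\rho'(\phi)\phi_t\mathbf u,\qquad \operatorname{div}\mathbf u=0\ \text{in }\Omega,\\ &\mathbf u\cdot\mathbf n=0,\qquad \beta(\phi)\mathbf u_\tau+\eta(\phi)(\mathbf S(\mathbf u)\mathbf n)_\tau=\gamma(\Theta'(\phi)+\delta\partial_{\mathbf n}\phi)\,\mathbf b\ \text{on }\Gamma,\\ &q_t+\operatorname{div}(q\mathbf u)=\operatorname{div}\big(K(\phi)\nabla(\lambda q+V)\big)\ \text{in }\Omega,\qquad K(\phi)\nabla(\lambda q+V)\cdot\mathbf n=0\ \text{on }\Gamma,\\ &-\operatorname{div}(\varepsilon^\star(\phi)\nabla V)=q\chi_\Omega\ \text{in }\Omega^\star,\qquad V=\bar V_0\ \text{on }\partial^\star\Omega^\star,\qquad \partial_{\mathbf n}V=0\ \text{on }\partial\Omega^\star\cap\Gamma . \end{aligned}$$ Here the tangential field $\mathbf b$ is either $\partial_\tau\phi=(\nabla\phi)_\tau$ (in which case $\nabla\phi$ is assumed continuous on $\overline\Omega$ at each time), or its regularisation $\psi(\phi)\boldsymbol\tau$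 with a measurable unit tangential field $\boldsymbol\tau$ on $\Gamma$. The function $\bar V_0$ is an extension to $\Omega^\star$ of the applied boundary voltage; it is continuous on $[0,T]$ and differentiable on $(0,T)$ with values in $H^1(\Omega^\star)$, with derivative $\bar V_{0,t}$ such that $\int_{\Omega^\star}|\nabla\bar V_{0,t}|^2$ and $\int_\Omega|\bar V_{0,t}|^2$ are integrable on $(0,T)$. *Solution* means: the system holds for every $t\in(0,T)$ in its weak formulation, obtained by multiplying each equation by a test function and integrating by parts, using the boundary conditions. The conditions $V=\bar V_0$ on $\partial^\star\Omega^\star$ (for $t\in[0,T]$) and $\mathbf u\cdot\mathbf n=0$ on $\Gamma$ (for $t\in(0,T)$) are understood in the sense of traces. The test functions are in $H^1(\Omega)$ for the phase and charge equations, in $H^1(\Omega)\cap C(\overline\Omega)$ for the equation of $\mu$, in $\{\mathbf w\in H^1(\Omega)^d\cap C(\overline\Omega)^d:\mathbf w\cdot\mathbf n|_\Gamma=0\}$ for the momentum equation, and in $\{W\in H^1(\Omega^\star):W|_{\partial^\star\Omega^\star}=0\}$ for the voltage equation. The solution is regular in the following sense. * $\phi,\mathbf u$ are continuous on $[0,T]\times\overline\Omega$,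 with time derivatives continuous on $(0,T)\times\overline\Omega$. * $\phi(t)\in H^1(\Omega)$ and $V(t)\in H^1(\Omega^\star)$ for $t\in[0,T]$; $\phi_t(t),\mu(t),q(t)\in H^1(\Omega)$, $\mathbf u(t)\in H^1(\Omega)^d$ and $p(t)\in L^2(\Omega)$ for $t\in(0,T)$. * $\nabla\phi$, $q$ and $\nabla V$ are continuous on $[0,T]$ and differentiable on $(0,T)$ with values in $L^2(\Omega)^d$, $L^2(\Omega)$ and $L^2(\Omega^\star)^d$, the derivative of $\nabla\phi$ being $\nabla\phi_t$. **Theorem (Stability).** There is an absolute constant $c>0$ (independent of $T$, of the domains, of the parameters, of the data and of the solution) such that the following holds. For every solution, put $\hat\Theta=\Theta+\frac12|\cos\theta_s|\ge0$, the interfacial energy density normalised to be nonnegative, and let $\varepsilon_M$ be an upper bound of $\varepsilon^\star(\phi)$ on $[0,T]\times\Omega^\star$ (for instance its supremum). Then the supremum and the time integral on the left below are finite, and $$\begin{aligned} &\sup_{s\in(0,T]}\Big\{\int_\Omega\Big[\tfrac12\rho(\phi)|\mathbf u|^2+\tfrac\lambda4q^2+\gamma\big(\tfrac\delta2|\nabla\phi|^2+\tfrac1\delta\mathcal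 W(\phi)\big)\Big]+\int_{\Omega^\star}\tfrac14\varepsilon^\star(\phi)|\nabla V|^2+\gamma\int_\Gamma\hat\Theta(\phi)\Big\}(s)\\ &\quad+\int_0^T\Big\{\int_\Omega\big[\eta(\phi)|\mathbf S(\mathbf u)|^2+M(\phi)|\nabla\mu|^2+K(\phi)|\nabla(\lambda q+V)|^2\big]+\int_\Gamma\big[\beta(\phi)|\mathbf u_\tau|^2+\alpha|\phi_t+\mathbf u_\tau\cdot\mathbf b|^2\big]\Big\}\,dt\\ &\le 4\Big\{\int_\Omega\Big[\tfrac12\rho(\phi)|\mathbf u|^2+\tfrac{1+\lambda}2q^2+\gamma\big(\tfrac\delta2|\nabla\phi|^2+\tfrac1\delta\mathcal W(\phi)\big)+\tfrac12|\bar V_0|^2\Big]\\ &\qquad\qquad+\int_{\Omega^\star}\big(\varepsilon^\star(\phi)|\nabla V|^2+\varepsilon_M|\nabla\bar V_0|^2\big)+\gamma\int_\Gamma\hat\Theta(\phi)\Big\}\Big|_{t=0}\\ &\quad+4\sup_{s\in[0,T]}\Big\{\int_{\Omega^\star}\varepsilon_M|\nabla\bar V_0|^2+\int_\Omega\tfrac1\lambda|\bar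 V_0|^2\Big\}(s) +c\,T\int_0^T\Big[\int_{\Omega^\star}\varepsilon_M|\nabla\bar V_{0,t}|^2+\tfrac4\lambda\int_\Omega|\bar V_{0,t}|^2\Big]dt . \end{aligned}$$ -/

import Mathlib

open MeasureTheory Set Filter Topology
open scoped ENNReal ContDiff

noncomputable section

namespace Electrowetting

/-! ### Sobolev spaces, boundary values and time regularity -/

/-- The ambient space `ℝ^d` with its Euclidean norm. -/
abbrev Space (d : ℕ) : Type := EuclideanSpace ℝ (Fin d)

/-- Bounded convex domains (they automatically have a Lipschitz boundary and are connected). -/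
structure IsConvexDomain {d : ℕ} (U : Set (Space d)) : Prop where
  isOpen : IsOpen U
  convex : Convex ℝ U
  bounded : Bornology.IsBounded U
  nonempty : U.Nonempty

/-- The `(d-1)`-dimensional surface measure on `A`, normalised so as to agree with Lebesgue measure
on hyperplanes. -/
def surface {d : ℕ} (A : Set (Space d)) : Measure (Space d) :=
  (μHE[d - 1] : Measure (Space d)).restrict A

/-- `ν` is an outer unit normal of the convex set `U` at `x`: a unit vector such that `U` lies in the
half space `{y | ⟨ν, y - x⟩ ≤ 0}`.  At almost every boundary point there is exactly one. -/
def IsOuterUnitNormal {d : ℕ} (U : Set (Space d)) (x ν : Space d) : Prop :=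
  ‖ν‖ = 1 ∧ ∀ y ∈ U, inner ℝ ν (y - x) ≤ 0

/-- Tangential component `w - (w · ν) ν` of a vector `w` with respect to the normal `ν`. -/
def tang {d : ℕ} (ν w : Space d) : Space d := w - (inner ℝ w ν : ℝ) • ν

/-- `f ∈ H¹(U)` with weak gradient `g`. -/
structure IsH1 {d : ℕ} (U : Set (Space d)) (f : Space d → ℝ) (g : Space d → Space d) : Prop where
  memLp : MemLp f 2 (volume.restrict U)
  grad_memLp : MemLp g 2 (volume.restrict U)
  weak : ∀ χ : Space d → ℝ, ContDiff ℝ ∞ χ → HasCompactSupport χ → tsupport χ ⊆ U →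
    ∀ v : Space d, ∫ x in U, f x * fderiv ℝ χ x v = - ∫ x in U, (inner ℝ (g x) v : ℝ) * χ x

/-- `w ∈ H¹(U)^d`, where `gw j` is the weak gradient of the `j`-th component of `w`. -/
def IsH1Vec {d : ℕ} (U : Set (Space d)) (w : Space d → Space d)
    (gw : Fin d → Space d → Space d) : Prop :=
  ∀ j, IsH1 U (fun x => w x j) (gw j)

/-- Divergence of a vector field, from the gradients of its components. -/
def divg {d : ℕ} (gw : Fin d → Space d → Space d) (x : Space d) : ℝ := ∑ j, gw j x j

/-- Entry `(i, j)` of the symmetric gradient `S(w) = (∇w + ∇wᵀ) / 2`. -/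
def symGrad {d : ℕ} (gw : Fin d → Space d → Space d) (x : Space d) (i j : Fin d) : ℝ :=
  (gw i x j + gw j x i) / 2

/-- The contraction `S(w) : S(z)`. -/
def symDot {d : ℕ} (gw gz : Fin d → Space d → Space d) (x : Space d) : ℝ :=
  ∑ i, ∑ j, symGrad gw x i j * symGrad gz x i j

/-- `(w · ∇) z`. -/
def advect {d : ℕ} (w : Space d → Space d) (gz : Fin d → Space d → Space d) (x : Space d) :
    Space d :=
  WithLp.toLp 2 fun j => (inner ℝ (w x) (gz j x) : ℝ)

/-- `w · n = 0` on `∂U`, as the vanishing of the normal trace: the Green formula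
`∫_U w · ∇χ + χ div w = 0` holds for all `χ ∈ H¹(U)`. -/
def HasZeroNormalTrace {d : ℕ} (U : Set (Space d)) (w : Space d → Space d)
    (gw : Fin d → Space d → Space d) : Prop :=
  ∀ (χ : Space d → ℝ) (gχ : Space d → Space d), IsH1 U χ gχ →
    ∫ x in U, ((inner ℝ (w x) (gχ x) : ℝ) + divg gw x * χ x) = 0

/-- `f ∈ H¹(U)`, with weak gradient `g`, has zero trace on the part `A` of the boundary of `U`: it is
the `H¹(U)`-limit of smooth functions whose restrictions to `A` tend to `0` in `L²(A)`. -/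
def IsH1ZeroOn {d : ℕ} (U A : Set (Space d)) (f : Space d → ℝ) (g : Space d → Space d) : Prop :=
  IsH1 U f g ∧ ∃ F : ℕ → Space d → ℝ, (∀ k, ContDiff ℝ ∞ (F k)) ∧
    Tendsto (fun k => eLpNorm (fun x => F k x - f x) 2 (volume.restrict U)) atTop (𝓝 0) ∧
    Tendsto (fun k => eLpNorm (fun x => gradient (F k) x - g x) 2 (volume.restrict U))
      atTop (𝓝 0) ∧
    Tendsto (fun k => eLpNorm (F k) 2 (surface A)) atTop (𝓝 0)

/-- `t ↦ f t` is continuous on `I` with values in `L²(m)`. -/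
def L2ContinuousOn {X F : Type*} [MeasurableSpace X] [NormedAddCommGroup F] (m : Measure X)
    (f : ℝ → X → F) (I : Set ℝ) : Prop :=
  ∀ t ∈ I, Tendsto (fun s => eLpNorm (fun x => f s x - f t x) 2 m) (𝓝[I] t) (𝓝 0)

/-- `t ↦ f t` is differentiable at `t` with values in `L²(m)`, with derivative `f'`. -/
def L2HasDerivAt {X F : Type*} [MeasurableSpace X] [NormedAddCommGroup F] [NormedSpace ℝ F]
    (m : Measure X) (f : ℝ → X → F) (f' : X → F) (t : ℝ) : Prop :=
  Tendsto (fun s => eLpNorm (fun x => (s - t)⁻¹ • (f s x - f t x) - f' x) 2 m) (𝓝[≠] t) (𝓝 0)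

/-! ### Constitutive relations -/

/-- The double well potential. -/
def doubleWell (ξ : ℝ) : ℝ :=
  if ξ < -1 then (ξ + 1) ^ 2 else if ξ ≤ 1 then (1 - ξ ^ 2) ^ 2 / 4 else (ξ - 1) ^ 2

/-- The interface energy density with equilibrium contact angle `θ`. -/
def wallEnergy (θ s : ℝ) : ℝ := Real.cos θ / 2 * Real.sin (Real.pi * s / 2)

/-- The regularised boundary derivative `ψ`, where `ℓ` is the length scale. -/
def psi (ℓ δ s : ℝ) : ℝ := 1 / ℓ * (1 / δ) * Real.exp (-s ^ 2 / (2 * δ))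

/-- The parameters of the model. -/
structure Params where
  /-- surface tension -/
  γ : ℝ
  /-- interface thickness -/
  δ : ℝ
  /-- boundary relaxation parameter -/
  α : ℝ
  /-- charge regularisation parameter -/
  lam : ℝ
  /-- equilibrium contact angle -/
  θs : ℝ
  /-- length scale in `ψ` -/
  ls : ℝ
  /-- permittivity of the plates -/
  εD : ℝ
  /-- density -/
  ρ : ℝ → ℝ
  /-- viscosity -/
  η : ℝ → ℝ
  /-- mobility -/
  M : ℝ → ℝ
  /-- conductivity -/
  K : ℝ → ℝ
  /-- slip coefficient -/
  β : ℝ → ℝ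
  /-- permittivity of the fluids -/
  ε : ℝ → ℝ

/-- A phase-dependent material quantity: continuous, with values in a bounded range of positive
numbers. -/
def IsMaterialLaw (f : ℝ → ℝ) : Prop :=
  Continuous f ∧ ∃ a b : ℝ, 0 < a ∧ ∀ s, a ≤ f s ∧ f s ≤ b

/-- Admissible parameters. -/
structure Params.Admissible (P : Params) : Prop where
  γ_pos : 0 < P.γ
  δ_pos : 0 < P.δ
  α_pos : 0 < P.α
  lam_pos : 0 < P.lam
  ls_pos : 0 < P.ls
  εD_pos : 0 < P.εD
  ρ_law : IsMaterialLaw P.ρ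
  ρ_smooth : ContDiff ℝ 1 P.ρ
  η_law : IsMaterialLaw P.η
  M_law : IsMaterialLaw P.M
  K_law : IsMaterialLaw P.K
  β_law : IsMaterialLaw P.β
  ε_law : IsMaterialLaw P.ε
  ε_smooth : ContDiff ℝ 1 P.ε

open Classical in
/-- The permittivity `ε⋆(φ)`: `ε(φ)` in `Ω` and `ε_D` in the plates. -/
def Params.epsStar (P : Params) {d : ℕ} (Ω : Set (Space d)) (φ : Space d → ℝ) (x : Space d) : ℝ :=
  if x ∈ Ω then P.ε (φ x) else P.εD

/-! ### Solutions -/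

/-- The applied voltage, extended to the whole of `Ω⋆`, with its spatial gradient, its time
derivative and the spatial gradient of the latter. -/
structure Voltage (d : ℕ) where
  V0 : ℝ → Space d → ℝ
  gV0 : ℝ → Space d → Space d
  V0t : ℝ → Space d → ℝ
  gV0t : ℝ → Space d → Space d

/-- Regularity of the applied voltage on `[0, T]`: it is continuous on `[0, T]` and differentiable on
`(0, T)` with values in `H¹(Ω⋆)`, the derivative being square integrable in time. -/
structure Voltage.Regular {d : ℕ} (B : Voltage d) (T : ℝ) (Ω Ωs : Set (Space d)) : Prop where
  h1 : ∀ t ∈ Icc 0 T, IsH1 Ωs (B.V0 t) (B.gV0 t)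
  h1_deriv : ∀ t ∈ Ioo 0 T, IsH1 Ωs (B.V0t t) (B.gV0t t)
  cont : L2ContinuousOn (volume.restrict Ωs) B.V0 (Icc 0 T)
  cont_grad : L2ContinuousOn (volume.restrict Ωs) B.gV0 (Icc 0 T)
  deriv : ∀ t ∈ Ioo 0 T, L2HasDerivAt (volume.restrict Ωs) B.V0 (B.V0t t) t
  deriv_grad : ∀ t ∈ Ioo 0 T, L2HasDerivAt (volume.restrict Ωs) B.gV0 (B.gV0t t) t
  sq_int : IntervalIntegrable (fun t => ∫ x in Ω, B.V0t t x ^ 2) volume 0 T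
  sq_int_grad : IntervalIntegrable (fun t => ∫ x in Ωs, ‖B.gV0t t x‖ ^ 2) volume 0 T

/-- The unknowns, as functions of time and space, together with the time derivatives (`φt`, `ut`,
`qt`, and `gVt` for that of `∇V`) and the spatial gradients (prefix `g`) that occur in the
equations; `gu t j` is the gradient of the `j`-th component of the velocity. -/
structure Fields (d : ℕ) where
  φ : ℝ → Space d → ℝ
  gφ : ℝ → Space d → Space d
  φt : ℝ → Space d → ℝ
  gφt : ℝ → Space d → Space d
  μ : ℝ → Space d → ℝ
  gμ : ℝ → Space d → Space d
  u : ℝ → Space d → Space d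
  gu : ℝ → Fin d → Space d → Space d
  ut : ℝ → Space d → Space d
  p : ℝ → Space d → ℝ
  q : ℝ → Space d → ℝ
  gq : ℝ → Space d → Space d
  qt : ℝ → Space d → ℝ
  V : ℝ → Space d → ℝ
  gV : ℝ → Space d → Space d
  gVt : ℝ → Space d → Space d

/-- The regularity asked of a solution on `[0, T]`. -/
structure Fields.Regular {d : ℕ} (F : Fields d) (T : ℝ) (Ω Ωs : Set (Space d)) : Prop where
  -- phase field
  φ_cont : ContinuousOn (fun z : ℝ × Space d => F.φ z.1 z.2) (Icc 0 T ×ˢ closure Ω)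
  φ_deriv : ∀ t ∈ Ioo 0 T, ∀ x ∈ closure Ω, HasDerivAt (fun s => F.φ s x) (F.φt t x) t
  φt_cont : ContinuousOn (fun z : ℝ × Space d => F.φt z.1 z.2) (Ioo 0 T ×ˢ closure Ω)
  φ_h1 : ∀ t ∈ Icc 0 T, IsH1 Ω (F.φ t) (F.gφ t)
  φt_h1 : ∀ t ∈ Ioo 0 T, IsH1 Ω (F.φt t) (F.gφt t)
  gφ_cont : L2ContinuousOn (volume.restrict Ω) F.gφ (Icc 0 T)
  gφ_deriv : ∀ t ∈ Ioo 0 T, L2HasDerivAt (volume.restrict Ω) F.gφ (F.gφt t) t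
  -- chemical potential
  μ_h1 : ∀ t ∈ Ioo 0 T, IsH1 Ω (F.μ t) (F.gμ t)
  -- velocity
  u_cont : ContinuousOn (fun z : ℝ × Space d => F.u z.1 z.2) (Icc 0 T ×ˢ closure Ω)
  u_deriv : ∀ t ∈ Ioo 0 T, ∀ x ∈ closure Ω, HasDerivAt (fun s => F.u s x) (F.ut t x) t
  ut_cont : ContinuousOn (fun z : ℝ × Space d => F.ut z.1 z.2) (Ioo 0 T ×ˢ closure Ω)
  u_h1 : ∀ t ∈ Ioo 0 T, IsH1Vec Ω (F.u t) (F.gu t)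
  -- pressure
  p_memLp : ∀ t ∈ Ioo 0 T, MemLp (F.p t) 2 (volume.restrict Ω)
  -- charge
  q_memLp : ∀ t ∈ Icc 0 T, MemLp (F.q t) 2 (volume.restrict Ω)
  qt_memLp : ∀ t ∈ Ioo 0 T, MemLp (F.qt t) 2 (volume.restrict Ω)
  q_h1 : ∀ t ∈ Ioo 0 T, IsH1 Ω (F.q t) (F.gq t)
  q_cont : L2ContinuousOn (volume.restrict Ω) F.q (Icc 0 T)
  q_deriv : ∀ t ∈ Ioo 0 T, L2HasDerivAt (volume.restrict Ω) F.q (F.qt t) t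
  -- voltage
  V_h1 : ∀ t ∈ Icc 0 T, IsH1 Ωs (F.V t) (F.gV t)
  gVt_memLp : ∀ t ∈ Ioo 0 T, MemLp (F.gVt t) 2 (volume.restrict Ωs)
  gV_cont : L2ContinuousOn (volume.restrict Ωs) F.gV (Icc 0 T)
  gV_deriv : ∀ t ∈ Ioo 0 T, L2HasDerivAt (volume.restrict Ωs) F.gV (F.gVt t) t

/-- The tangential field `b` that stands for the tangential derivative of the phase field on the
boundary: either it is `∂_τ φ` itself (if `∇φ` has continuous boundary values), or it is `ψ(φ) τ` for
a unit tangential field `τ`. -/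
def IsTangentialClosure {d : ℕ} (P : Params) (T : ℝ) (Ω : Set (Space d)) (n : Space d → Space d)
    (F : Fields d) (b : ℝ → Space d → Space d) : Prop :=
  (∀ t ∈ Ioo 0 T, ContinuousOn (F.gφ t) (closure Ω) ∧
      ∀ x ∈ frontier Ω, b t x = tang (n x) (F.gφ t x)) ∨
  (∃ τ : Space d → Space d, Measurable τ ∧
      (∀ᵐ x ∂(surface (frontier Ω)), ‖τ x‖ = 1 ∧ (inner ℝ (τ x) (n x) : ℝ) = 0) ∧
      ∀ t ∈ Ioo 0 T, ∀ x ∈ frontier Ω, b t x = psi P.ls P.δ (F.φ t x) • τ x)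

/-- First phase field equation: `φ_t + u · ∇φ = div (M(φ) ∇μ)`, `M(φ) ∂_n μ = 0`. -/
def PhaseEq {d : ℕ} (P : Params) (Ω : Set (Space d)) (F : Fields d) (t : ℝ) : Prop :=
  ∀ (v : Space d → ℝ) (gv : Space d → Space d), IsH1 Ω v gv →
    (∫ x in Ω, F.φt t x * v x) + (∫ x in Ω, (inner ℝ (F.u t x) (F.gφ t x) : ℝ) * v x)
      + (∫ x in Ω, P.M (F.φ t x) * (inner ℝ (F.gμ t x) (gv x) : ℝ)) = 0

/-- Equation for the chemical potential,
`μ = γ (W'(φ)/δ - δ Δφ) - ε'(φ) |∇V|² / 2 + ρ'(φ) |u|² / 2`, with the dynamic boundary condition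
`α (φ_t + u_τ · b) + γ (Θ'(φ) + δ ∂_n φ) = 0`. -/
def ChemEq {d : ℕ} (P : Params) (Ω : Set (Space d)) (n : Space d → Space d) (F : Fields d)
    (b : ℝ → Space d → Space d) (t : ℝ) : Prop :=
  ∀ (v : Space d → ℝ) (gv : Space d → Space d), IsH1 Ω v gv → ContinuousOn v (closure Ω) →
    ∫ x in Ω, F.μ t x * v x =
      P.γ / P.δ * (∫ x in Ω, deriv doubleWell (F.φ t x) * v x)
      + P.γ * P.δ * (∫ x in Ω, (inner ℝ (F.gφ t x) (gv x) : ℝ))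
      - 1 / 2 * (∫ x in Ω, deriv P.ε (F.φ t x) * ‖F.gV t x‖ ^ 2 * v x)
      + 1 / 2 * (∫ x in Ω, deriv P.ρ (F.φ t x) * ‖F.u t x‖ ^ 2 * v x)
      + P.α * (∫ x, (F.φt t x + (inner ℝ (tang (n x) (F.u t x)) (b t x) : ℝ)) * v x
          ∂(surface (frontier Ω)))
      + P.γ * (∫ x, deriv (wallEnergy P.θs) (F.φ t x) * v x ∂(surface (frontier Ω)))

/-- The material term `σ (σ u)_t + ρ u · ∇u + div (ρ u) u / 2` of the momentum equation, where
`σ = √ρ(φ)`. -/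
def materialDeriv {d : ℕ} (P : Params) (F : Fields d) (t : ℝ) (x : Space d) : Space d :=
  √(P.ρ (F.φ t x)) • deriv (fun s => √(P.ρ (F.φ s x)) • F.u s x) t
    + P.ρ (F.φ t x) • advect (F.u t) (F.gu t) x
    + ((1 / 2 : ℝ) * (deriv P.ρ (F.φ t x) * (inner ℝ (F.gφ t x) (F.u t x) : ℝ)
        + P.ρ (F.φ t x) * divg (F.gu t) x)) • F.u t x

/-- Momentum equation with viscous stress `η(φ) S(u)`, pressure, the capillary and electric forces,
and the generalised Navier condition
`β(φ) u_τ + η(φ) S(u)_{nτ} = γ (Θ'(φ) + δ ∂_n φ) b`. -/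
def MomentumEq {d : ℕ} (P : Params) (Ω : Set (Space d)) (n : Space d → Space d) (F : Fields d)
    (b : ℝ → Space d → Space d) (t : ℝ) : Prop :=
  ∀ (w : Space d → Space d) (gw : Fin d → Space d → Space d), IsH1Vec Ω w gw →
    ContinuousOn w (closure Ω) → HasZeroNormalTrace Ω w gw →
    (∫ x in Ω, (inner ℝ (materialDeriv P F t x) (w x) : ℝ))
      + (∫ x in Ω, P.η (F.φ t x) * symDot (F.gu t) gw x)
      - (∫ x in Ω, F.p t x * divg gw x)
      + (∫ x, P.β (F.φ t x) * (inner ℝ (tang (n x) (F.u t x)) (tang (n x) (w x)) : ℝ)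
          ∂(surface (frontier Ω)))
      + P.α * (∫ x, (inner ℝ (tang (n x) (F.u t x)) (b t x) : ℝ)
          * (inner ℝ (tang (n x) (w x)) (b t x) : ℝ) ∂(surface (frontier Ω)))
    = (∫ x in Ω, F.μ t x * (inner ℝ (F.gφ t x) (w x) : ℝ))
      - (∫ x in Ω, F.q t x * (inner ℝ (P.lam • F.gq t x + F.gV t x) (w x) : ℝ))
      + 1 / 2 * (∫ x in Ω, deriv P.ρ (F.φ t x) * F.φt t x * (inner ℝ (F.u t x) (w x) : ℝ))
      - P.α * (∫ x, F.φt t x * (inner ℝ (tang (n x) (w x)) (b t x) : ℝ)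
          ∂(surface (frontier Ω)))

/-- Charge equation: `q_t + div (q u) = div (K(φ) ∇(λ q + V))`, `K(φ) ∇(λ q + V) · n = 0`. -/
def ChargeEq {d : ℕ} (P : Params) (Ω : Set (Space d)) (F : Fields d) (t : ℝ) : Prop :=
  ∀ (r : Space d → ℝ) (gr : Space d → Space d), IsH1 Ω r gr →
    (∫ x in Ω, F.qt t x * r x) - (∫ x in Ω, F.q t x * (inner ℝ (F.u t x) (gr x) : ℝ))
      + (∫ x in Ω, P.K (F.φ t x) * (inner ℝ (P.lam • F.gq t x + F.gV t x) (gr x) : ℝ)) = 0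

/-- Voltage equation: `-div (ε⋆(φ) ∇V) = q χ_Ω` in `Ω⋆`, `∂_n V = 0` on `∂Ω⋆ ∩ Γ`. -/
def PotentialEq {d : ℕ} (P : Params) (Ω Ωs : Set (Space d)) (F : Fields d) (t : ℝ) : Prop :=
  ∀ (W : Space d → ℝ) (gW : Space d → Space d),
    IsH1ZeroOn Ωs (frontier Ωs \ frontier Ω) W gW →
    ∫ x in Ωs, P.epsStar Ω (F.φ t) x * (inner ℝ (F.gV t x) (gW x) : ℝ) = ∫ x in Ω, F.q t x * W x

/-- `F` is a (regular, weak) solution on `[0, T]` of the electrowetting system in `Ω ⊆ Ω⋆`, with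
applied voltage `B`; `n` is the outer normal on `∂Ω`, and `b` the tangential field in the boundary
conditions. -/
structure IsSolution {d : ℕ} (P : Params) (T : ℝ) (Ω Ωs : Set (Space d)) (n : Space d → Space d)
    (B : Voltage d) (b : ℝ → Space d → Space d) (F : Fields d) : Prop where
  regular : F.Regular T Ω Ωs
  closure_b : IsTangentialClosure P T Ω n F b
  phase : ∀ t ∈ Ioo 0 T, PhaseEq P Ω F t
  chem : ∀ t ∈ Ioo 0 T, ChemEq P Ω n F b t
  momentum : ∀ t ∈ Ioo 0 T, MomentumEq P Ω n F b t
  incompressible : ∀ t ∈ Ioo 0 T, ∀ᵐ x ∂(volume.restrict Ω), divg (F.gu t) x = 0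
  impermeable : ∀ t ∈ Ioo 0 T, HasZeroNormalTrace Ω (F.u t) (F.gu t)
  charge : ∀ t ∈ Ioo 0 T, ChargeEq P Ω F t
  potential : ∀ t ∈ Ioo 0 T, PotentialEq P Ω Ωs F t
  voltage : ∀ t ∈ Icc 0 T, IsH1ZeroOn Ωs (frontier Ωs \ frontier Ω)
    (fun x => F.V t x - B.V0 t x) (fun x => F.gV t x - B.gV0 t x)

/-! ### The quantities in the energy estimate -/

/-- The interface energy density, shifted by a constant so that its minimum over `ℝ` is `0`. -/
def wallEnergyNorm (θ s : ℝ) : ℝ := wallEnergy θ s + |Real.cos θ| / 2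

/-- The phase energy `γ ∫_Ω (δ/2 |∇φ|² + W(φ)/δ) + γ ∫_Γ (Θ(φ) + |cos θ_s| / 2)`. -/
def phaseEnergy {d : ℕ} (P : Params) (Ω : Set (Space d)) (F : Fields d) (t : ℝ) : ℝ :=
  P.γ * (∫ x in Ω, (P.δ / 2 * ‖F.gφ t x‖ ^ 2 + 1 / P.δ * doubleWell (F.φ t x)))
    + P.γ * (∫ x, wallEnergyNorm P.θs (F.φ t x) ∂(surface (frontier Ω)))

/-- The energy on the left of the estimate. -/
def energy {d : ℕ} (P : Params) (Ω Ωs : Set (Space d)) (F : Fields d) (t : ℝ) : ℝ :=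
  (∫ x in Ω, (1 / 2 * P.ρ (F.φ t x) * ‖F.u t x‖ ^ 2 + P.lam / 4 * F.q t x ^ 2))
    + phaseEnergy P Ω F t
    + (∫ x in Ωs, 1 / 4 * P.epsStar Ω (F.φ t) x * ‖F.gV t x‖ ^ 2)

/-- The rate of dissipation. -/
def dissipation {d : ℕ} (P : Params) (Ω : Set (Space d)) (n : Space d → Space d) (F : Fields d)
    (b : ℝ → Space d → Space d) (t : ℝ) : ℝ :=
  (∫ x in Ω, (P.η (F.φ t x) * symDot (F.gu t) (F.gu t) x + P.M (F.φ t x) * ‖F.gμ t x‖ ^ 2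
      + P.K (F.φ t x) * ‖P.lam • F.gq t x + F.gV t x‖ ^ 2))
    + (∫ x, (P.β (F.φ t x) * ‖tang (n x) (F.u t x)‖ ^ 2
        + P.α * (F.φt t x + (inner ℝ (tang (n x) (F.u t x)) (b t x) : ℝ)) ^ 2)
        ∂(surface (frontier Ω)))

/-- The contribution of the initial data. -/
def initialEnergy {d : ℕ} (P : Params) (εM : ℝ) (Ω Ωs : Set (Space d)) (B : Voltage d)
    (F : Fields d) : ℝ :=
  (∫ x in Ω, (1 / 2 * P.ρ (F.φ 0 x) * ‖F.u 0 x‖ ^ 2 + (1 + P.lam) / 2 * F.q 0 x ^ 2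
      + 1 / 2 * B.V0 0 x ^ 2))
    + phaseEnergy P Ω F 0
    + (∫ x in Ωs, (P.epsStar Ω (F.φ 0) x * ‖F.gV 0 x‖ ^ 2 + εM * ‖B.gV0 0 x‖ ^ 2))

/-- The contribution of the applied voltage at time `t`. -/
def voltageSize {d : ℕ} (P : Params) (εM : ℝ) (Ω Ωs : Set (Space d)) (B : Voltage d) (t : ℝ) : ℝ :=
  (∫ x in Ωs, εM * ‖B.gV0 t x‖ ^ 2) + (∫ x in Ω, 1 / P.lam * B.V0 t x ^ 2)

/-- The contribution of the rate of change of the applied voltage at time `t`. -/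
def voltageRate {d : ℕ} (P : Params) (εM : ℝ) (Ω Ωs : Set (Space d)) (B : Voltage d) (t : ℝ) : ℝ :=
  (∫ x in Ωs, εM * ‖B.gV0t t x‖ ^ 2) + 4 / P.lam * (∫ x in Ω, B.V0t t x ^ 2)

end Electrowetting

end

/-! The estimate is an energy law followed by absorption. The phase equation is tested with `μ`, the
equation of `μ` with `φ_t`, the momentum equation with `u`, and the charge equation with `λ q + V`.
The voltage equation is differentiated in time and tested with `V - V₀`, since `V` itself does not
vanish on the electrode part of the boundary. Transport and capillary force cancel, as do charge
convection and electric force, the two `ρ'` terms, and the `ε'` term against the variation of the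
field energy. On the boundary the relaxation terms complete the square `α |φ_t + u_τ · b|²`. What
remains (`energy_identity`) is `G' = R - D` with `D` the dissipation. Here `G` is the full energy,
with coefficients `λ/2` and `1/2` for charge and field, corrected by `∫ q V₀ - ∫ ε⋆ ∇V · ∇V₀`, and
`R` is the same pairing with the time derivative of `V₀`.

Half of the charge and field energy in `G` pays, through Young's inequality, for the correction. The
other half is what the energy `E` of the theorem keeps. Hence `E ≤ G +` voltage data, and `G(0)` is
bounded by the initial data. The power satisfies `|R| ≤ E / (4T) + 4T ·` (voltage rate), so after
integration the supremum of `E` returns with factor `1/4` and is absorbed. This gives dependence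
linear in `T`, with no Gronwall exponential.

Four analytic facts support this. The inertial terms form a time derivative plus half the divergence
of `ρ |u|² u`. To drop the divergence, `ρ(φ) |u|²` must be a test function in the Green formula for
`u · n = 0`, which needs the weak chain rule `IsH1.comp_contDiff`. Boundary integrals of bounded
functions need finite surface measure, obtained for convex sets by an expanding map onto the surface
of a cube. Time derivatives of integrals come from differentiating in the Hilbert space `L²`
(`L2Curve`), with coefficients that vary uniformly in space (`UniformCurve`). Finally, `D` is not
assumed measurable or integrable in time: both follow from the energy law, by truncation and
monotone convergence (`integrableOn_of_hasDerivAt_sub`). -/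

namespace Electrowetting

/-! ### The boundary of a bounded convex domain has finite surface measure -/

section Surface

/-- Every boundary point of an open convex set has a nonzero outer normal. -/
theorem exists_outer_normal {d : ℕ} {U : Set (Space d)} (hU : IsConvexDomain U) {x : Space d}
    (hx : x ∈ frontier U) :
    ∃ ν : Space d, ν ≠ 0 ∧ ∀ y ∈ closure U, inner ℝ ν (y - x) ≤ 0 := by
  have hxU : x ∉ U := by
    rw [hU.isOpen.frontier_eq] at hx
    exact hx.2
  obtain ⟨f, hf⟩ := geometric_hahn_banach_open_point hU.convex hU.isOpen hxU
  refine ⟨(InnerProductSpace.toDual ℝ (Space d)).symm f, ?_, ?_⟩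
  · intro h
    obtain ⟨a, ha⟩ := hU.nonempty
    have h0 : f = 0 := by simpa using h
    have := hf a ha
    simp [h0] at this
  · intro y hy
    rw [InnerProductSpace.toDual_symm_apply, map_sub, sub_nonpos]
    have hcl : IsClosed {y | f y ≤ f x} := isClosed_le f.continuous continuous_const
    exact closure_minimal (fun a ha => (hf a ha).le) hcl hy

/-- The boundary of the cube `[-R, R]^d`. -/
def cubeBoundary (d : ℕ) (R : ℝ) : Set (Space d) := {z | ‖WithLp.ofLp z‖ = R}

/-- Along the ray the sup norm starts at most `R`. Once the displacement has sup norm `2R`, the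
reverse triangle inequality makes it at least `R`, and the intermediate value theorem gives the
hitting point. -/
theorem exists_ray_mem_cubeBoundary {d : ℕ} {R : ℝ} {x ν : Space d} (hν : ν ≠ 0)
    (hx : ‖WithLp.ofLp x‖ ≤ R) : ∃ s : ℝ, 0 ≤ s ∧ x + s • ν ∈ cubeBoundary d R := by
  have hν' : 0 < ‖WithLp.ofLp ν‖ := by
    rw [norm_pos_iff]
    intro h
    exact hν (by ext i; simpa using congrFun h i)
  set N : ℝ → ℝ := fun s => ‖WithLp.ofLp (x + s • ν)‖ with hN
  have hc : Continuous N := by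
    refine continuous_norm.comp ((PiLp.continuous_ofLp 2 _).comp ?_)
    fun_prop
  set b : ℝ := (2 * R) / ‖WithLp.ofLp ν‖ with hb
  have hR : 0 ≤ R := (norm_nonneg _).trans hx
  have hb0 : 0 ≤ b := by positivity
  have h0 : N 0 ≤ R := by simpa [hN] using hx
  have h1 : R ≤ N b := by
    have e : WithLp.ofLp (x + b • ν) = b • WithLp.ofLp ν - (-WithLp.ofLp x) := by
      simp [add_comm]
    have e2 : ‖b • WithLp.ofLp ν‖ = 2 * R := by
      rw [norm_smul, Real.norm_of_nonneg hb0, hb]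
      field_simp
    have := norm_sub_norm_le (b • WithLp.ofLp ν) (-WithLp.ofLp x)
    rw [← e, e2, norm_neg] at this
    simp only [hN]
    linarith
  obtain ⟨s, hs, hs'⟩ := intermediate_value_Icc hb0 hc.continuousOn ⟨h0, h1⟩
  exact ⟨s, hs.1, hs'⟩

/-- Moving along outer normals increases distances. -/
theorem dist_le_dist_add_normal {d : ℕ} {x x' ν ν' : Space d} {s s' : ℝ} (hs : 0 ≤ s) (hs' : 0 ≤ s')
    (h : inner ℝ ν (x' - x) ≤ 0) (h' : inner ℝ ν' (x - x') ≤ 0) :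
    dist x x' ≤ dist (x + s • ν) (x' + s' • ν') := by
  rw [dist_eq_norm, dist_eq_norm]
  have e : x + s • ν - (x' + s' • ν') = (x - x') + (s • ν - s' • ν') := by abel
  rw [e]
  refine le_of_sq_le_sq ?_ (norm_nonneg _) 
  rw [norm_add_sq_real]
  -- Each normal points away from the other point, so the cross term in the expanded square is
  -- nonnegative.
  have h2 : 0 ≤ inner ℝ (x - x') (s • ν - s' • ν') := by
    rw [inner_sub_right, inner_smul_right, inner_smul_right, real_inner_comm, real_inner_comm ν']
    have : inner ℝ ν (x - x') = - inner ℝ ν (x' - x) := by rw [← inner_neg_right, neg_sub]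
    rw [this]
    nlinarith [mul_nonneg hs (neg_nonneg.2 h), mul_nonneg hs' (neg_nonneg.2 h')]
  nlinarith [sq_nonneg ‖s • ν - s' • ν'‖]

/-- Every face is a Lipschitz image of a ball of `Fin m → ℝ` with the sup norm, where the
`m`-dimensional Hausdorff measure is Lebesgue measure. -/
theorem hausdorffMeasure_cubeBoundary_lt_top (m : ℕ) (R : ℝ) :
    (Measure.hausdorffMeasure (m : ℝ) : Measure (Space (m + 1))) (cubeBoundary (m + 1) R) < ⊤ := by
  set f : Fin (m + 1) → ℝ → (Fin m → ℝ) → Space (m + 1) :=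
    fun i a y => WithLp.toLp 2 (Fin.insertNth (α := fun _ => ℝ) i a y) with hf
  have hlip : ∀ i a, ∃ K, LipschitzWith K (f i a) := by
    intro i a
    refine ⟨_, (PiLp.lipschitzWith_toLp 2 (fun _ : Fin (m + 1) => ℝ)).comp
      (LipschitzWith.of_dist_le_mul (K := 1) fun y z => ?_)⟩
    rw [NNReal.coe_one, one_mul, dist_pi_le_iff dist_nonneg]
    intro j
    refine Fin.succAboveCases i ?_ (fun k => ?_) j
    · simp
    · simpa using dist_le_pi_dist y z k
  have hsub : cubeBoundary (m + 1) R ⊆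
      ⋃ i, (f i R '' Metric.closedBall 0 R ∪ f i (-R) '' Metric.closedBall 0 R) := by
    intro z hz
    have hz' : ‖WithLp.ofLp z‖ = R := hz
    obtain ⟨i, hi⟩ : ∃ i, ‖z i‖ = R := by
      by_contra! hcon
      have hR0 : 0 ≤ R := hz' ▸ norm_nonneg _
      have hlt : ∀ i, ‖WithLp.ofLp z i‖ < R := fun i =>
        lt_of_le_of_ne (hz' ▸ norm_le_pi_norm _ i) (hcon i)
      have hRpos : 0 < R := (norm_nonneg _).trans_lt (hlt 0)
      exact absurd hz' ((pi_norm_lt_iff hRpos).2 hlt).ne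
    refine mem_iUnion.2 ⟨i, ?_⟩
    have hmem : i.removeNth (WithLp.ofLp z) ∈ Metric.closedBall (0 : Fin m → ℝ) R := by
      rw [mem_closedBall_zero_iff, pi_norm_le_iff_of_nonneg (hz' ▸ norm_nonneg _)]
      intro j
      exact hz' ▸ norm_le_pi_norm (WithLp.ofLp z) (i.succAbove j)
    have hrec : f i (z i) (i.removeNth (WithLp.ofLp z)) = z := by
      simp [hf]
    rcases eq_or_eq_neg_of_abs_eq hi with h | h
    · exact Or.inl ⟨_, hmem, by rw [← h]; exact hrec⟩
    · exact Or.inr ⟨_, hmem, by rw [← h]; exact hrec⟩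
  refine (measure_mono hsub).trans_lt ((measure_iUnion_le _).trans_lt ?_)
  rw [tsum_fintype]
  refine ENNReal.sum_lt_top.2 fun i _ => (measure_union_le _ _).trans_lt (ENNReal.add_lt_top.2 ?_)
  have key : ∀ a, (Measure.hausdorffMeasure (m : ℝ) : Measure (Space (m + 1)))
      (f i a '' Metric.closedBall 0 R) < ⊤ := by
    intro a
    obtain ⟨K, hK⟩ := hlip i a
    refine (hK.hausdorffMeasure_image_le (Nat.cast_nonneg m) _).trans_lt ?_
    have hv : (Measure.hausdorffMeasure (m : ℝ) : Measure (Fin m → ℝ)) = volume := by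
      simpa using hausdorffMeasure_pi_real (ι := Fin m)
    rw [hv]
    exact ENNReal.mul_lt_top (ENNReal.rpow_lt_top_of_nonneg (Nat.cast_nonneg m) ENNReal.coe_ne_top)
      measure_closedBall_lt_top
  exact ⟨key R, key (-R)⟩

/-- Pushing each boundary point along an outer normal until it meets the surface of a large cube
does not decrease distances. The inverse of this map is therefore 1-Lipschitz, and the Hausdorff
measure of the boundary is at most that of the cube surface. -/
theorem euclideanHausdorffMeasure_frontier_lt_top {m : ℕ} {U : Set (Space (m + 1))}
    (hU : IsConvexDomain U) : (μHE[m] : Measure (Space (m + 1))) (frontier U) < ⊤ := by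
  obtain ⟨R, hR⟩ := hU.bounded.closure.exists_norm_le
  have hR' : ∀ x ∈ frontier U, ‖WithLp.ofLp x‖ ≤ R := fun x hx => by
    refine le_trans ?_ (hR x (frontier_subset_closure hx))
    refine (pi_norm_le_iff_of_nonneg (norm_nonneg _)).2 fun i => PiLp.norm_apply_le x i
  choose ν hν hνn using fun x : frontier U => exists_outer_normal hU x.2
  choose s hs hsm using fun x : frontier U => exists_ray_mem_cubeBoundary (hν x) (hR' x x.2)
  have hanti : AntilipschitzWith 1 (fun x : frontier U => (x : Space (m + 1)) + s x • ν x) := by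
    refine AntilipschitzWith.of_le_mul_dist fun x y => ?_
    rw [NNReal.coe_one, one_mul]
    exact dist_le_dist_add_normal (hs x) (hs y)
      (hνn x y (frontier_subset_closure y.2)) (hνn y x (frontier_subset_closure x.2))
  -- The expansion bound concerns the measure on the subtype; the isometric inclusion carries it to
  -- the ambient space.
  have h1 := hanti.le_hausdorffMeasure_image (Nat.cast_nonneg m) univ
  have h2 := (isometry_subtype_coe (s := frontier U)).hausdorffMeasure_image
    (Or.inl (Nat.cast_nonneg m)) univ
  rw [image_univ, Subtype.range_coe] at h2
  have h3 : (Measure.hausdorffMeasure (m : ℝ) : Measure (Space (m + 1))) (frontier U) < ⊤ := by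
    rw [h2]
    refine h1.trans_lt ?_
    simp only [ENNReal.coe_one, ENNReal.one_rpow, one_mul]
    refine (measure_mono ?_).trans_lt (hausdorffMeasure_cubeBoundary_lt_top m R)
    rintro _ ⟨x, -, rfl⟩
    exact hsm x
  rw [Measure.euclideanHausdorffMeasure_def]
  exact ENNReal.mul_lt_top ENNReal.coe_lt_top h3

theorem isFiniteMeasure_surface_frontier {d : ℕ} (hd : 0 < d) {U : Set (Space d)}
    (hU : IsConvexDomain U) : IsFiniteMeasure (surface (frontier U)) := by
  obtain ⟨m, rfl⟩ := Nat.exists_eq_succ_of_ne_zero hd.ne'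
  refine ⟨?_⟩
  rw [surface, Measure.restrict_apply_univ]
  exact euclideanHausdorffMeasure_frontier_lt_top hU

end Surface

end Electrowetting

namespace Electrowetting

/-! ### Weakly differentiable functions -/

section Mollification

open scoped Convolution

variable {d : ℕ}

/-- The standard mollifier at scale `1 / (k + 1)`. -/
noncomputable def mollifier (d k : ℕ) : ContDiffBump (0 : Space d) where
  rIn := 1 / (2 * ((k : ℝ) + 1))
  rOut := 1 / ((k : ℝ) + 1)
  rIn_pos := by positivity
  rIn_lt_rOut := by
    have : (0 : ℝ) < (k : ℝ) + 1 := by positivity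
    exact one_div_lt_one_div_of_lt this (by linarith)

theorem tendsto_rOut_mollifier : Tendsto (fun k => (mollifier d k).rOut) atTop (𝓝 0) :=
  tendsto_one_div_add_atTop_nhds_zero_nat

/-- Mollification of a function at scale `1 / (k + 1)`. -/
noncomputable def mollify (k : ℕ) (f : Space d → ℝ) : Space d → ℝ :=
  ((mollifier d k).normed volume ⋆[ContinuousLinearMap.lsmul ℝ ℝ, volume] f)

theorem mollify_apply (k : ℕ) (f : Space d → ℝ) (x : Space d) :
    mollify k f x = ∫ t, (mollifier d k).normed volume t * f (x - t) := by
  simp [mollify, convolution_def]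

theorem mollify_apply_swap (k : ℕ) (f : Space d → ℝ) (x : Space d) :
    mollify k f x = ∫ y, (mollifier d k).normed volume (x - y) * f y := by
  simp [mollify, convolution_eq_swap]

theorem contDiff_mollify (k : ℕ) {f : Space d → ℝ} (hf : Integrable f) :
    ContDiff ℝ ∞ (mollify k f) :=
  (mollifier d k).hasCompactSupport_normed.contDiff_convolution_left _
    (mollifier d k).contDiff_normed hf.locallyIntegrable

theorem abs_mollify_le (k : ℕ) {f : Space d → ℝ} {C : ℝ} (hf : ∀ x, |f x| ≤ C) (x : Space d) :
    |mollify k f x| ≤ C := by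
  rw [mollify_apply]
  have hN : ∫ t, (mollifier d k).normed volume t * C = C := by
    rw [integral_mul_const, (mollifier d k).integral_normed, one_mul]
  have hi : Integrable (fun t => (mollifier d k).normed volume t * C) :=
    (mollifier d k).integrable_normed.mul_const C
  rw [← hN, ← Real.norm_eq_abs]
  refine norm_integral_le_of_norm_le hi (Eventually.of_forall fun t => ?_)
  rw [norm_mul, Real.norm_of_nonneg ((mollifier d k).nonneg_normed t)]
  exact mul_le_mul_of_nonneg_left (hf _) ((mollifier d k).nonneg_normed t)

/-- Both the scale and the mollified function depend on `k`: the chain rule mollifies functions that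
are themselves built from mollifications. Convergence jointly in `k` and the point ensures that the
shrinking averages have the expected limit. -/
theorem tendsto_mollify {x : Space d} {f : ℕ → Space d → ℝ} {z : ℝ}
    (hm : ∀ k, AEStronglyMeasurable (f k)) 
    (hf : Tendsto (Function.uncurry f) (atTop ×ˢ 𝓝 x) (𝓝 z)) :
    Tendsto (fun p : ℕ × Space d => mollify p.1 (f p.1) p.2) (atTop ×ˢ 𝓝 x) (𝓝 z) := by
  refine ContDiffBump.convolution_tendsto_right (φ := fun p : ℕ × Space d => mollifier d p.1)
    (g := fun p => f p.1) (k := Prod.snd) (x₀ := x) (tendsto_rOut_mollifier.comp tendsto_fst)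
    (Eventually.of_forall fun p => hm p.1) ?_ tendsto_snd
  exact hf.comp ((tendsto_fst.comp tendsto_fst).prodMk tendsto_snd)

/-- Mollification is symmetric. -/
theorem integral_mul_mollify (k : ℕ) {ψ g : Space d → ℝ} (hψ : Integrable ψ) (hg : Integrable g) :
    ∫ x, ψ x * mollify k g x = ∫ y, mollify k ψ y * g y := by
  set N := (mollifier d k).normed volume with hN
  have hNc : Continuous N := (mollifier d k).continuous_normed
  have h1 : ∀ x, ψ x * mollify k g x = ∫ y, ψ x * (N (x - y) * g y) := fun x => by
    rw [mollify_apply_swap, integral_const_mul]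
  have h2 : ∀ y, mollify k ψ y * g y = ∫ x, ψ x * (N (x - y) * g y) := fun y => by
    rw [mollify_apply_swap, ← integral_mul_const]
    refine integral_congr_ae (Eventually.of_forall fun x => ?_)
    -- The bump is even, so both sides are the same double integral up to the order of integration.
    have : N (y - x) = N (x - y) := by
      rw [hN, ← (mollifier d k).normed_neg (x - y), neg_sub]
    simp only [← hN, this]
    ring
  simp_rw [h1, h2]
  -- Fubini applies because the kernel is bounded and `ψ x * g y` is integrable on the product.
  refine integral_integral_swap ?_
  obtain ⟨C, hC⟩ := hNc.bounded_above_of_compact_support (mollifier d k).hasCompactSupport_normed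
  have hp : Integrable (fun z : Space d × Space d => ψ z.1 * g z.2) (volume.prod volume) :=
    hψ.mul_prod hg
  have := hp.bdd_mul (f := fun z : Space d × Space d => N (z.1 - z.2)) (c := C)
    (hNc.comp (continuous_fst.sub continuous_snd)).aestronglyMeasurable
    (Eventually.of_forall fun z => hC _)
  refine this.congr (Eventually.of_forall fun z => ?_)
  simp only [Function.uncurry]
  ring

end Mollification

variable {d : ℕ} {U : Set (Space d)}

/-- Moves integrals against test functions between `U` and the whole space, where mollification and
classical integration by parts take place. -/
theorem setIntegral_eq_of_tsupport_subset (hU : IsOpen U) {F : Space d → ℝ}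
    (h : ∀ x, x ∉ U → F x = 0) : ∫ x in U, F x = ∫ x, F x := by
  rw [← integral_indicator hU.measurableSet]
  congr 1
  ext x
  by_cases hx : x ∈ U <;> simp [hx, h x]

theorem fderiv_apply_eq_zero_of_notMem {χ : Space d → ℝ} {x : Space d} (hx : x ∉ tsupport χ)
    (v : Space d) : fderiv ℝ χ x v = 0 := by
  have : x ∉ tsupport (fderiv ℝ χ) := fun h => hx (tsupport_fderiv_subset ℝ h)
  rw [image_eq_zero_of_notMem_tsupport this]
  rfl

theorem continuous_fderiv_apply_const {χ : Space d → ℝ} (hχ : ContDiff ℝ ∞ χ) (v : Space d) :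
    Continuous fun x => fderiv ℝ χ x v :=
  (hχ.continuous_fderiv (by simp)).clm_apply continuous_const

theorem hasCompactSupport_fderiv_apply_const {χ : Space d → ℝ} (hc : HasCompactSupport χ)
    (v : Space d) : HasCompactSupport fun x => fderiv ℝ χ x v :=
  hc.of_isClosed_subset (isClosed_tsupport _) (closure_minimal (fun x hx => by
    by_contra h
    exact hx (fderiv_apply_eq_zero_of_notMem h v)) (isClosed_tsupport _))

/-- The derivative of a mollified weakly differentiable function. -/
theorem fderiv_mollify {f : Space d → ℝ} {g : Space d → Space d} (hU : IsOpen U)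
    (hf : IsH1 U f g) (hfi : IntegrableOn f U) {x : Space d} {k : ℕ}
    (hx : Metric.closedBall x (mollifier d k).rOut ⊆ U) (v : Space d) :
    fderiv ℝ (mollify k (U.indicator f)) x v
      = mollify k (U.indicator fun y => inner ℝ (g y) v) x := by
  set N := (mollifier d k).normed volume with hN
  have hNs : ContDiff ℝ ∞ N := (mollifier d k).contDiff_normed
  have hNc : HasCompactSupport N := (mollifier d k).hasCompactSupport_normed
  have hfi' : Integrable (U.indicator f) := hfi.integrable_indicator hU.measurableSet
  have hder := hNc.hasFDerivAt_convolution_left (μ := volume) (ContinuousLinearMap.lsmul ℝ ℝ)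
    (hNs.of_le (by simp)) hfi'.locallyIntegrable x
  have hconv : ConvolutionExistsAt (fderiv ℝ N) (U.indicator f) x
      (ContinuousLinearMap.precompL (Space d) (ContinuousLinearMap.lsmul ℝ ℝ)) volume :=
    (hNc.fderiv ℝ).convolutionExists_left _ (hNs.continuous_fderiv (by simp))
      hfi'.locallyIntegrable x
  have e1 : fderiv ℝ (mollify k (U.indicator f)) x v
      = ∫ t, fderiv ℝ N t v * U.indicator f (x - t) := by
    have := hder.fderiv
    rw [show mollify k (U.indicator f) = convolution N (U.indicator f)
      (ContinuousLinearMap.lsmul ℝ ℝ) volume from rfl, this, convolution_def,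
      ContinuousLinearMap.integral_apply hconv]
    simp [ContinuousLinearMap.precompL_apply]
  rw [e1, ← integral_sub_left_eq_self _ _ x]
  -- The derivative has fallen on the kernel. The reflected and translated kernel is an admissible
  -- test function, because its support lies in the closed ball around `x` contained in `U`.
  set ζ : Space d → ℝ := fun y => N (x - y) with hζ
  have hζs : ContDiff ℝ ∞ ζ := hNs.comp (contDiff_const.sub contDiff_id)
  have hts : tsupport ζ ⊆ Metric.closedBall x (mollifier d k).rOut := by
    refine closure_minimal (fun y hy => ?_) Metric.isClosed_closedBall
    have : x - y ∈ Function.support N := hy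
    rw [hN, (mollifier d k).support_normed_eq, mem_ball_zero_iff] at this
    rw [Metric.mem_closedBall, dist_comm, dist_eq_norm]
    exact this.le
  have hζc : HasCompactSupport ζ :=
    (isCompact_closedBall _ _).of_isClosed_subset (isClosed_tsupport _) hts
  have hζd : ∀ y, fderiv ℝ ζ y v = - fderiv ℝ N (x - y) v := by
    intro y
    have h1 : HasFDerivAt N (fderiv ℝ N (x - y)) (x - y) :=
      (hNs.differentiable (by simp) _).hasFDerivAt
    have h2 : HasFDerivAt (fun y : Space d => x - y) (-ContinuousLinearMap.id ℝ _) y :=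
      (hasFDerivAt_id y).const_sub x
    have := (h1.comp y h2).fderiv
    rw [show ζ = N ∘ fun y => x - y from rfl, this]
    simp
  have hw := hf.weak ζ hζs hζc (hts.trans hx) v
  have hz : ∀ y, y ∉ U → ζ y = 0 := fun y hy =>
    image_eq_zero_of_notMem_tsupport fun h => hy (hx (hts h))
  simp_rw [hζd] at hw
  rw [mollify_apply_swap]
  have e2 : ∫ y, fderiv ℝ N (x - y) v * U.indicator f (x - (x - y))
      = - ∫ y in U, f y * -fderiv ℝ N (x - y) v := by
    rw [← integral_neg, ← integral_indicator hU.measurableSet]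
    congr 1
    ext y
    by_cases hy : y ∈ U <;> simp [hy, mul_comm]
  rw [e2, hw, neg_neg, ← integral_indicator hU.measurableSet]
  congr 1
  ext y
  by_cases hy : y ∈ U <;> simp [hy, mul_comm, hζ, hN]

/-- A test function supported in the smaller set is one for the larger set. It serves to regard the
voltage, given on `Ωs`, as a function in `H¹(Ω)`. -/
theorem IsH1.restrict {V : Set (Space d)} {f : Space d → ℝ} {g : Space d → Space d}
    (hf : IsH1 U f g) (hU : IsOpen U) (hV : IsOpen V) (hVU : V ⊆ U) : IsH1 V f g where
  memLp := hf.memLp.mono_measure (Measure.restrict_mono hVU le_rfl)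
  grad_memLp := hf.grad_memLp.mono_measure (Measure.restrict_mono hVU le_rfl)
  weak χ hχ hc hs v := by
    have h0 : ∀ x, x ∉ V → x ∉ tsupport χ := fun x hx h => hx (hs h)
    have h1 := hf.weak χ hχ hc (hs.trans hVU) v
    rw [setIntegral_eq_of_tsupport_subset hU, setIntegral_eq_of_tsupport_subset hU] at h1
    · rwa [setIntegral_eq_of_tsupport_subset hV, setIntegral_eq_of_tsupport_subset hV]
      · intro x hx
        simp [image_eq_zero_of_notMem_tsupport (h0 x hx)]
      · intro x hx
        simp [fderiv_apply_eq_zero_of_notMem (h0 x hx)]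
    · intro x hx
      simp [image_eq_zero_of_notMem_tsupport (h0 x fun h => hx (hVU h))]
    · intro x hx
      simp [fderiv_apply_eq_zero_of_notMem (h0 x fun h => hx (hVU h))]

theorem IsH1.smul_add {f f' : Space d → ℝ} {g g' : Space d → Space d} (a : ℝ)
    (hf : IsH1 U f g) (hf' : IsH1 U f' g') :
    IsH1 U (fun x => a * f x + f' x) (fun x => a • g x + g' x) where
  memLp := (hf.memLp.const_mul a).add hf'.memLp
  grad_memLp := (hf.grad_memLp.const_smul a).add hf'.grad_memLp
  weak χ hχ hc hs v := by
    have m1 : MemLp (fun x => fderiv ℝ χ x v) 2 (volume.restrict U) :=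
      ((continuous_fderiv_apply_const hχ v).memLp_of_hasCompactSupport
        (hasCompactSupport_fderiv_apply_const hc v)).restrict U
    have m2 : MemLp χ 2 (volume.restrict U) :=
      (hχ.continuous.memLp_of_hasCompactSupport hc).restrict U
    have i1 : Integrable (fun x => f x * fderiv ℝ χ x v) (volume.restrict U) :=
      hf.memLp.integrable_mul m1
    have i2 : Integrable (fun x => f' x * fderiv ℝ χ x v) (volume.restrict U) :=
      hf'.memLp.integrable_mul m1
    have i3 : Integrable (fun x => inner ℝ (g x) v * χ x) (volume.restrict U) :=
      (hf.grad_memLp.inner_const v).integrable_mul m2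
    have i4 : Integrable (fun x => inner ℝ (g' x) v * χ x) (volume.restrict U) :=
      (hf'.grad_memLp.inner_const v).integrable_mul m2
    have e1 : ∫ x in U, (a * f x + f' x) * fderiv ℝ χ x v
        = a * (∫ x in U, f x * fderiv ℝ χ x v) + ∫ x in U, f' x * fderiv ℝ χ x v := by
      rw [← integral_const_mul, ← integral_add (i1.const_mul a) i2]
      congr 1
      ext x
      ring
    have e2 : ∫ x in U, inner ℝ (a • g x + g' x) v * χ x
        = a * (∫ x in U, inner ℝ (g x) v * χ x) + ∫ x in U, inner ℝ (g' x) v * χ x := by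
      rw [← integral_const_mul, ← integral_add (i3.const_mul a) i4]
      congr 1
      ext x
      simp only [inner_add_left, real_inner_smul_left]
      ring
    rw [e1, e2, hf.weak χ hχ hc hs v, hf'.weak χ hχ hc hs v]
    ring

end Electrowetting

namespace Electrowetting

/-! ### The chain rule in `H¹` by mollification. -/

section ChainRule

variable {d : ℕ} {U : Set (Space d)}

theorem memLp_of_continuousOn_closure {F : Type*} [NormedAddCommGroup F]
    [SecondCountableTopology F] (hU : IsOpen U)
    (hb : Bornology.IsBounded U) {f : Space d → F} (hf : ContinuousOn f (closure U)) (p : ℝ≥0∞) :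
    MemLp f p (volume.restrict U) := by
  obtain ⟨C, hC⟩ := hb.isCompact_closure.exists_bound_of_continuousOn hf
  have : IsFiniteMeasure (volume.restrict U) := ⟨by
    rw [Measure.restrict_apply_univ]; exact hb.measure_lt_top⟩
  refine MemLp.of_bound ((hf.mono subset_closure).aestronglyMeasurable hU.measurableSet) C ?_
  filter_upwards [ae_restrict_mem hU.measurableSet] with x hx using hC x (subset_closure hx)

theorem memLp_smul_of_continuousOn_closure {F : Type*} [NormedAddCommGroup F] [NormedSpace ℝ F]
    (hU : IsOpen U) (hb : Bornology.IsBounded U) {c : Space d → ℝ} {g : Space d → F}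
    (hc : ContinuousOn c (closure U)) (hg : MemLp g 2 (volume.restrict U)) :
    MemLp (fun x => c x • g x) 2 (volume.restrict U) := by
  have h := memLp_of_continuousOn_closure hU hb hc ⊤
  exact MemLp.smul (p := ⊤) (q := 2) (r := 2) hg h

variable {ι : Type*} [Fintype ι] [DecidableEq ι]

theorem tendsto_slice {Y : Type*} {x : Space d} {g : ℕ → Space d → Y} {l : Filter Y}
    (h : Tendsto (fun p : ℕ × Space d => g p.1 p.2) (atTop ×ˢ 𝓝 x) l) :
    Tendsto (fun k => g k x) atTop l := by
  have h1 : Tendsto (fun k : ℕ => (k, x)) atTop (atTop ×ˢ 𝓝 x) :=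
    tendsto_id.prodMk tendsto_const_nhds
  exact h.comp h1

/-- Convergence of the mollified functions, jointly in the scale and the point. -/
theorem tendsto_mollify_indicator (hU : IsOpen U) {f : Space d → ℝ} (hf : ContinuousOn f U)
    {x : Space d} (hx : x ∈ U) :
    Tendsto (fun p : ℕ × Space d => mollify p.1 (U.indicator f) p.2) (atTop ×ˢ 𝓝 x)
      (𝓝 (f x)) := by
  refine tendsto_mollify (f := fun _ => U.indicator f) (fun k => ?_) ?_
  · exact (aestronglyMeasurable_indicator_iff hU.measurableSet).2
      (hf.aestronglyMeasurable hU.measurableSet)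
  · have h1 : ContinuousAt (U.indicator f) x := by
      refine (hf.continuousAt (hU.mem_nhds hx)).congr ?_
      filter_upwards [hU.mem_nhds hx] with y hy
      simp [hy]
    have h2 : U.indicator f x = f x := by simp [hx]
    rw [← h2]
    exact h1.tendsto.comp tendsto_snd

theorem continuous_fderiv_single {G : (ι → ℝ) → ℝ} (hG : ContDiff ℝ 1 G) (i : ι) :
    Continuous fun y => fderiv ℝ G y (Pi.single i 1) :=
  (hG.continuous_fderiv (by simp)).clm_apply continuous_const

/-- Integration by parts for a smooth function of mollified functions. -/
theorem integral_comp_mollify (hU : IsOpen U) {f : ι → Space d → ℝ} {g : ι → Space d → Space d}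
    (hf : ∀ i, IsH1 U (f i) (g i)) (hfi : ∀ i, IntegrableOn (f i) U)
    (hgi : ∀ i, IntegrableOn (g i) U) {G : (ι → ℝ) → ℝ} (hG : ContDiff ℝ 1 G)
    {χ : Space d → ℝ} (hχ : ContDiff ℝ ∞ χ) (hc : HasCompactSupport χ) {k : ℕ}
    (hk : ∀ x ∈ tsupport χ, Metric.closedBall x (mollifier d k).rOut ⊆ U) (v : Space d) :
    ∫ x, G (fun i => mollify k (U.indicator (f i)) x) * fderiv ℝ χ x v =
      - ∑ i, ∫ x, mollify k (fun x => fderiv ℝ G (fun i => mollify k (U.indicator (f i)) x)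
          (Pi.single i 1) * χ x) x * U.indicator (fun x => inner ℝ (g i x) v) x := by
  set F : Space d → ι → ℝ := fun x i => mollify k (U.indicator (f i)) x with hF
  have hFs : ContDiff ℝ 1 F := contDiff_pi.2 fun i =>
    (contDiff_mollify k ((hfi i).integrable_indicator hU.measurableSet)).of_le (by simp)
  have hGF : ContDiff ℝ 1 (fun x => G (F x)) := hG.comp hFs
  have hχ1 : ContDiff ℝ 1 χ := hχ.of_le (by simp)
  have hψc : ∀ i, Continuous fun x => fderiv ℝ G (F x) (Pi.single i 1) * χ x := fun i =>
    ((continuous_fderiv_single hG i).comp hFs.continuous).mul hχ.continuous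
  have hψi : ∀ i, Integrable fun x => fderiv ℝ G (F x) (Pi.single i 1) * χ x := fun i =>
    (hψc i).integrable_of_hasCompactSupport hc.mul_left
  have hgv : ∀ i, Integrable (U.indicator fun x => inner ℝ (g i x) v) := fun i =>
    IntegrableOn.integrable_indicator ((hgi i).inner_const v) hU.measurableSet
  -- The classical chain rule. Off the support of `χ` both sides vanish, so the derivative of a
  -- mollification is needed only where the kernel stays inside `U`.
  have hd : ∀ x, fderiv ℝ (fun x => G (F x)) x v * χ x
      = ∑ i, (fderiv ℝ G (F x) (Pi.single i 1) * χ x)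
          * mollify k (U.indicator fun x => inner ℝ (g i x) v) x := by
    intro x
    by_cases hx : x ∈ tsupport χ
    · have h1 : HasFDerivAt G (fderiv ℝ G (F x)) (F x) :=
        (hG.differentiable (by simp) _).hasFDerivAt
      have h2 : HasFDerivAt F (fderiv ℝ F x) x := (hFs.differentiable (by simp) _).hasFDerivAt
      have h3 : fderiv ℝ (fun x => G (F x)) x v = fderiv ℝ G (F x) (fderiv ℝ F x v) := by
        rw [show (fun x => G (F x)) = G ∘ F from rfl, (h1.comp x h2).fderiv]
        rfl
      have h4 : ∀ i, fderiv ℝ F x v i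
          = mollify k (U.indicator fun x => inner ℝ (g i x) v) x := by
        intro i
        rw [← fderiv_mollify hU (hf i) (hfi i) (hk x hx) v]
        have := (hasFDerivAt_pi'.1 h2 i).fderiv
        rw [show mollify k (U.indicator (f i)) = fun x => F x i from rfl, this]
        rfl
      have h5 : fderiv ℝ F x v = ∑ i, (fderiv ℝ F x v i) • (Pi.single i 1 : ι → ℝ) := by
        simpa using pi_eq_sum_univ' (fderiv ℝ F x v)
      rw [h3, h5, map_sum, Finset.sum_mul]
      refine Finset.sum_congr rfl fun i _ => ?_
      rw [map_smul, h4, smul_eq_mul]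
      ring
    · simp [image_eq_zero_of_notMem_tsupport hx]
  have hint : ∀ i, Integrable fun x => (fderiv ℝ G (F x) (Pi.single i 1) * χ x)
          * mollify k (U.indicator fun x => inner ℝ (g i x) v) x := fun i =>
    ((hψc i).mul (contDiff_mollify k (hgv i)).continuous).integrable_of_hasCompactSupport
      hc.mul_left.mul_right
  change ∫ x, G (F x) * fderiv ℝ χ x v = - ∑ i, ∫ x, mollify k
    (fun x => fderiv ℝ G (F x) (Pi.single i 1) * χ x) x * U.indicator (fun x => inner ℝ (g i x) v) x
  rw [integral_mul_fderiv_eq_neg_fderiv_mul_of_integrable]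
  · simp_rw [hd]
    rw [integral_finsetSum _ fun i _ => hint i]
    congr 1
    refine Finset.sum_congr rfl fun i _ => ?_
    -- By symmetry the mollifier passes from the rough gradient to the continuous factor.
    exact integral_mul_mollify k (hψi i) (hgv i)
  · simp_rw [hd]
    exact integrable_finsetSum _ fun i _ => hint i
  · exact (hGF.continuous.mul (continuous_fderiv_apply_const hχ v)).integrable_of_hasCompactSupport
      (hasCompactSupport_fderiv_apply_const hc v).mul_left
  · exact (hGF.continuous.mul hχ.continuous).integrable_of_hasCompactSupport hc.mul_left
  · exact fun x _ => hGF.differentiable (by simp) x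
  · exact fun x _ => hχ1.differentiable (by simp) x

theorem exists_forall_closedBall_subset (hU : IsOpen U) {K : Set (Space d)} (hK : IsCompact K)
    (hKU : K ⊆ U) :
    ∀ᶠ k in atTop, ∀ x ∈ K, Metric.closedBall x (mollifier d k).rOut ⊆ U := by
  obtain ⟨r, hr, hrU⟩ := hK.exists_cthickening_subset_open hU hKU
  filter_upwards [tendsto_rOut_mollifier.eventually (gt_mem_nhds hr)] with k hk x hx
  exact ((Metric.closedBall_subset_closedBall hk.le).trans
    (Metric.closedBall_subset_cthickening hx r)).trans hrU

/-- The chain rule for weakly differentiable functions that are continuous up to the boundary. -/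
theorem IsH1.comp_contDiff (hU : IsOpen U) (hb : Bornology.IsBounded U) {f : ι → Space d → ℝ}
    {g : ι → Space d → Space d} (hf : ∀ i, IsH1 U (f i) (g i))
    (hfc : ∀ i, ContinuousOn (f i) (closure U)) {G : (ι → ℝ) → ℝ} (hG : ContDiff ℝ 1 G) :
    IsH1 U (fun x => G fun i => f i x)
      (fun x => ∑ i, fderiv ℝ G (fun j => f j x) (Pi.single i 1) • g i x) := by
  have : IsFiniteMeasure (volume.restrict U) := ⟨by
    rw [Measure.restrict_apply_univ]; exact hb.measure_lt_top⟩
  have hfc' : ContinuousOn (fun x i => f i x) (closure U) := continuousOn_pi.2 hfc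
  refine ⟨memLp_of_continuousOn_closure hU hb (hG.continuous.comp_continuousOn hfc') 2, ?_, ?_⟩
  · refine memLp_finsetSum _ fun i _ => ?_
    exact memLp_smul_of_continuousOn_closure hU hb
      ((continuous_fderiv_single hG i).comp_continuousOn hfc') (hf i).grad_memLp
  intro χ hχ hc hs v
  have hfi : ∀ i, IntegrableOn (f i) U := fun i => (hf i).memLp.integrable one_le_two
  have hgi : ∀ i, IntegrableOn (g i) U := fun i => (hf i).grad_memLp.integrable one_le_two
  have hgv : ∀ i, IntegrableOn (fun x => inner ℝ (g i x) v) U := fun i => (hgi i).inner_const v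
  have hgv' : ∀ i, Integrable (U.indicator fun x => inner ℝ (g i x) v) := fun i =>
    (hgv i).integrable_indicator hU.measurableSet
  obtain ⟨F, hF⟩ : ∃ F : ℕ → Space d → ι → ℝ, F = fun k x i => mollify k (U.indicator (f i)) x :=
    ⟨_, rfl⟩
  have hFa : ∀ k x i, F k x i = mollify k (U.indicator (f i)) x := fun k x i => by rw [hF]
  have hFc : ∀ k, Continuous (F k) := fun k => continuous_pi fun i => by
    simp_rw [hFa]
    exact (contDiff_mollify k ((hfi i).integrable_indicator hU.measurableSet)).continuous
  -- Averaging does not increase the sup norm, so all approximations take values in one compact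
  -- ball, on which `G` and its derivative are bounded.
  obtain ⟨C, hC⟩ : ∃ C, ∀ k x, F k x ∈ Metric.closedBall (0 : ι → ℝ) C := by
    obtain ⟨C, hC⟩ := hb.isCompact_closure.exists_bound_of_continuousOn hfc'
    refine ⟨max C 0, fun k x => ?_⟩
    rw [mem_closedBall_zero_iff, pi_norm_le_iff_of_nonneg (le_max_right _ _)]
    intro i
    rw [hFa]
    refine abs_mollify_le k (fun y => ?_) x
    by_cases hy : y ∈ U
    · simp only [hy, indicator_of_mem]
      exact (norm_le_pi_norm (fun i => f i y) i).trans
        ((hC y (subset_closure hy)).trans (le_max_left _ _))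
    · simp [hy]
  have hFlim : ∀ x ∈ U, Tendsto (fun p : ℕ × Space d => F p.1 p.2) (atTop ×ˢ 𝓝 x)
      (𝓝 fun i => f i x) := fun x hx => tendsto_pi_nhds.2 fun i => by
    simp_rw [hFa]
    exact tendsto_mollify_indicator hU ((hfc i).mono subset_closure) hx
  have hFlim' : ∀ x ∈ U, Tendsto (fun k => F k x) atTop (𝓝 fun i => f i x) := fun x hx =>
    tendsto_slice (g := F) (hFlim x hx)
  have hbd : ∀ H : (ι → ℝ) → ℝ, Continuous H → ∃ B, ∀ k x, |H (F k x)| ≤ B := fun H hH => by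
    obtain ⟨B, hB⟩ := (isCompact_closedBall (0 : ι → ℝ) C).exists_bound_of_continuousOn
      hH.continuousOn
    exact ⟨B, fun k x => hB _ (hC k x)⟩
  have hχz : ∀ x, x ∉ U → χ x = 0 := fun x hx =>
    image_eq_zero_of_notMem_tsupport fun h => hx (hs h)
  have hχdz : ∀ x, x ∉ U → fderiv ℝ χ x v = 0 := fun x hx =>
    fderiv_apply_eq_zero_of_notMem (fun h => hx (hs h)) v
  have hχdi : Integrable fun x => fderiv ℝ χ x v :=
    (continuous_fderiv_apply_const hχ v).integrable_of_hasCompactSupport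
      (hasCompactSupport_fderiv_apply_const hc v)
  -- the left-hand side
  have hL : Tendsto (fun k => ∫ x, G (F k x) * fderiv ℝ χ x v) atTop
      (𝓝 (∫ x, G (fun i => f i x) * fderiv ℝ χ x v)) := by
    obtain ⟨B, hB⟩ := hbd G hG.continuous
    refine tendsto_integral_of_dominated_convergence (fun x => B * |fderiv ℝ χ x v|) ?_ ?_ ?_ ?_
    · exact fun k => ((hG.continuous.comp (hFc k)).mul
        (continuous_fderiv_apply_const hχ v)).aestronglyMeasurable
    · exact hχdi.abs.const_mul B
    · refine fun k => Eventually.of_forall fun x => ?_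
      rw [norm_mul]
      exact mul_le_mul_of_nonneg_right (hB k x) (abs_nonneg _)
    · refine Eventually.of_forall fun x => ?_
      by_cases hx : x ∈ U
      · exact ((hG.continuous.tendsto _).comp (hFlim' x hx)).mul_const _
      · simp [hχdz x hx]
  -- the right-hand side
  obtain ⟨X, hX⟩ := hχ.continuous.bounded_above_of_compact_support hc
  -- With the mollifier on the bounded factor, the gradient is a fixed integrable weight, and
  -- dominated convergence needs only pointwise convergence in `U`.
  have hR : ∀ i, Tendsto (fun k => ∫ x, mollify k (fun x => fderiv ℝ G (F k x) (Pi.single i 1)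
      * χ x) x * U.indicator (fun x => inner ℝ (g i x) v) x) atTop
      (𝓝 (∫ x, (fderiv ℝ G (fun j => f j x) (Pi.single i 1) * χ x)
        * U.indicator (fun x => inner ℝ (g i x) v) x)) := by
    intro i
    have hdc := continuous_fderiv_single hG i
    obtain ⟨B, hB⟩ := hbd _ hdc
    have hψc : ∀ k, Continuous fun x => fderiv ℝ G (F k x) (Pi.single i 1) * χ x := fun k =>
      (hdc.comp (hFc k)).mul hχ.continuous
    have hψb : ∀ k x, |fderiv ℝ G (F k x) (Pi.single i 1) * χ x| ≤ B * X := fun k x => by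
      rw [abs_mul]
      exact mul_le_mul (hB k x) (hX x) (abs_nonneg _) ((abs_nonneg _).trans (hB k x))
    refine tendsto_integral_of_dominated_convergence
      (fun x => (B * X) * |U.indicator (fun x => inner ℝ (g i x) v) x|) ?_ ?_ ?_ ?_
    · refine fun k => AEStronglyMeasurable.mul ?_ (hgv' i).aestronglyMeasurable
      exact (contDiff_mollify k ((hψc k).integrable_of_hasCompactSupport
        hc.mul_left)).continuous.aestronglyMeasurable
    · exact (hgv' i).abs.const_mul _
    · refine fun k => Eventually.of_forall fun x => ?_
      rw [norm_mul]
      exact mul_le_mul_of_nonneg_right (abs_mollify_le k (hψb k) x) (abs_nonneg _)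
    · refine Eventually.of_forall fun x => ?_
      by_cases hx : x ∈ U
      · refine Tendsto.mul_const _ ?_
        have := tendsto_mollify (x := x)
          (f := fun k x => fderiv ℝ G (F k x) (Pi.single i 1) * χ x)
          (z := fderiv ℝ G (fun j => f j x) (Pi.single i 1) * χ x)
          (fun k => (hψc k).aestronglyMeasurable)
          (((hdc.tendsto _).comp (hFlim x hx)).mul ((hχ.continuous.tendsto x).comp tendsto_snd))
        exact tendsto_slice (g := fun k => mollify k
          (fun x => fderiv ℝ G (F k x) (Pi.single i 1) * χ x)) this
      · simp [hx]
  have hlim := (tendsto_finsetSum Finset.univ fun i _ => hR i).neg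
  have heq := tendsto_nhds_unique_of_eventuallyEq hL hlim (by
    filter_upwards [exists_forall_closedBall_subset hU hc hs] with k hk
    simp_rw [hF]
    exact integral_comp_mollify hU hf hfi hgi hG hχ hc hk v)
  rw [setIntegral_eq_of_tsupport_subset hU fun x hx => by simp [hχdz x hx], heq]
  congr 1
  have hint : ∀ i, Integrable (fun x => (fderiv ℝ G (fun j => f j x) (Pi.single i 1) * χ x)
      * inner ℝ (g i x) v) (volume.restrict U) := by
    intro i
    have h := memLp_smul_of_continuousOn_closure (F := ℝ) hU hb (c := fun x =>
      fderiv ℝ G (fun j => f j x) (Pi.single i 1) * χ x)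
      (((continuous_fderiv_single hG i).comp_continuousOn hfc').mul hχ.continuous.continuousOn)
      (g := fun x => inner ℝ (g i x) v) ((hf i).grad_memLp.inner_const v)
    exact h.integrable one_le_two
  have e1 : ∀ x, inner ℝ (∑ i, fderiv ℝ G (fun j => f j x) (Pi.single i 1) • g i x) v * χ x
      = ∑ i, (fderiv ℝ G (fun j => f j x) (Pi.single i 1) * χ x) * inner ℝ (g i x) v := by
    intro x
    rw [sum_inner, Finset.sum_mul]
    refine Finset.sum_congr rfl fun i _ => ?_
    rw [real_inner_smul_left]
    ring
  simp_rw [e1]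
  rw [integral_finsetSum _ fun i _ => hint i]
  refine Finset.sum_congr rfl fun i _ => ?_
  rw [← integral_indicator hU.measurableSet]
  congr 1
  ext x
  by_cases hx : x ∈ U <;> simp [hx]

end ChainRule

end Electrowetting

namespace Electrowetting

/-! ### Curves in `L²` -/

section Curves

set_option linter.unusedSectionVars false

variable {X E : Type*} [MeasurableSpace X] {m : Measure X}

/-- `t ↦ f t` is a continuous curve in `L²(m)` on `[0, T]` with derivative `f'` on `(0, T)`. -/
structure L2Curve [NormedAddCommGroup E] [NormedSpace ℝ E] (m : Measure X) (T : ℝ)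
    (f f' : ℝ → X → E) : Prop where
  memLp : ∀ t ∈ Icc 0 T, MemLp (f t) 2 m
  memLp' : ∀ t ∈ Ioo 0 T, MemLp (f' t) 2 m
  cont : L2ContinuousOn m f (Icc 0 T)
  deriv : ∀ t ∈ Ioo 0 T, L2HasDerivAt m f (f' t) t

open Classical in
/-- The element of `L²(m)` given by a square integrable function (and `0` otherwise). -/
noncomputable def toL2 [NormedAddCommGroup E] (m : Measure X) (f : X → E) : Lp E 2 m :=
  if h : MemLp f 2 m then h.toLp f else 0

theorem toL2_of_memLp [NormedAddCommGroup E] {f : X → E} (h : MemLp f 2 m) :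
    toL2 m f = h.toLp f := by
  simp [toL2, h]

theorem inner_toL2 [NormedAddCommGroup E] [InnerProductSpace ℝ E] {f g : X → E}
    (hf : MemLp f 2 m) (hg : MemLp g 2 m) :
    inner ℝ (toL2 m f) (toL2 m g) = ∫ x, inner ℝ (f x) (g x) ∂m := by
  rw [toL2_of_memLp hf, toL2_of_memLp hg, L2.inner_def]
  refine integral_congr_ae ?_
  filter_upwards [hf.coeFn_toLp, hg.coeFn_toLp] with x h1 h2
  rw [h1, h2]

/-! ### Curves of functions as paths in the Hilbert space. -/

section

variable [NormedAddCommGroup E] [NormedSpace ℝ E] {T : ℝ} {f f' : ℝ → X → E}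

theorem L2Curve.continuousOn_toL2 (h : L2Curve m T f f') :
    ContinuousOn (fun t => toL2 m (f t)) (Icc 0 T) := by
  intro t ht
  refine tendsto_iff_edist_tendsto_0.2 ((h.cont t ht).congr' ?_)
  filter_upwards [self_mem_nhdsWithin] with s hs
  rw [toL2_of_memLp (h.memLp s hs), toL2_of_memLp (h.memLp t ht), Lp.edist_toLp_toLp]
  rfl

theorem L2Curve.hasDerivAt_toL2 (h : L2Curve m T f f') {t : ℝ} (ht : t ∈ Ioo 0 T) :
    HasDerivAt (fun t => toL2 m (f t)) (toL2 m (f' t)) t := by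
  rw [hasDerivAt_iff_tendsto_slope, tendsto_iff_edist_tendsto_0]
  refine (h.deriv t ht).congr' ?_
  have hn : Icc 0 T ∈ 𝓝[≠] t := mem_nhdsWithin_of_mem_nhds (Icc_mem_nhds ht.1 ht.2)
  filter_upwards [hn] with s hs
  have hs' := h.memLp s hs
  have ht' := h.memLp t (Ioo_subset_Icc_self ht)
  rw [slope_def_module, toL2_of_memLp hs', toL2_of_memLp ht', toL2_of_memLp (h.memLp' t ht),
    ← MemLp.toLp_sub hs' ht', ← MemLp.toLp_const_smul, Lp.edist_toLp_toLp]
  rfl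

end

section

variable [NormedAddCommGroup E] [InnerProductSpace ℝ E] {T : ℝ} {f f' g g' : ℝ → X → E}

theorem L2Curve.continuousOn_integral_inner (hf : L2Curve m T f f') (hg : L2Curve m T g g') :
    ContinuousOn (fun t => ∫ x, inner ℝ (f t x) (g t x) ∂m) (Icc 0 T) := by
  refine (hf.continuousOn_toL2.inner hg.continuousOn_toL2).congr fun t ht => ?_
  exact (inner_toL2 (hf.memLp t ht) (hg.memLp t ht)).symm

/-- The product rule for the inner product of `L²`; no pointwise derivative in time is involved. -/
theorem L2Curve.hasDerivAt_integral_inner (hf : L2Curve m T f f') (hg : L2Curve m T g g') {t : ℝ}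
    (ht : t ∈ Ioo 0 T) :
    HasDerivAt (fun t => ∫ x, inner ℝ (f t x) (g t x) ∂m)
      ((∫ x, inner ℝ (f t x) (g' t x) ∂m) + ∫ x, inner ℝ (f' t x) (g t x) ∂m) t := by
  have ht' := Ioo_subset_Icc_self ht
  rw [← inner_toL2 (hf.memLp t ht') (hg.memLp' t ht), ← inner_toL2 (hf.memLp' t ht) (hg.memLp t ht')]
  refine ((hf.hasDerivAt_toL2 ht).inner ℝ (hg.hasDerivAt_toL2 ht)).congr_of_eventuallyEq ?_
  filter_upwards [Icc_mem_nhds ht.1 ht.2] with s hs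
  exact (inner_toL2 (hf.memLp s hs) (hg.memLp s hs)).symm

/-- The pairing of a curve with the derivative of another curve is a measurable function of time. -/
theorem L2Curve.aestronglyMeasurable_integral_inner [CompleteSpace E] (hf : L2Curve m T f f')
    (hg : L2Curve m T g g') :
    AEStronglyMeasurable (fun t => ∫ x, inner ℝ (f t x) (g' t x) ∂m)
      (volume.restrict (Ioo 0 T)) := by
  have h1 : AEStronglyMeasurable (fun t => toL2 m (f t)) (volume.restrict (Ioo 0 T)) :=
    (hf.continuousOn_toL2.mono Ioo_subset_Icc_self).aestronglyMeasurable measurableSet_Ioo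
  -- Nothing is assumed about `g'` as a function of time, but the derivative of a path in a Banach
  -- space is automatically measurable, and on `(0, T)` it represents `g'`.
  have h2 : AEStronglyMeasurable (_root_.deriv fun t => toL2 m (g t))
      (volume.restrict (Ioo 0 T)) := (stronglyMeasurable_deriv _).aestronglyMeasurable
  refine (h1.inner (𝕜 := ℝ) h2).congr ?_
  filter_upwards [ae_restrict_mem measurableSet_Ioo] with t ht
  rw [(hg.hasDerivAt_toL2 ht).deriv,
    inner_toL2 (hf.memLp t (Ioo_subset_Icc_self ht)) (hg.memLp' t ht)]

end

/-- Serves to freeze a test function while the other factor of a pairing is differentiated, and to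
write an integral as a pairing with `1`. -/
theorem L2Curve.const [NormedAddCommGroup E] [NormedSpace ℝ E] {f : X → E} (hf : MemLp f 2 m)
    (T : ℝ) : L2Curve m T (fun _ => f) (fun _ _ => 0) where
  memLp _ _ := hf
  memLp' _ _ := MemLp.zero
  cont _ _ := by simp [tendsto_const_nhds]
  deriv _ _ := by simp [L2HasDerivAt]

/-! ### Coefficients varying uniformly in space. -/

/-- `t ↦ c t` is a continuous curve of bounded functions on `S` for the uniform norm, with
derivative `c'`. -/
structure UniformCurve (S : Set X) (T : ℝ) (c c' : ℝ → X → ℝ) : Prop where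
  bdd : ∀ t ∈ Icc 0 T, ∃ C, ∀ x ∈ S, |c t x| ≤ C
  bdd' : ∀ t ∈ Ioo 0 T, ∃ C, ∀ x ∈ S, |c' t x| ≤ C
  cont : ∀ t ∈ Icc 0 T, TendstoUniformlyOn c (c t) (𝓝[Icc 0 T] t) S
  deriv : ∀ t ∈ Ioo 0 T,
    TendstoUniformlyOn (fun s x => (s - t)⁻¹ * (c s x - c t x)) (c' t) (𝓝[≠] t) S

theorem UniformCurve.mono {S S' : Set X} {T : ℝ} {c c' : ℝ → X → ℝ} (h : UniformCurve S T c c')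
    (hS : S' ⊆ S) : UniformCurve S' T c c' where
  bdd t ht := (h.bdd t ht).imp fun _ hC x hx => hC x (hS hx)
  bdd' t ht := (h.bdd' t ht).imp fun _ hC x hx => hC x (hS hx)
  cont t ht := (h.cont t ht).mono hS
  deriv t ht := (h.deriv t ht).mono hS

-- A constant extension does not spoil uniformity in `x`, whatever jump it creates across the
-- boundary of `S`. This is the situation of the permittivity.
open Classical in
theorem UniformCurve.extend {S : Set X} {T : ℝ} {c c' : ℝ → X → ℝ} (h : UniformCurve S T c c')
    (k : ℝ) (S' : Set X) :
    UniformCurve S' T (fun t x => if x ∈ S then c t x else k)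
      (fun t x => if x ∈ S then c' t x else 0) where
  bdd t ht := by
    obtain ⟨C, hC⟩ := h.bdd t ht
    refine ⟨max C |k|, fun x _ => ?_⟩
    split_ifs with hx
    · exact (hC x hx).trans (le_max_left _ _)
    · exact le_max_right _ _
  bdd' t ht := by
    obtain ⟨C, hC⟩ := h.bdd' t ht
    refine ⟨max C 0, fun x _ => ?_⟩
    split_ifs with hx
    · exact (hC x hx).trans (le_max_left _ _)
    · simp
  cont t ht := by
    rw [Metric.tendstoUniformlyOn_iff]
    intro ε hε
    filter_upwards [Metric.tendstoUniformlyOn_iff.1 (h.cont t ht) ε hε] with s hs x _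
    split_ifs with hx
    · exact hs x hx
    · simpa using hε
  deriv t ht := by
    rw [Metric.tendstoUniformlyOn_iff]
    intro ε hε
    filter_upwards [Metric.tendstoUniformlyOn_iff.1 (h.deriv t ht) ε hε] with s hs x _
    split_ifs with hx
    · exact hs x hx
    · simpa using hε

/-! ### Products of uniform curves with square integrable curves. -/

section Multiplication

variable [NormedAddCommGroup E] [NormedSpace ℝ E]

theorem tendsto_eLpNorm_smul_of_bounded {l : Filter ℝ} {S : Set X} (hS : ∀ᵐ x ∂m, x ∈ S)
    {a : ℝ → X → ℝ} {C : ℝ} (ha : ∀ᶠ s in l, ∀ x ∈ S, |a s x| ≤ C) {h : ℝ → X → E}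
    (hh : Tendsto (fun s => eLpNorm (h s) 2 m) l (𝓝 0)) :
    Tendsto (fun s => eLpNorm (fun x => a s x • h s x) 2 m) l (𝓝 0) := by
  have h0 : Tendsto (fun s => ENNReal.ofReal C * eLpNorm (h s) 2 m) l (𝓝 0) := by
    simpa using ENNReal.Tendsto.const_mul hh (Or.inr ENNReal.ofReal_ne_top)
  refine tendsto_of_tendsto_of_tendsto_of_le_of_le' tendsto_const_nhds h0
    (Eventually.of_forall fun _ => zero_le) ?_
  filter_upwards [ha] with s hs
  refine eLpNorm_le_mul_eLpNorm_of_ae_le_mul ?_ 2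
  filter_upwards [hS] with x hx
  rw [norm_smul]
  exact mul_le_mul_of_nonneg_right (hs x hx) (norm_nonneg _)

theorem tendsto_eLpNorm_smul_of_tendstoUniformlyOn {l : Filter ℝ} {S : Set X}
    (hS : ∀ᵐ x ∂m, x ∈ S) {a : ℝ → X → ℝ} {b : X → ℝ} (ha : TendstoUniformlyOn a b l S)
    {k : X → E} (hk : MemLp k 2 m) :
    Tendsto (fun s => eLpNorm (fun x => (a s x - b x) • k x) 2 m) l (𝓝 0) := by
  rw [ENNReal.tendsto_nhds_zero]
  intro ε hε
  obtain ⟨r, hr, hr'⟩ : ∃ r : ℝ, 0 < r ∧ ENNReal.ofReal r * eLpNorm k 2 m ≤ ε := by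
    rcases eq_or_ne ε ⊤ with rfl | hεt
    · exact ⟨1, one_pos, le_top⟩
    · have hN := hk.eLpNorm_ne_top
      -- The added `1` guards against a vanishing norm of `k`.
      refine ⟨ε.toReal / ((eLpNorm k 2 m).toReal + 1), ?_, ?_⟩
      · have := ENNReal.toReal_pos hε.ne' hεt
        positivity
      · rw [← ENNReal.ofReal_toReal hN, ← ENNReal.ofReal_mul (by positivity)]
        refine ENNReal.ofReal_le_of_le_toReal ?_
        rw [ENNReal.toReal_ofReal ENNReal.toReal_nonneg, div_mul_eq_mul_div,
          div_le_iff₀ (by positivity)]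
        exact mul_le_mul_of_nonneg_left (by linarith) ENNReal.toReal_nonneg
  filter_upwards [Metric.tendstoUniformlyOn_iff.1 ha r hr] with s hs
  refine le_trans (eLpNorm_le_mul_eLpNorm_of_ae_le_mul ?_ 2) hr'
  filter_upwards [hS] with x hx
  rw [norm_smul]
  refine mul_le_mul_of_nonneg_right ?_ (norm_nonneg _)
  rw [← dist_eq_norm, dist_comm]
  exact (hs x hx).le

theorem tendsto_eLpNorm_add {l : Filter ℝ} {u v : ℝ → X → E}
    (hu : ∀ᶠ s in l, AEStronglyMeasurable (u s) m) (hv : ∀ᶠ s in l, AEStronglyMeasurable (v s) m)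
    (hu0 : Tendsto (fun s => eLpNorm (u s) 2 m) l (𝓝 0))
    (hv0 : Tendsto (fun s => eLpNorm (v s) 2 m) l (𝓝 0)) :
    Tendsto (fun s => eLpNorm (fun x => u s x + v s x) 2 m) l (𝓝 0) := by
  have h0 : Tendsto (fun s => eLpNorm (u s) 2 m + eLpNorm (v s) 2 m) l (𝓝 0) := by
    simpa using hu0.add hv0
  refine tendsto_of_tendsto_of_tendsto_of_le_of_le' tendsto_const_nhds h0
    (Eventually.of_forall fun _ => zero_le) ?_
  filter_upwards [hu, hv] with s h1 h2
  exact eLpNorm_add_le h1 h2 one_le_two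

theorem memLp_smul_of_bounded {S : Set X} (hS : ∀ᵐ x ∂m, x ∈ S) {c : X → ℝ} {C : ℝ}
    (hc : ∀ x ∈ S, |c x| ≤ C) (hcm : AEStronglyMeasurable c m) {p : ℝ≥0∞} {k : X → E}
    (hk : MemLp k p m) : MemLp (fun x => c x • k x) p m := by
  refine hk.of_le_mul (c := C) (hcm.smul hk.1) ?_
  filter_upwards [hS] with x hx
  rw [norm_smul]
  exact mul_le_mul_of_nonneg_right (hc x hx) (norm_nonneg _)

theorem UniformCurve.eventually_bdd {S : Set X} {T : ℝ} {c c' : ℝ → X → ℝ}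
    (hc : UniformCurve S T c c') {t : ℝ} (ht : t ∈ Icc 0 T) :
    ∃ C, ∀ᶠ s in 𝓝[Icc 0 T] t, ∀ x ∈ S, |c s x| ≤ C := by
  obtain ⟨C, hC⟩ := hc.bdd t ht
  refine ⟨C + 1, ?_⟩
  filter_upwards [Metric.tendstoUniformlyOn_iff.1 (hc.cont t ht) 1 one_pos] with s hs x hx
  have h1 := hs x hx
  rw [dist_comm, Real.dist_eq] at h1
  have h2 := abs_sub_abs_le_abs_sub (c s x) (c t x)
  linarith [hC x hx]

/-- The product of an `L²` curve with a uniform curve. -/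
theorem L2Curve.smul {S : Set X} (hS : ∀ᵐ x ∂m, x ∈ S) {T : ℝ} {c c' : ℝ → X → ℝ}
    (hc : UniformCurve S T c c') (hm : ∀ t ∈ Icc 0 T, AEStronglyMeasurable (c t) m)
    (hm' : ∀ t ∈ Ioo 0 T, AEStronglyMeasurable (c' t) m) {f f' : ℝ → X → E}
    (hf : L2Curve m T f f') :
    L2Curve m T (fun t x => c t x • f t x) (fun t x => c' t x • f t x + c t x • f' t x) where
  memLp t ht := by
    obtain ⟨C, hC⟩ := hc.bdd t ht
    exact memLp_smul_of_bounded hS hC (hm t ht) (hf.memLp t ht)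
  memLp' t ht := by
    have ht' := Ioo_subset_Icc_self ht
    obtain ⟨C, hC⟩ := hc.bdd t ht'
    obtain ⟨C', hC'⟩ := hc.bdd' t ht
    exact (memLp_smul_of_bounded hS hC' (hm' t ht) (hf.memLp t ht')).add
      (memLp_smul_of_bounded hS hC (hm t ht') (hf.memLp' t ht))
  cont t ht := by
    obtain ⟨C, hC⟩ := hc.eventually_bdd ht
    -- One term pairs locally bounded coefficients with an `L²` difference tending to zero; the
    -- other pairs a uniformly small difference with a fixed `L²` function.
    have e : ∀ s, (fun x => c s x • f s x - c t x • f t x)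
        = fun x => c s x • (f s x - f t x) + (c s x - c t x) • f t x := fun s => by
      ext x; module
    simp_rw [e]
    refine tendsto_eLpNorm_add ?_ ?_
      (tendsto_eLpNorm_smul_of_bounded hS hC (hf.cont t ht))
      (tendsto_eLpNorm_smul_of_tendstoUniformlyOn hS (hc.cont t ht) (hf.memLp t ht))
    · filter_upwards [self_mem_nhdsWithin] with s hs
      exact (hm s hs).smul ((hf.memLp s hs).1.sub (hf.memLp t ht).1)
    · filter_upwards [self_mem_nhdsWithin] with s hs
      exact ((hm s hs).sub (hm t ht)).smul (hf.memLp t ht).1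
  deriv t ht := by
    have ht' := Ioo_subset_Icc_self ht
    have hn : Icc 0 T ∈ 𝓝[≠] t := mem_nhdsWithin_of_mem_nhds (Icc_mem_nhds ht.1 ht.2)
    have hle : 𝓝[≠] t ≤ 𝓝[Icc 0 T] t := by
      rw [nhdsWithin_eq_nhds.2 (Icc_mem_nhds ht.1 ht.2)]
      exact nhdsWithin_le_nhds
    obtain ⟨C, hC⟩ := hc.eventually_bdd ht'
    -- The product rule with its remainder in three parts: bounded times vanishing in `L²`, and
    -- twice uniformly vanishing times fixed in `L²`.
    have e : ∀ s, (fun x => (s - t)⁻¹ • (c s x • f s x - c t x • f t x)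
          - (c' t x • f t x + c t x • f' t x))
        = fun x => c s x • ((s - t)⁻¹ • (f s x - f t x) - f' t x)
          + ((c s x - c t x) • f' t x
            + ((s - t)⁻¹ * (c s x - c t x) - c' t x) • f t x) := fun s => by
      ext x; module
    rw [L2HasDerivAt]
    simp_rw [e]
    refine tendsto_eLpNorm_add ?_ ?_
      (tendsto_eLpNorm_smul_of_bounded hS (hC.filter_mono hle) (hf.deriv t ht))
      (tendsto_eLpNorm_add ?_ ?_
        (tendsto_eLpNorm_smul_of_tendstoUniformlyOn hS
          (fun u hu => (hc.cont t ht' u hu).filter_mono hle) (hf.memLp' t ht))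
        (tendsto_eLpNorm_smul_of_tendstoUniformlyOn hS (hc.deriv t ht) (hf.memLp t ht')))
    · filter_upwards [hn] with s hs
      exact (hm s hs).smul ((((hf.memLp s hs).1.sub (hf.memLp t ht').1).const_smul _).sub
        (hf.memLp' t ht).1)
    · filter_upwards [hn] with s hs
      exact (((hm s hs).sub (hm t ht')).smul (hf.memLp' t ht).1).add
        (((((hm s hs).sub (hm t ht')).const_mul _).sub (hm' t ht)).smul (hf.memLp t ht').1)
    · filter_upwards [hn] with s hs
      exact ((hm s hs).sub (hm t ht')).smul (hf.memLp' t ht).1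
    · filter_upwards [hn] with s hs
      exact ((((hm s hs).sub (hm t ht')).const_mul _).sub (hm' t ht)).smul (hf.memLp t ht').1

end Multiplication

/-! ### Differentiation under the integral sign. -/

section Integral

variable [IsFiniteMeasure m] {S : Set X} {T : ℝ} {c c' : ℝ → X → ℝ}

/-- On a finite measure space `1` is square integrable, and the integral is the `L²` pairing of `c t
• 1` with `1`. -/
theorem UniformCurve.continuousOn_integral (hS : ∀ᵐ x ∂m, x ∈ S) (hc : UniformCurve S T c c')
    (hm : ∀ t ∈ Icc 0 T, AEStronglyMeasurable (c t) m)
    (hm' : ∀ t ∈ Ioo 0 T, AEStronglyMeasurable (c' t) m) :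
    ContinuousOn (fun t => ∫ x, c t x ∂m) (Icc 0 T) := by
  have h1 : L2Curve m T (fun _ _ => (1 : ℝ)) (fun _ _ => 0) := L2Curve.const (memLp_const 1) T
  simpa using (h1.smul hS hc hm hm').continuousOn_integral_inner h1

theorem UniformCurve.hasDerivAt_integral (hS : ∀ᵐ x ∂m, x ∈ S) (hc : UniformCurve S T c c')
    (hm : ∀ t ∈ Icc 0 T, AEStronglyMeasurable (c t) m)
    (hm' : ∀ t ∈ Ioo 0 T, AEStronglyMeasurable (c' t) m) {t : ℝ} (ht : t ∈ Ioo 0 T) :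
    HasDerivAt (fun t => ∫ x, c t x ∂m) (∫ x, c' t x ∂m) t := by
  have h1 : L2Curve m T (fun _ _ => (1 : ℝ)) (fun _ _ => 0) := L2Curve.const (memLp_const 1) T
  simpa using (h1.smul hS hc hm hm').hasDerivAt_integral_inner h1 ht

end Integral

/-- A curve of functions that is jointly continuous on a compact set, with a jointly continuous
time derivative, is a uniform curve. -/
theorem UniformCurve.of_continuousOn [TopologicalSpace X] {K : Set X} (hK : IsCompact K) {T : ℝ}
    {c c' : ℝ → X → ℝ} (hc : ContinuousOn (fun z : ℝ × X => c z.1 z.2) (Icc 0 T ×ˢ K))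
    (hd : ∀ t ∈ Ioo 0 T, ∀ x ∈ K, HasDerivAt (fun s => c s x) (c' t x) t)
    (hc' : ContinuousOn (fun z : ℝ × X => c' z.1 z.2) (Ioo 0 T ×ˢ K)) :
    UniformCurve K T c c' where
  bdd t ht := hK.exists_bound_of_continuousOn
    (hc.comp (Continuous.prodMk_right t).continuousOn fun _ hx => ⟨ht, hx⟩)
  bdd' t ht := hK.exists_bound_of_continuousOn
    (hc'.comp (Continuous.prodMk_right t).continuousOn fun _ hx => ⟨ht, hx⟩)
  cont t ht := by
    rw [Metric.tendstoUniformlyOn_iff]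
    intro ε hε
    -- Compactness of `K` turns joint continuity into continuity in time uniformly on `K`.
    obtain ⟨v, hv, hv'⟩ := hK.mem_uniformity_of_prod hc ht (Metric.dist_mem_uniformity hε)
    filter_upwards [hv] with s hs x hx
    rw [dist_comm]
    exact hv' s hs x hx
  deriv t ht := by
    rw [Metric.tendstoUniformlyOn_iff]
    intro ε hε
    obtain ⟨v, hv, hv'⟩ := hK.mem_uniformity_of_prod hc' ht
      (Metric.dist_mem_uniformity (half_pos hε))
    rw [nhdsWithin_eq_nhds.2 (Ioo_mem_nhds ht.1 ht.2)] at hv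
    obtain ⟨r, hr, hrv⟩ := Metric.mem_nhds_iff.1 (inter_mem hv (Ioo_mem_nhds ht.1 ht.2))
    have hb : Metric.ball t r ∈ 𝓝[≠] t := mem_nhdsWithin_of_mem_nhds (Metric.ball_mem_nhds t hr)
    filter_upwards [hb, self_mem_nhdsWithin] with s hs hst x hx
    have hst' : s - t ≠ 0 := sub_ne_zero.2 hst
    -- Subtracting the linear part leaves a function with derivative at most `ε / 2`, uniformly in
    -- `x`. The mean value inequality then bounds the error of the difference quotient, and the
    -- factor `1 / 2` makes the final bound strict.
    have hder : ∀ y ∈ Metric.ball t r, HasDerivWithinAt (fun s => c s x - s * c' t x)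
        (c' y x - c' t x) (Metric.ball t r) y := by
      intro y hy
      have h2 := (hasDerivAt_id y).mul_const (c' t x)
      rw [one_mul] at h2
      exact ((hd y (hrv hy).2 x hx).sub h2).hasDerivWithinAt
    have hbd : ∀ y ∈ Metric.ball t r, ‖c' y x - c' t x‖ ≤ ε / 2 := fun y hy => by
      have := hv' y (hrv hy).1 x hx
      rw [← dist_eq_norm]
      exact le_of_lt this
    have hmv := (convex_ball t r).norm_image_sub_le_of_norm_hasDerivWithin_le hder hbd
      (Metric.mem_ball_self hr) hs
    have e : (s - t)⁻¹ * (c s x - c t x) - c' t x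
        = (s - t)⁻¹ * ((c s x - s * c' t x) - (c t x - t * c' t x)) := by
      field_simp
      ring
    rw [dist_comm, Real.dist_eq, e, abs_mul, abs_inv]
    have hpos : 0 < |s - t| := abs_pos.2 hst'
    rw [inv_mul_lt_iff₀ hpos]
    simp only [Real.norm_eq_abs] at hmv
    nlinarith

end Curves

end Electrowetting

namespace Electrowetting

/-! ### Constitutive relations -/

section Constitutive

/-- Two branches that agree to first order at `a` have equal one-sided derivatives there. -/
theorem hasDerivAt_ite_le {f f' g g' : ℝ → ℝ} (hf : ∀ x, HasDerivAt f (f' x) x)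
    (hg : ∀ x, HasDerivAt g (g' x) x) {a : ℝ} (h : f a = g a) (h' : f' a = g' a) (x : ℝ) :
    HasDerivAt (fun x => if x ≤ a then f x else g x) (if x ≤ a then f' x else g' x) x := by
  rcases lt_trichotomy x a with hx | rfl | hx
  · rw [if_pos hx.le]
    refine (hf x).congr_of_eventuallyEq ?_
    filter_upwards [gt_mem_nhds hx] with y hy
    rw [if_pos (le_of_lt hy)]
  · rw [if_pos le_rfl, ← hasDerivWithinAt_univ, ← Iic_union_Ici (a := x)]
    refine HasDerivWithinAt.union ?_ ?_
    · exact (hf x).hasDerivWithinAt.congr (fun y hy => if_pos hy) (if_pos le_rfl)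
    · rw [h']
      refine (hg x).hasDerivWithinAt.congr (fun y hy => ?_) (by simp [h])
      rcases eq_or_lt_of_le (mem_Ici.1 hy) with rfl | hlt
      · simp [h]
      · rw [if_neg (not_le.2 hlt)]
  · rw [if_neg (not_le.2 hx)]
    refine (hg x).congr_of_eventuallyEq ?_
    filter_upwards [lt_mem_nhds hx] with y hy
    rw [if_neg (not_le.2 hy)]

/-- The derivative of the double well potential. -/
noncomputable def doubleWellDeriv (ξ : ℝ) : ℝ :=
  if ξ ≤ -1 then 2 * (ξ + 1) else if ξ ≤ 1 then -(ξ * (1 - ξ ^ 2)) else 2 * (ξ - 1)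

/-- At `±1` both adjacent branches vanish together with their derivatives, so the pieces glue to a
`C¹` function. -/
theorem hasDerivAt_doubleWell (ξ : ℝ) : HasDerivAt doubleWell (doubleWellDeriv ξ) ξ := by
  have hA : ∀ x : ℝ, HasDerivAt (fun x : ℝ => (x + 1) ^ 2) (2 * (x + 1)) x := fun x => by
    simpa using ((hasDerivAt_id x).add_const 1).fun_pow 2
  have hB : ∀ x : ℝ, HasDerivAt (fun x : ℝ => (1 - x ^ 2) ^ 2 / 4) (-(x * (1 - x ^ 2))) x :=
    fun x => by
      refine (((((hasDerivAt_id x).pow 2).const_sub 1).pow 2).div_const 4).congr_deriv ?_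
      simp
      ring
  have hC : ∀ x : ℝ, HasDerivAt (fun x : ℝ => (x - 1) ^ 2) (2 * (x - 1)) x := fun x => by
    simpa using ((hasDerivAt_id x).sub_const 1).fun_pow 2
  have h := hasDerivAt_ite_le hA (hasDerivAt_ite_le hB hC (a := 1) (by norm_num) (by norm_num))
    (a := -1) (by norm_num) (by norm_num) ξ
  refine h.congr_of_eventuallyEq (Eventually.of_forall fun x => ?_)
  -- The potential is defined with a strict inequality at `-1` and the glued function with a weak
  -- one; the two agree since both branches are zero there.
  rcases lt_trichotomy x (-1) with hx | rfl | hx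
  · simp [doubleWell, hx, hx.le]
  · norm_num [doubleWell]
  · simp [doubleWell, not_lt.2 hx.le, not_le.2 hx]

theorem continuous_doubleWellDeriv : Continuous doubleWellDeriv := by
  refine Continuous.if_le (by fun_prop) (Continuous.if_le (by fun_prop) (by fun_prop)
    continuous_id continuous_const ?_) continuous_id continuous_const ?_
  · rintro x rfl; norm_num
  · rintro x rfl; norm_num

theorem doubleWell_nonneg (ξ : ℝ) : 0 ≤ doubleWell ξ := by
  unfold doubleWell
  split_ifs <;> positivity

theorem contDiff_wallEnergy (θ : ℝ) : ContDiff ℝ 1 (wallEnergy θ) := by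
  unfold wallEnergy
  fun_prop

theorem wallEnergyNorm_nonneg (θ s : ℝ) : 0 ≤ wallEnergyNorm θ s := by
  unfold wallEnergyNorm wallEnergy
  have h1 : |Real.cos θ / 2 * Real.sin (Real.pi * s / 2)| ≤ |Real.cos θ| / 2 := by
    rw [abs_mul, abs_div, abs_two]
    exact mul_le_of_le_one_right (by positivity) (Real.abs_sin_le_one _)
  linarith [neg_abs_le (Real.cos θ / 2 * Real.sin (Real.pi * s / 2))]

theorem IsMaterialLaw.pos {f : ℝ → ℝ} (hf : IsMaterialLaw f) (s : ℝ) : 0 < f s := by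
  obtain ⟨_, a, b, ha, h⟩ := hf
  exact ha.trans_le (h s).1

theorem continuous_psi (ℓ δ : ℝ) : Continuous (psi ℓ δ) := by
  unfold psi
  fun_prop

end Constitutive

/-! ### The standing assumptions and their consequences -/

/-- A solution of the electrowetting system together with all the standing assumptions. -/
structure Configuration {d : ℕ} (P : Params) (T : ℝ) (Ω Ωs : Set (Space d))
    (n : Space d → Space d) (B : Voltage d) (b : ℝ → Space d → Space d) (F : Fields d) : Prop where
  dim_pos : 0 < d
  admissible : P.Admissible
  domain : IsConvexDomain Ω
  domain' : IsConvexDomain Ωs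
  subset : Ω ⊆ Ωs
  normal_meas : Measurable n
  normal : ∀ᵐ x ∂(surface (frontier Ω)), IsOuterUnitNormal Ω x (n x)
  time_pos : 0 < T
  voltage : B.Regular T Ω Ωs
  solution : IsSolution P T Ω Ωs n B b F

section Consequences

variable {d : ℕ} {P : Params} {T : ℝ} {Ω Ωs : Set (Space d)} {n : Space d → Space d}
  {B : Voltage d} {b : ℝ → Space d → Space d} {F : Fields d}

theorem ae_mem_closure_surface :
    ∀ᵐ x ∂(surface (frontier Ω)), x ∈ closure Ω := by
  have := ae_restrict_mem (μ := (μHE[d - 1] : Measure (Space d)))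
    (isClosed_frontier (s := Ω)).measurableSet
  filter_upwards [this] with x hx using frontier_subset_closure hx

theorem aestronglyMeasurable_surface {E : Type*} [NormedAddCommGroup E] {f : Space d → E}
    (hf : ContinuousOn f (closure Ω)) : AEStronglyMeasurable f (surface (frontier Ω)) :=
  (hf.mono frontier_subset_closure).aestronglyMeasurable isClosed_frontier.measurableSet

theorem memLp_top_surface {E : Type*} [NormedAddCommGroup E] (hΩ : IsConvexDomain Ω)
    {f : Space d → E} (hf : ContinuousOn f (closure Ω)) : MemLp f ⊤ (surface (frontier Ω)) := by
  obtain ⟨C, hC⟩ := hΩ.bounded.isCompact_closure.exists_bound_of_continuousOn hf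
  refine memLp_top_of_bound (aestronglyMeasurable_surface hf) C ?_
  filter_upwards [ae_mem_closure_surface] with x hx using hC x hx

theorem MemLp.inner_top {X E : Type*} [MeasurableSpace X] {m : Measure X} [NormedAddCommGroup E]
    [InnerProductSpace ℝ E] {f g : X → E} (hf : MemLp f ⊤ m) (hg : MemLp g ⊤ m) :
    MemLp (fun x => inner ℝ (f x) (g x)) ⊤ m := by
  have h : MemLp (fun x => ‖f x‖ * ‖g x‖) ⊤ m := MemLp.mul (p := ⊤) (q := ⊤) hg.norm hf.norm
  refine h.mono (hf.1.inner hg.1) (Eventually.of_forall fun x => ?_)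
  rw [norm_mul, norm_norm, norm_norm]
  exact norm_inner_le_norm _ _

theorem MemLp.mul_top {X : Type*} [MeasurableSpace X] {m : Measure X} {f g : X → ℝ}
    (hf : MemLp f ⊤ m) (hg : MemLp g ⊤ m) : MemLp (fun x => f x * g x) ⊤ m :=
  MemLp.mul (p := ⊤) (q := ⊤) hg hf

theorem MemLp.smul_top {X E : Type*} [MeasurableSpace X] {m : Measure X} [NormedAddCommGroup E]
    [NormedSpace ℝ E] {f : X → ℝ} {g : X → E} (hf : MemLp f ⊤ m) (hg : MemLp g ⊤ m) :
    MemLp (fun x => f x • g x) ⊤ m :=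
  MemLp.smul (p := ⊤) (q := ⊤) hg hf

/-! ### Regularity of the coefficients and fields entering the energy. -/

namespace Configuration

variable (h : Configuration P T Ω Ωs n B b F)
include h

theorem isFiniteMeasure : IsFiniteMeasure (volume.restrict Ω) :=
  ⟨by rw [Measure.restrict_apply_univ]; exact h.domain.bounded.measure_lt_top⟩

theorem isFiniteMeasure_surface : IsFiniteMeasure (surface (frontier Ω)) :=
  isFiniteMeasure_surface_frontier h.dim_pos h.domain

theorem isCompact : IsCompact (closure Ω) := h.domain.bounded.isCompact_closure

theorem phi_slice {t : ℝ} (ht : t ∈ Icc 0 T) : ContinuousOn (F.φ t) (closure Ω) :=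
  h.solution.regular.φ_cont.comp (Continuous.prodMk_right t).continuousOn fun _ hx => ⟨ht, hx⟩

theorem phit_slice {t : ℝ} (ht : t ∈ Ioo 0 T) : ContinuousOn (F.φt t) (closure Ω) :=
  h.solution.regular.φt_cont.comp (Continuous.prodMk_right t).continuousOn fun _ hx => ⟨ht, hx⟩

theorem u_slice {t : ℝ} (ht : t ∈ Icc 0 T) : ContinuousOn (F.u t) (closure Ω) :=
  h.solution.regular.u_cont.comp (Continuous.prodMk_right t).continuousOn fun _ hx => ⟨ht, hx⟩

theorem ut_slice {t : ℝ} (ht : t ∈ Ioo 0 T) : ContinuousOn (F.ut t) (closure Ω) :=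
  h.solution.regular.ut_cont.comp (Continuous.prodMk_right t).continuousOn fun _ hx => ⟨ht, hx⟩

theorem memLp_top {E : Type*} [NormedAddCommGroup E] [SecondCountableTopology E]
    {f : Space d → E} (hf : ContinuousOn f (closure Ω)) : MemLp f ⊤ (volume.restrict Ω) :=
  memLp_of_continuousOn_closure h.domain.isOpen h.domain.bounded hf ⊤

theorem aestronglyMeasurable {E : Type*} [NormedAddCommGroup E] [SecondCountableTopology E]
    {f : Space d → E} (hf : ContinuousOn f (closure Ω)) :
    AEStronglyMeasurable f (volume.restrict Ω) := (h.memLp_top hf).1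

/-- Functions of the phase field are uniform curves. -/
theorem uniformCurve_comp_phi {g g' : ℝ → ℝ} (hg : ∀ s, HasDerivAt g (g' s) s)
    (hg' : Continuous g') :
    UniformCurve (closure Ω) T (fun t x => g (F.φ t x)) (fun t x => g' (F.φ t x) * F.φt t x) := by
  have hR := h.solution.regular
  have hgc : Continuous g := continuous_iff_continuousAt.2 fun s => (hg s).continuousAt
  refine UniformCurve.of_continuousOn h.isCompact (hgc.comp_continuousOn hR.φ_cont) ?_ ?_
  · exact fun t ht x hx => (hg _).comp t (hR.φ_deriv t ht x hx)
  · exact (hg'.comp_continuousOn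
      (hR.φ_cont.mono (prod_mono Ioo_subset_Icc_self le_rfl))).mul hR.φt_cont

theorem hasDerivAt_rho (s : ℝ) : HasDerivAt P.ρ (deriv P.ρ s) s :=
  (h.admissible.ρ_smooth.differentiable (by simp) s).hasDerivAt

theorem continuous_deriv_rho : Continuous (deriv P.ρ) :=
  h.admissible.ρ_smooth.continuous_deriv (by simp)

theorem hasDerivAt_eps (s : ℝ) : HasDerivAt P.ε (deriv P.ε s) s :=
  (h.admissible.ε_smooth.differentiable (by simp) s).hasDerivAt

theorem continuous_deriv_eps : Continuous (deriv P.ε) :=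
  h.admissible.ε_smooth.continuous_deriv (by simp)

/-- The kinetic energy density is a uniform curve. -/
theorem uniformCurve_kinetic :
    UniformCurve (closure Ω) T (fun t x => 1 / 2 * P.ρ (F.φ t x) * ‖F.u t x‖ ^ 2)
      (fun t x => 1 / 2 * (deriv P.ρ (F.φ t x) * F.φt t x * ‖F.u t x‖ ^ 2)
        + P.ρ (F.φ t x) * inner ℝ (F.ut t x) (F.u t x)) := by
  have hR := h.solution.regular
  have hρ := h.admissible.ρ_law.1
  have hφ := hR.φ_cont.mono (prod_mono (Ioo_subset_Icc_self (a := 0) (b := T)) le_rfl)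
  have hu := hR.u_cont.mono (prod_mono (Ioo_subset_Icc_self (a := 0) (b := T)) le_rfl)
  refine UniformCurve.of_continuousOn h.isCompact ?_ ?_ ?_
  · exact ((continuousOn_const (c := (1 / 2 : ℝ))).mul (hρ.comp_continuousOn hR.φ_cont)).mul
      (hR.u_cont.norm.pow 2)
  · intro t ht x hx
    have h1 := ((h.hasDerivAt_rho (F.φ t x)).comp t (hR.φ_deriv t ht x hx)).const_mul (1 / 2 : ℝ)
    have h2 := (hR.u_deriv t ht x hx).norm_sq
    refine (h1.mul h2).congr_deriv ?_
    rw [real_inner_comm (F.u t x)]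
    simp only [Function.comp]
    ring
  · exact ((continuousOn_const (c := (1 / 2 : ℝ))).mul
      (((h.continuous_deriv_rho.comp_continuousOn hφ).mul hR.φt_cont).mul (hu.norm.pow 2))).add
      ((hρ.comp_continuousOn hφ).mul (hR.ut_cont.inner hu))

omit h in
/-- The time derivative of the permittivity. -/
noncomputable def _root_.Electrowetting.epsStarRate (P : Params) (Ω : Set (Space d))
    (F : Fields d) (t : ℝ) (x : Space d) : ℝ :=
  Ω.indicator (fun x => deriv P.ε (F.φ t x) * F.φt t x) x

/-- The permittivity jumps across the boundary of `Ω`, but only its dependence on time matters, and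
in the plates it is constant. -/
theorem uniformCurve_epsStar :
    UniformCurve Ωs T (fun t x => P.epsStar Ω (F.φ t) x) (epsStarRate P Ω F) := by
  classical
  have h1 := ((h.uniformCurve_comp_phi h.hasDerivAt_eps h.continuous_deriv_eps).mono
    subset_closure).extend P.εD Ωs
  convert h1 using 3
  · simp only [Params.epsStar]
  · simp only [epsStarRate, indicator_apply]

theorem aestronglyMeasurable_epsStar {t : ℝ} (ht : t ∈ Icc 0 T) :
    AEStronglyMeasurable (P.epsStar Ω (F.φ t)) (volume.restrict Ωs) := by
  classical
  have h1 : AEStronglyMeasurable (fun x => P.ε (F.φ t x)) (volume.restrict Ω) :=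
    h.aestronglyMeasurable (h.admissible.ε_law.1.comp_continuousOn (h.phi_slice ht))
  have h2 : AEStronglyMeasurable (Ω.piecewise (fun x => P.ε (F.φ t x)) fun _ => P.εD) volume :=
    AEStronglyMeasurable.piecewise h.domain.isOpen.measurableSet h1 aestronglyMeasurable_const
  refine AEStronglyMeasurable.restrict (h2.congr (Eventually.of_forall fun x => ?_))
  simp only [Set.piecewise, Params.epsStar]

theorem aestronglyMeasurable_epsStarRate {t : ℝ} (ht : t ∈ Ioo 0 T) :
    AEStronglyMeasurable (epsStarRate P Ω F t) (volume.restrict Ωs) := by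
  have h1 : AEStronglyMeasurable (fun x => deriv P.ε (F.φ t x) * F.φt t x) (volume.restrict Ω) :=
    h.aestronglyMeasurable ((h.continuous_deriv_eps.comp_continuousOn
      (h.phi_slice (Ioo_subset_Icc_self ht))).mul (h.phit_slice ht))
  exact ((aestronglyMeasurable_indicator_iff h.domain.isOpen.measurableSet).2 h1).restrict

theorem curve_gradPhi : L2Curve (volume.restrict Ω) T F.gφ F.gφt :=
  ⟨fun t ht => (h.solution.regular.φ_h1 t ht).grad_memLp,
    fun t ht => (h.solution.regular.φt_h1 t ht).grad_memLp,
    h.solution.regular.gφ_cont, h.solution.regular.gφ_deriv⟩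

theorem curve_q : L2Curve (volume.restrict Ω) T F.q F.qt :=
  ⟨h.solution.regular.q_memLp, h.solution.regular.qt_memLp,
    h.solution.regular.q_cont, h.solution.regular.q_deriv⟩

theorem curve_gradV : L2Curve (volume.restrict Ωs) T F.gV F.gVt :=
  ⟨fun t ht => (h.solution.regular.V_h1 t ht).grad_memLp, h.solution.regular.gVt_memLp,
    h.solution.regular.gV_cont, h.solution.regular.gV_deriv⟩

theorem curve_gradV0 : L2Curve (volume.restrict Ωs) T B.gV0 B.gV0t :=
  ⟨fun t ht => (h.voltage.h1 t ht).grad_memLp, fun t ht => (h.voltage.h1_deriv t ht).grad_memLp,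
    h.voltage.cont_grad, h.voltage.deriv_grad⟩

omit h in
theorem _root_.Electrowetting.L2Curve.mono_measure {X E : Type*} [MeasurableSpace X]
    [NormedAddCommGroup E] [NormedSpace ℝ E] {m m' : Measure X} (hm : m' ≤ m)
    {f f' : ℝ → X → E} (hf : L2Curve m T f f') : L2Curve m' T f f' where
  memLp t ht := (hf.memLp t ht).mono_measure hm
  memLp' t ht := (hf.memLp' t ht).mono_measure hm
  cont t ht := tendsto_of_tendsto_of_tendsto_of_le_of_le tendsto_const_nhds (hf.cont t ht)
    (fun _ => zero_le) fun _ => eLpNorm_mono_measure _ hm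
  deriv t ht := tendsto_of_tendsto_of_tendsto_of_le_of_le tendsto_const_nhds (hf.deriv t ht)
    (fun _ => zero_le) fun _ => eLpNorm_mono_measure _ hm

theorem curve_V0 : L2Curve (volume.restrict Ω) T B.V0 B.V0t := by
  have h1 : L2Curve (volume.restrict Ωs) T B.V0 B.V0t :=
    ⟨fun t ht => (h.voltage.h1 t ht).memLp, fun t ht => (h.voltage.h1_deriv t ht).memLp,
      h.voltage.cont, h.voltage.deriv⟩
  exact h1.mono_measure (Measure.restrict_mono h.subset le_rfl)

/-- The electric displacement `ε⋆(φ) ∇V` is a curve in `L²`. -/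
theorem curve_displacement :
    L2Curve (volume.restrict Ωs) T (fun t x => P.epsStar Ω (F.φ t) x • F.gV t x)
      (fun t x => epsStarRate P Ω F t x • F.gV t x + P.epsStar Ω (F.φ t) x • F.gVt t x) :=
  L2Curve.smul (ae_restrict_mem h.domain'.isOpen.measurableSet) h.uniformCurve_epsStar
    (fun _ ht => h.aestronglyMeasurable_epsStar ht)
    (fun _ ht => h.aestronglyMeasurable_epsStarRate ht) h.curve_gradV

theorem memLp_tang_u {t : ℝ} (ht : t ∈ Icc 0 T) :
    MemLp (fun x => tang (n x) (F.u t x)) ⊤ (surface (frontier Ω)) := by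
  have hn : MemLp n ⊤ (surface (frontier Ω)) := by
    refine memLp_top_of_bound h.normal_meas.aestronglyMeasurable 1 ?_
    filter_upwards [h.normal] with x hx using hx.1.le
  have hu := memLp_top_surface h.domain (h.u_slice ht)
  exact hu.sub (MemLp.smul_top (MemLp.inner_top hu hn) hn)

/-- Boundedness and measurability are all that the energy identity requires of `b`, which is why
both choices of the tangential field are treated at once. -/
theorem memLp_b {t : ℝ} (ht : t ∈ Ioo 0 T) : MemLp (b t) ⊤ (surface (frontier Ω)) := by
  have hn : MemLp n ⊤ (surface (frontier Ω)) := by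
    refine memLp_top_of_bound h.normal_meas.aestronglyMeasurable 1 ?_
    filter_upwards [h.normal] with x hx using hx.1.le
  have hmem : ∀ᵐ x ∂(surface (frontier Ω)), x ∈ frontier Ω :=
    ae_restrict_mem isClosed_frontier.measurableSet
  rcases h.solution.closure_b with hb | ⟨τ, hτ, hτn, hb⟩
  · obtain ⟨hc, hb⟩ := hb t ht
    have hu := memLp_top_surface h.domain hc
    refine (memLp_congr_ae ?_).1 (hu.sub (MemLp.smul_top (MemLp.inner_top hu hn) hn))
    filter_upwards [hmem] with x hx
    rw [hb x hx]
    rfl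
  · have hτm : MemLp τ ⊤ (surface (frontier Ω)) := by
      refine memLp_top_of_bound hτ.aestronglyMeasurable 1 ?_
      filter_upwards [hτn] with x hx using hx.1.le
    have hψ := memLp_top_surface h.domain ((continuous_psi P.ls P.δ).comp_continuousOn
      (h.phi_slice (Ioo_subset_Icc_self ht)))
    refine (memLp_congr_ae ?_).1 (MemLp.smul_top hψ hτm)
    filter_upwards [hmem] with x hx
    rw [hb t ht x hx]
    rfl

end Configuration

end Consequences

end Electrowetting

namespace Electrowetting

/-! ### Transport of kinetic energy -/

section Kinetic

variable {d : ℕ}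

theorem MemLp.integrable_top_mul {X : Type*} [MeasurableSpace X] {m : Measure X} {c f : X → ℝ}
    (hc : MemLp c ⊤ m) (hf : Integrable f m) : Integrable (fun x => c x * f x) m :=
  memLp_one_iff_integrable.1 (MemLp.mul (p := ⊤) (q := 1) (memLp_one_iff_integrable.2 hf) hc)

theorem MemLp.integrable_inner' {X E : Type*} [MeasurableSpace X] {m : Measure X}
    [NormedAddCommGroup E] [InnerProductSpace ℝ E] {f g : X → E} (hf : MemLp f 2 m)
    (hg : MemLp g 2 m) : Integrable (fun x => inner ℝ (f x) (g x)) m := by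
  have h : Integrable (fun x => ‖f x‖ * ‖g x‖) m := hf.norm.integrable_mul hg.norm
  refine h.mono (hf.1.inner hg.1) (Eventually.of_forall fun x => ?_)
  rw [norm_mul, norm_norm, norm_norm]
  exact norm_inner_le_norm _ _

theorem integrable_mul_L2 {X : Type*} [MeasurableSpace X] {m : Measure X}
    {f g : X → ℝ} (hf : MemLp f 2 m) (hg : MemLp g 2 m) : Integrable (fun x => f x * g x) m :=
  hf.integrable_mul hg

theorem memLp_coord {X : Type*} [MeasurableSpace X] {m : Measure X} {f : X → Space d} {p : ℝ≥0∞}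
    (hf : MemLp f p m) (i : Fin d) : MemLp (fun x => f x i) p m :=
  (EuclideanSpace.proj i : Space d →L[ℝ] ℝ).comp_memLp' hf

/-- The kinetic energy density as a function of the phase field and the velocity components. -/
noncomputable def kineticFun (ρ : ℝ → ℝ) (y : Option (Fin d) → ℝ) : ℝ :=
  ρ (y none) * ∑ j, y (some j) ^ 2

theorem contDiff_kineticFun {ρ : ℝ → ℝ} (hρ : ContDiff ℝ 1 ρ) :
    ContDiff ℝ 1 (kineticFun (d := d) ρ) := by
  unfold kineticFun
  refine (hρ.comp (contDiff_apply ℝ ℝ _)).mul (ContDiff.sum fun j _ => ?_)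
  exact (contDiff_apply ℝ ℝ _).pow 2

/-- The derivative in direction `e` is read off from the one-variable function `s ↦ kineticFun ρ (y
+ s • e)` by uniqueness of derivatives. -/
theorem hasDerivAt_kineticFun_line {ρ : ℝ → ℝ} (hρ : ContDiff ℝ 1 ρ) (y e : Option (Fin d) → ℝ) :
    fderiv ℝ (kineticFun ρ) y e = deriv ρ (y none) * e none * (∑ j, y (some j) ^ 2)
      + ρ (y none) * ∑ j, 2 * y (some j) * e (some j) := by
  have h1 : HasFDerivAt (kineticFun ρ) (fderiv ℝ (kineticFun ρ) y) (y + (0 : ℝ) • e) := by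
    rw [zero_smul, add_zero]
    exact ((contDiff_kineticFun hρ).differentiable (by simp) y).hasFDerivAt
  have h2 : HasDerivAt (fun s : ℝ => y + s • e) e 0 := by
    simpa using ((hasDerivAt_id (0 : ℝ)).smul_const e).const_add y
  have h3 : HasDerivAt (fun s : ℝ => kineticFun ρ (y + s • e)) (fderiv ℝ (kineticFun ρ) y e) 0 :=
    HasFDerivAt.comp_hasDerivAt (x := (0 : ℝ)) (f := fun s : ℝ => y + s • e) h1 h2
  have hc : ∀ i, HasDerivAt (fun s : ℝ => y i + s * e i) (e i) 0 := fun i => by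
    simpa using ((hasDerivAt_id (0 : ℝ)).mul_const (e i)).const_add (y i)
  have h4 : HasDerivAt (fun s : ℝ => ρ (y none + s * e none)) (deriv ρ (y none) * e none) 0 := by
    have hρd : HasDerivAt ρ (deriv ρ (y none)) (y none + 0 * e none) := by
      rw [zero_mul, add_zero]
      exact (hρ.differentiable (by simp) _).hasDerivAt
    exact hρd.comp (0 : ℝ) (hc none)
  have h5 : HasDerivAt (fun s : ℝ => ∑ j, (y (some j) + s * e (some j)) ^ 2)
      (∑ j, 2 * y (some j) * e (some j)) 0 := by
    refine HasDerivAt.fun_sum fun j _ => ?_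
    simpa using (hc (some j)).fun_pow 2
  have h6 := h4.mul h5
  rw [h3.unique h6]
  simp

/-- The weak gradient of `ρ(φ) |u|²`. -/
noncomputable def kineticGrad (P : Params) (F : Fields d) (t : ℝ) (x : Space d) : Space d :=
  (deriv P.ρ (F.φ t x) * ‖F.u t x‖ ^ 2) • F.gφ t x
    + ∑ j, (P.ρ (F.φ t x) * (2 * F.u t x j)) • F.gu t j x

variable {P : Params} {T : ℝ} {Ω Ωs : Set (Space d)} {n : Space d → Space d}
  {B : Voltage d} {b : ℝ → Space d → Space d} {F : Fields d}

namespace Configuration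

variable (h : Configuration P T Ω Ωs n B b F)
include h

/-- Makes the kinetic density admissible in the Green formula that encodes `u · n = 0`. Continuity
of `φ` and `u` up to the boundary is what lets the chain rule apply. -/
theorem isH1_kinetic {t : ℝ} (ht : t ∈ Ioo 0 T) :
    IsH1 Ω (fun x => P.ρ (F.φ t x) * ‖F.u t x‖ ^ 2) (kineticGrad P F t) := by
  have ht' := Ioo_subset_Icc_self ht
  set f : Option (Fin d) → Space d → ℝ := fun i => i.elim (F.φ t) fun j x => F.u t x j with hf
  set g : Option (Fin d) → Space d → Space d := fun i => i.elim (F.gφ t) fun j => F.gu t j with hg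
  have hfg : ∀ i, IsH1 Ω (f i) (g i) := fun i => by
    cases i with
    | none => exact h.solution.regular.φ_h1 t ht'
    | some j => exact h.solution.regular.u_h1 t ht j
  have hfc : ∀ i, ContinuousOn (f i) (closure Ω) := by
    intro i
    cases i with
    | none => exact h.phi_slice ht'
    | some j =>
      exact (EuclideanSpace.proj j : Space d →L[ℝ] ℝ).continuous.comp_continuousOn
        (h.u_slice ht')
  have hρ := h.admissible.ρ_smooth
  have key := IsH1.comp_contDiff h.domain.isOpen h.domain.bounded hfg hfc
    (contDiff_kineticFun (d := d) hρ)
  have e1 : (fun x => kineticFun P.ρ fun i => f i x)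
      = fun x => P.ρ (F.φ t x) * ‖F.u t x‖ ^ 2 := by
    ext x
    simp [kineticFun, hf, EuclideanSpace.real_norm_sq_eq]
  have e2 : (fun x => ∑ i, fderiv ℝ (kineticFun P.ρ) (fun j => f j x) (Pi.single i 1) • g i x)
      = kineticGrad P F t := by
    ext1 x
    simp_rw [hasDerivAt_kineticFun_line hρ]
    rw [Fintype.sum_option]
    simp [kineticGrad, hf, hg, EuclideanSpace.real_norm_sq_eq, Pi.single_apply]
  rwa [e1, e2] at key

/-- The factor `σ (σ u)_t` is designed so that its product with `u` is the time derivative of `ρ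
|u|² / 2`. The convective terms add up to half the divergence of `ρ |u|² u`, without using `div u =
0`. -/
theorem inner_materialDeriv {t : ℝ} (ht : t ∈ Ioo 0 T) {x : Space d} (hx : x ∈ closure Ω) :
    inner ℝ (materialDeriv P F t x) (F.u t x) =
      (1 / 2 * (deriv P.ρ (F.φ t x) * F.φt t x * ‖F.u t x‖ ^ 2)
        + P.ρ (F.φ t x) * inner ℝ (F.ut t x) (F.u t x))
      + 1 / 2 * (inner ℝ (F.u t x) (kineticGrad P F t x)
        + divg (F.gu t) x * (P.ρ (F.φ t x) * ‖F.u t x‖ ^ 2)) := by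
  have hpos := h.admissible.ρ_law.pos (F.φ t x)
  have hs : √(P.ρ (F.φ t x)) ≠ 0 := (Real.sqrt_pos.2 hpos).ne'
  have hsq : √(P.ρ (F.φ t x)) * √(P.ρ (F.φ t x)) = P.ρ (F.φ t x) := Real.mul_self_sqrt hpos.le
  have h1 : HasDerivAt (fun s => √(P.ρ (F.φ s x)))
      (deriv P.ρ (F.φ t x) * F.φt t x / (2 * √(P.ρ (F.φ t x)))) t :=
    ((h.hasDerivAt_rho (F.φ t x)).comp t (h.solution.regular.φ_deriv t ht x hx)).sqrt hpos.ne'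
  have h2 := (h1.smul (h.solution.regular.u_deriv t ht x hx)).deriv
  have h3 : √(P.ρ (F.φ t x)) • deriv (fun s => √(P.ρ (F.φ s x)) • F.u s x) t
      = P.ρ (F.φ t x) • F.ut t x
        + (1 / 2 * (deriv P.ρ (F.φ t x) * F.φt t x)) • F.u t x := by
    rw [show (fun s => √(P.ρ (F.φ s x)) • F.u s x)
      = (fun s => √(P.ρ (F.φ s x))) • fun s => F.u s x from rfl, h2, smul_add, smul_smul, smul_smul,
      hsq]
    congr 2
    field_simp
  have h4 : inner ℝ (advect (F.u t) (F.gu t) x) (F.u t x)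
      = ∑ j, F.u t x j * inner ℝ (F.u t x) (F.gu t j x) := by
    simp [advect, PiLp.inner_apply]
  have h5 : inner ℝ (F.u t x) (kineticGrad P F t x)
      = deriv P.ρ (F.φ t x) * ‖F.u t x‖ ^ 2 * inner ℝ (F.gφ t x) (F.u t x)
        + 2 * P.ρ (F.φ t x) * ∑ j, F.u t x j * inner ℝ (F.u t x) (F.gu t j x) := by
    rw [kineticGrad, inner_add_right, real_inner_smul_right, inner_sum, Finset.mul_sum,
      real_inner_comm]
    congr 1
    refine Finset.sum_congr rfl fun j _ => ?_
    rw [real_inner_smul_right]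
    ring
  rw [materialDeriv, h3, inner_add_left, inner_add_left, inner_add_left, real_inner_smul_left,
    real_inner_smul_left, real_inner_smul_left, real_inner_smul_left, h4, h5,
    real_inner_self_eq_norm_sq]
  ring

theorem memLp_divg {t : ℝ} (ht : t ∈ Ioo 0 T) :
    MemLp (divg (F.gu t)) 2 (volume.restrict Ω) := by
  unfold divg
  exact memLp_finsetSum _ fun j _ => memLp_coord (h.solution.regular.u_h1 t ht j).grad_memLp j

/-- Tested with the velocity, the material term is the rate of change of the kinetic energy. -/
theorem integral_inner_materialDeriv {t : ℝ} (ht : t ∈ Ioo 0 T) :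
    ∫ x in Ω, inner ℝ (materialDeriv P F t x) (F.u t x) =
      ∫ x in Ω, (1 / 2 * (deriv P.ρ (F.φ t x) * F.φt t x * ‖F.u t x‖ ^ 2)
        + P.ρ (F.φ t x) * inner ℝ (F.ut t x) (F.u t x)) := by
  have ht' := Ioo_subset_Icc_self ht
  have := h.isFiniteMeasure
  have hK := h.isH1_kinetic ht
  have hu := h.u_slice ht'
  have i1 : Integrable (fun x => 1 / 2 * (deriv P.ρ (F.φ t x) * F.φt t x * ‖F.u t x‖ ^ 2)
        + P.ρ (F.φ t x) * inner ℝ (F.ut t x) (F.u t x)) (volume.restrict Ω) := by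
    refine (h.memLp_top ?_).integrable le_top
    exact (continuousOn_const.mul (((h.continuous_deriv_rho.comp_continuousOn
      (h.phi_slice ht')).mul (h.phit_slice ht)).mul (hu.norm.pow 2))).add
      ((h.admissible.ρ_law.1.comp_continuousOn (h.phi_slice ht')).mul ((h.ut_slice ht).inner hu))
  have i2 : Integrable (fun x => inner ℝ (F.u t x) (kineticGrad P F t x)
        + divg (F.gu t) x * (P.ρ (F.φ t x) * ‖F.u t x‖ ^ 2)) (volume.restrict Ω) :=
    (MemLp.integrable_inner' ((h.memLp_top hu).mono_exponent le_top) hK.grad_memLp).add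
      (integrable_mul_L2 (h.memLp_divg ht) hK.memLp)
  have e : ∫ x in Ω, inner ℝ (materialDeriv P F t x) (F.u t x)
      = ∫ x in Ω, ((1 / 2 * (deriv P.ρ (F.φ t x) * F.φt t x * ‖F.u t x‖ ^ 2)
        + P.ρ (F.φ t x) * inner ℝ (F.ut t x) (F.u t x))
      + 1 / 2 * (inner ℝ (F.u t x) (kineticGrad P F t x)
        + divg (F.gu t) x * (P.ρ (F.φ t x) * ‖F.u t x‖ ^ 2))) :=
    setIntegral_congr_fun h.domain.isOpen.measurableSet fun x hx =>
      h.inner_materialDeriv ht (subset_closure hx)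
  -- The second bracket has the form `u · ∇χ + χ div u` with `χ = ρ(φ) |u|²`, so its integral
  -- vanishes by impermeability.
  rw [e, integral_add i1 (i2.const_mul _), integral_const_mul,
    h.solution.impermeable t ht _ _ hK]
  simp

end Configuration

end Kinetic

end Electrowetting

namespace Electrowetting

/-! ### The energy identity -/

section Identity

variable {d : ℕ} {P : Params} {T : ℝ} {Ω Ωs : Set (Space d)} {n : Space d → Space d}
  {B : Voltage d} {b : ℝ → Space d → Space d} {F : Fields d}

theorem integral_add_add {X : Type*} [MeasurableSpace X] {m : Measure X} {f g k : X → ℝ}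
    (hf : Integrable f m) (hg : Integrable g m) (hk : Integrable k m) :
    ∫ x, (f x + g x + k x) ∂m = (∫ x, f x ∂m) + (∫ x, g x ∂m) + ∫ x, k x ∂m := by
  have hfg : Integrable (fun x => f x + g x) m := hf.add hg
  rw [integral_add hfg hk, integral_add hf hg]

/-- The electric displacement `ε⋆(φ) ∇V`. -/
noncomputable def displacement (P : Params) (Ω : Set (Space d)) (F : Fields d) (t : ℝ)
    (x : Space d) : Space d := P.epsStar Ω (F.φ t) x • F.gV t x

/-- The time derivative of the electric displacement. -/
noncomputable def displacementRate (P : Params) (Ω : Set (Space d)) (F : Fields d) (t : ℝ)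
    (x : Space d) : Space d :=
  epsStarRate P Ω F t x • F.gV t x + P.epsStar Ω (F.φ t) x • F.gVt t x

/-- The energy of the system relative to the applied voltage. -/
noncomputable def relativeEnergy (P : Params) (Ω Ωs : Set (Space d)) (B : Voltage d)
    (F : Fields d) (t : ℝ) : ℝ :=
  (∫ x in Ω, 1 / 2 * P.ρ (F.φ t x) * ‖F.u t x‖ ^ 2)
    + P.lam / 2 * (∫ x in Ω, inner ℝ (F.q t x) (F.q t x))
    + P.γ * P.δ / 2 * (∫ x in Ω, inner ℝ (F.gφ t x) (F.gφ t x))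
    + P.γ / P.δ * (∫ x in Ω, doubleWell (F.φ t x))
    + P.γ * (∫ x, wallEnergyNorm P.θs (F.φ t x) ∂(surface (frontier Ω)))
    + 1 / 2 * (∫ x in Ωs, inner ℝ (displacement P Ω F t x) (F.gV t x))
    + (∫ x in Ω, inner ℝ (F.q t x) (B.V0 t x))
    - ∫ x in Ωs, inner ℝ (displacement P Ω F t x) (B.gV0 t x)

/-- The power supplied by the applied voltage. -/
noncomputable def voltagePower (P : Params) (Ω Ωs : Set (Space d)) (B : Voltage d)
    (F : Fields d) (t : ℝ) : ℝ :=
  (∫ x in Ω, inner ℝ (F.q t x) (B.V0t t x))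
    - ∫ x in Ωs, inner ℝ (displacement P Ω F t x) (B.gV0t t x)

namespace Configuration

variable (h : Configuration P T Ω Ωs n B b F)
include h

theorem curve_displacement' :
    L2Curve (volume.restrict Ωs) T (displacement P Ω F) (displacementRate P Ω F) :=
  h.curve_displacement

/-- The potential equation, differentiated in time and tested with `V - V₀`. -/
theorem displacementRate_identity {t : ℝ} (ht : t ∈ Ioo 0 T) :
    (∫ x in Ωs, inner ℝ (displacementRate P Ω F t x) (F.gV t x))
        - ∫ x in Ωs, inner ℝ (displacementRate P Ω F t x) (B.gV0 t x)
      = (∫ x in Ω, F.qt t x * F.V t x) - ∫ x in Ω, F.qt t x * B.V0 t x := by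
  have ht' := Ioo_subset_Icc_self ht
  have hle : volume.restrict Ω ≤ volume.restrict Ωs := Measure.restrict_mono h.subset le_rfl
  have hW := h.solution.voltage t ht'
  have hV := h.solution.regular.V_h1 t ht'
  have hV0 := h.voltage.h1 t ht'
  have hqt := h.solution.regular.qt_memLp t ht
  have hD := h.curve_displacement'.memLp' t ht
  -- The test function `V - V₀` is frozen at the time `t`. The equation holds at all nearby times
  -- `s` with this fixed test function, so both sides may be differentiated in `s`, and only the
  -- displacement and the charge contribute.
  have c1 : L2Curve (volume.restrict Ωs) T (fun _ x => F.gV t x - B.gV0 t x) (fun _ _ => 0) :=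
    L2Curve.const hW.1.grad_memLp T
  have c2 : L2Curve (volume.restrict Ω) T (fun _ x => F.V t x - B.V0 t x) (fun _ _ => 0) :=
    L2Curve.const (hW.1.memLp.mono_measure hle) T
  have d1 := h.curve_displacement'.hasDerivAt_integral_inner c1 ht
  have d2 := h.curve_q.hasDerivAt_integral_inner c2 ht
  have heq : (fun s => ∫ x in Ωs, inner ℝ (displacement P Ω F s x) (F.gV t x - B.gV0 t x))
      =ᶠ[𝓝 t] fun s => ∫ x in Ω, inner ℝ (F.q s x) (F.V t x - B.V0 t x) := by
    filter_upwards [Ioo_mem_nhds ht.1 ht.2] with s hs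
    have := h.solution.potential s hs _ _ hW
    simp only [displacement, real_inner_smul_left]
    rw [this]
    simp [mul_comm]
  have key := d1.unique (d2.congr_of_eventuallyEq heq)
  simp only [inner_zero_right, integral_zero, zero_add] at key
  rw [← integral_sub (MemLp.integrable_inner' hD hV.grad_memLp)
    (MemLp.integrable_inner' hD hV0.grad_memLp),
    ← integral_sub (integrable_mul_L2 hqt (hV.memLp.mono_measure hle))
    (integrable_mul_L2 hqt (hV0.memLp.mono_measure hle))]
  simp only [inner_sub_right] at key
  rw [key]
  refine integral_congr_ae (Eventually.of_forall fun x => ?_)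
  simp only [RCLike.inner_apply, conj_trivial]
  ring

/-- The product rule for `ε⋆ ∇V`, with the rate of `ε⋆` carried by `Ω`. It isolates the `ε'(φ)
|∇V|²` term that cancels the electric term in the chemical potential. -/
theorem integral_displacementRate_inner {t : ℝ} (ht : t ∈ Ioo 0 T) :
    ∫ x in Ωs, inner ℝ (displacementRate P Ω F t x) (F.gV t x)
      = (∫ x in Ω, deriv P.ε (F.φ t x) * ‖F.gV t x‖ ^ 2 * F.φt t x)
        + ∫ x in Ωs, inner ℝ (displacement P Ω F t x) (F.gVt t x) := by
  have ht' := Ioo_subset_Icc_self ht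
  have hV := (h.solution.regular.V_h1 t ht').grad_memLp
  have hVt := h.solution.regular.gVt_memLp t ht
  obtain ⟨C, hC⟩ := h.uniformCurve_epsStar.bdd' t ht
  have m1 : MemLp (fun x => epsStarRate P Ω F t x • F.gV t x) 2 (volume.restrict Ωs) :=
    memLp_smul_of_bounded (ae_restrict_mem h.domain'.isOpen.measurableSet) hC
      (h.aestronglyMeasurable_epsStarRate ht) hV
  have m2 := h.curve_displacement'.memLp t ht'
  have e : ∀ x, inner ℝ (displacementRate P Ω F t x) (F.gV t x)
      = inner ℝ (epsStarRate P Ω F t x • F.gV t x) (F.gV t x)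
        + inner ℝ (displacement P Ω F t x) (F.gVt t x) := fun x => by
    rw [displacementRate, displacement, inner_add_left, real_inner_smul_left (F.gV t x) (F.gVt t x),
      real_inner_smul_left (F.gVt t x), real_inner_comm (F.gVt t x)]
  simp_rw [e]
  rw [integral_add (MemLp.integrable_inner' m1 hV) (MemLp.integrable_inner' m2 hVt)]
  congr 1
  have e2 : ∀ x, inner ℝ (epsStarRate P Ω F t x • F.gV t x) (F.gV t x)
      = Ω.indicator (fun x => deriv P.ε (F.φ t x) * ‖F.gV t x‖ ^ 2 * F.φt t x) x := fun x => by
    rw [real_inner_smul_left, real_inner_self_eq_norm_sq, epsStarRate]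
    by_cases hx : x ∈ Ω
    · simp only [hx, indicator_of_mem]; ring
    · simp [hx]
  simp_rw [e2]
  rw [setIntegral_indicator h.domain.isOpen.measurableSet, inter_eq_self_of_subset_right h.subset]

/-- The boundary integrals in the dissipation. -/
theorem integral_boundary_dissipation {t : ℝ} (ht : t ∈ Ioo 0 T) :
    ∫ x, (P.β (F.φ t x) * ‖tang (n x) (F.u t x)‖ ^ 2
        + P.α * (F.φt t x + inner ℝ (tang (n x) (F.u t x)) (b t x)) ^ 2) ∂(surface (frontier Ω))
      = (∫ x, P.β (F.φ t x) * inner ℝ (tang (n x) (F.u t x)) (tang (n x) (F.u t x))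
          ∂(surface (frontier Ω)))
        + P.α * ((∫ x, (F.φt t x + inner ℝ (tang (n x) (F.u t x)) (b t x)) * F.φt t x
            ∂(surface (frontier Ω)))
          + (∫ x, F.φt t x * inner ℝ (tang (n x) (F.u t x)) (b t x) ∂(surface (frontier Ω)))
          + ∫ x, inner ℝ (tang (n x) (F.u t x)) (b t x) * inner ℝ (tang (n x) (F.u t x)) (b t x)
            ∂(surface (frontier Ω))) := by
  have ht' := Ioo_subset_Icc_self ht
  have := h.isFiniteMeasure_surface
  have mβ := memLp_top_surface h.domain
    (h.admissible.β_law.1.comp_continuousOn (h.phi_slice ht'))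
  have mφ := memLp_top_surface h.domain (h.phit_slice ht)
  have mu := h.memLp_tang_u ht'
  have mub := MemLp.inner_top mu (h.memLp_b ht)
  have i1 := (MemLp.mul_top mβ (MemLp.inner_top mu mu)).integrable le_top
  have i2 := (MemLp.mul_top (mφ.add mub) mφ).integrable le_top
  have i3 := (MemLp.mul_top mφ mub).integrable le_top
  have i4 := (MemLp.mul_top mub mub).integrable le_top
  simp only [Function.comp, Pi.add_apply] at i1 i2 i3 i4
  have i5 : Integrable (fun x => P.α * ((F.φt t x + inner ℝ (tang (n x) (F.u t x)) (b t x))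
      * F.φt t x + F.φt t x * inner ℝ (tang (n x) (F.u t x)) (b t x)
      + inner ℝ (tang (n x) (F.u t x)) (b t x) * inner ℝ (tang (n x) (F.u t x)) (b t x)))
      (surface (frontier Ω)) := ((i2.add i3).add i4).const_mul P.α
  -- The first `α` integral comes from the equation of `μ`, the other two from the momentum
  -- equation; together they complete the square.
  rw [← integral_add_add i2 i3 i4, ← integral_const_mul, ← integral_add i1 i5]
  refine integral_congr_ae (Eventually.of_forall fun x => ?_)
  simp only [real_inner_self_eq_norm_sq]
  ring

theorem integrable_symDot {t : ℝ} (ht : t ∈ Ioo 0 T) :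
    Integrable (symDot (F.gu t) (F.gu t)) (volume.restrict Ω) := by
  have hc : ∀ i j, MemLp (fun x => symGrad (F.gu t) x i j) 2 (volume.restrict Ω) := fun i j => by
    have hij := (memLp_coord (h.solution.regular.u_h1 t ht i).grad_memLp j).add
      (memLp_coord (h.solution.regular.u_h1 t ht j).grad_memLp i)
    refine (hij.const_mul (1 / 2)).ae_eq (Eventually.of_forall fun x => ?_)
    simp only [symGrad, Pi.add_apply]
    ring
  unfold symDot
  exact integrable_finsetSum _ fun i _ => integrable_finsetSum _ fun j _ =>
    integrable_mul_L2 (hc i j) (hc i j)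

/-- The electrochemical potential `λ q + V`. -/
theorem isH1_potential {t : ℝ} (ht : t ∈ Ioo 0 T) :
    IsH1 Ω (fun x => P.lam * F.q t x + F.V t x) (fun x => P.lam • F.gq t x + F.gV t x) :=
  (h.solution.regular.q_h1 t ht).smul_add P.lam
    ((h.solution.regular.V_h1 t (Ioo_subset_Icc_self ht)).restrict h.domain'.isOpen
      h.domain.isOpen h.subset)

/-- The bulk integrals in the dissipation. -/
theorem integral_bulk_dissipation {t : ℝ} (ht : t ∈ Ioo 0 T) :
    ∫ x in Ω, (P.η (F.φ t x) * symDot (F.gu t) (F.gu t) x + P.M (F.φ t x) * ‖F.gμ t x‖ ^ 2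
        + P.K (F.φ t x) * ‖P.lam • F.gq t x + F.gV t x‖ ^ 2)
      = (∫ x in Ω, P.η (F.φ t x) * symDot (F.gu t) (F.gu t) x)
        + (∫ x in Ω, P.M (F.φ t x) * inner ℝ (F.gμ t x) (F.gμ t x))
        + ∫ x in Ω, P.K (F.φ t x) * inner ℝ (P.lam • F.gq t x + F.gV t x)
          (P.lam • F.gq t x + F.gV t x) := by
  have hφ := h.phi_slice (Ioo_subset_Icc_self ht)
  have hμ := (h.solution.regular.μ_h1 t ht).grad_memLp
  have hr := (h.isH1_potential ht).grad_memLp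
  have i1 := MemLp.integrable_top_mul
    (h.memLp_top (h.admissible.η_law.1.comp_continuousOn hφ)) (h.integrable_symDot ht)
  have i2 := MemLp.integrable_top_mul
    (h.memLp_top (h.admissible.M_law.1.comp_continuousOn hφ)) (MemLp.integrable_inner' hμ hμ)
  have i3 := MemLp.integrable_top_mul
    (h.memLp_top (h.admissible.K_law.1.comp_continuousOn hφ)) (MemLp.integrable_inner' hr hr)
  simp only [Function.comp] at i1 i2 i3
  rw [← integral_add_add i1 i2 i3]
  refine integral_congr_ae (Eventually.of_forall fun x => ?_)
  simp only [real_inner_self_eq_norm_sq]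

/-! ### Continuity in time of the parts of the energy. -/

theorem uniformCurve_doubleWell :
    UniformCurve (closure Ω) T (fun t x => doubleWell (F.φ t x))
      (fun t x => doubleWellDeriv (F.φ t x) * F.φt t x) :=
  h.uniformCurve_comp_phi hasDerivAt_doubleWell continuous_doubleWellDeriv

theorem uniformCurve_wallEnergyNorm :
    UniformCurve (closure Ω) T (fun t x => wallEnergyNorm P.θs (F.φ t x))
      (fun t x => deriv (wallEnergy P.θs) (F.φ t x) * F.φt t x) :=
  h.uniformCurve_comp_phi (g := wallEnergyNorm P.θs)
    (fun s => ((contDiff_wallEnergy P.θs).differentiable (by simp) s).hasDerivAt.add_const _)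
    ((contDiff_wallEnergy P.θs).continuous_deriv (by simp))

omit h in
theorem _root_.Electrowetting.continuous_doubleWell : Continuous doubleWell :=
  continuous_iff_continuousAt.2 fun s => (hasDerivAt_doubleWell s).continuousAt

omit h in
theorem _root_.Electrowetting.continuous_wallEnergyNorm (θ : ℝ) :
    Continuous (wallEnergyNorm θ) :=
  (contDiff_wallEnergy θ).continuous.add continuous_const

theorem ae_mem_closure : ∀ᵐ x ∂(volume.restrict Ω), x ∈ closure Ω := by
  filter_upwards [ae_restrict_mem h.domain.isOpen.measurableSet] with x hx
    using subset_closure hx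

theorem kinetic_slice {t : ℝ} (ht : t ∈ Icc 0 T) :
    ContinuousOn (fun x => 1 / 2 * P.ρ (F.φ t x) * ‖F.u t x‖ ^ 2) (closure Ω) :=
  (continuousOn_const.mul (h.admissible.ρ_law.1.comp_continuousOn (h.phi_slice ht))).mul
    ((h.u_slice ht).norm.pow 2)

theorem kineticRate_slice {t : ℝ} (ht : t ∈ Ioo 0 T) :
    ContinuousOn (fun x => 1 / 2 * (deriv P.ρ (F.φ t x) * F.φt t x * ‖F.u t x‖ ^ 2)
      + P.ρ (F.φ t x) * inner ℝ (F.ut t x) (F.u t x)) (closure Ω) := by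
  have ht' := Ioo_subset_Icc_self ht
  have hu := h.u_slice ht'
  exact (continuousOn_const.mul (((h.continuous_deriv_rho.comp_continuousOn
    (h.phi_slice ht')).mul (h.phit_slice ht)).mul (hu.norm.pow 2))).add
    ((h.admissible.ρ_law.1.comp_continuousOn (h.phi_slice ht')).mul ((h.ut_slice ht).inner hu))

theorem doubleWellRate_slice {t : ℝ} (ht : t ∈ Ioo 0 T) :
    ContinuousOn (fun x => doubleWellDeriv (F.φ t x) * F.φt t x) (closure Ω) :=
  (continuous_doubleWellDeriv.comp_continuousOn (h.phi_slice (Ioo_subset_Icc_self ht))).mul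
    (h.phit_slice ht)

theorem wallRate_slice {t : ℝ} (ht : t ∈ Ioo 0 T) :
    ContinuousOn (fun x => deriv (wallEnergy P.θs) (F.φ t x) * F.φt t x) (closure Ω) :=
  (((contDiff_wallEnergy P.θs).continuous_deriv (by simp)).comp_continuousOn
    (h.phi_slice (Ioo_subset_Icc_self ht))).mul (h.phit_slice ht)

theorem continuousOn_integral_kinetic :
    ContinuousOn (fun t => ∫ x in Ω, 1 / 2 * P.ρ (F.φ t x) * ‖F.u t x‖ ^ 2) (Icc 0 T) :=
  have := h.isFiniteMeasure
  h.uniformCurve_kinetic.continuousOn_integral h.ae_mem_closure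
    (fun _ ht => h.aestronglyMeasurable (h.kinetic_slice ht))
    fun _ ht => h.aestronglyMeasurable (h.kineticRate_slice ht)

theorem continuousOn_integral_doubleWell :
    ContinuousOn (fun t => ∫ x in Ω, doubleWell (F.φ t x)) (Icc 0 T) :=
  have := h.isFiniteMeasure
  h.uniformCurve_doubleWell.continuousOn_integral h.ae_mem_closure
    (fun _ ht => h.aestronglyMeasurable (continuous_doubleWell.comp_continuousOn (h.phi_slice ht)))
    fun _ ht => h.aestronglyMeasurable (h.doubleWellRate_slice ht)

theorem continuousOn_integral_wall :
    ContinuousOn (fun t => ∫ x, wallEnergyNorm P.θs (F.φ t x) ∂(surface (frontier Ω)))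
      (Icc 0 T) :=
  have := h.isFiniteMeasure_surface
  h.uniformCurve_wallEnergyNorm.continuousOn_integral ae_mem_closure_surface
    (fun _ ht => aestronglyMeasurable_surface
      ((continuous_wallEnergyNorm _).comp_continuousOn (h.phi_slice ht)))
    fun _ ht => aestronglyMeasurable_surface (h.wallRate_slice ht)

theorem continuousOn_relativeEnergy : ContinuousOn (relativeEnergy P Ω Ωs B F) (Icc 0 T) := by
  have cD := h.curve_displacement'
  exact (((((((h.continuousOn_integral_kinetic).add
    (continuousOn_const.mul (h.curve_q.continuousOn_integral_inner h.curve_q))).add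
    (continuousOn_const.mul (h.curve_gradPhi.continuousOn_integral_inner h.curve_gradPhi))).add
    (continuousOn_const.mul h.continuousOn_integral_doubleWell)).add
    (continuousOn_const.mul h.continuousOn_integral_wall)).add
    (continuousOn_const.mul (cD.continuousOn_integral_inner h.curve_gradV))).add
    (h.curve_q.continuousOn_integral_inner h.curve_V0)).sub
    (cD.continuousOn_integral_inner h.curve_gradV0)

/-- The correction terms in the relative energy absorb the pairings of the rates of displacement and
charge with `V₀`, so the supplied power contains only the time derivative of the applied voltage. -/
theorem energy_identity {t : ℝ} (ht : t ∈ Ioo 0 T) :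
    HasDerivAt (relativeEnergy P Ω Ωs B F)
      (voltagePower P Ω Ωs B F t - dissipation P Ω n F b t) t := by
  have ht' := Ioo_subset_Icc_self ht
  have := h.isFiniteMeasure
  have := h.isFiniteMeasure_surface
  have hR := h.solution.regular
  have cD := h.curve_displacement'
  have d1 := h.uniformCurve_kinetic.hasDerivAt_integral h.ae_mem_closure
    (fun _ ht => h.aestronglyMeasurable (h.kinetic_slice ht))
    (fun _ ht => h.aestronglyMeasurable (h.kineticRate_slice ht)) ht
  have d2 := (h.curve_q.hasDerivAt_integral_inner h.curve_q ht).const_mul (P.lam / 2)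
  have d3 := (h.curve_gradPhi.hasDerivAt_integral_inner h.curve_gradPhi ht).const_mul
    (P.γ * P.δ / 2)
  have d4 := (h.uniformCurve_doubleWell.hasDerivAt_integral h.ae_mem_closure
    (fun _ ht => h.aestronglyMeasurable (continuous_doubleWell.comp_continuousOn (h.phi_slice ht)))
    (fun _ ht => h.aestronglyMeasurable (h.doubleWellRate_slice ht)) ht).const_mul (P.γ / P.δ)
  have d5 := (h.uniformCurve_wallEnergyNorm.hasDerivAt_integral
    (ae_mem_closure_surface (Ω := Ω)) (fun _ ht => aestronglyMeasurable_surface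
      ((continuous_wallEnergyNorm _).comp_continuousOn (h.phi_slice ht)))
    (fun _ ht => aestronglyMeasurable_surface (h.wallRate_slice ht)) ht).const_mul P.γ
  have d6 := (cD.hasDerivAt_integral_inner h.curve_gradV ht).const_mul (1 / 2)
  have d7 := h.curve_q.hasDerivAt_integral_inner h.curve_V0 ht
  have d8 := cD.hasDerivAt_integral_inner h.curve_gradV0 ht
  have hder := ((((((d1.add d2).add d3).add d4).add d5).add d6).add d7).sub d8
  refine hder.congr_deriv ?_
  -- the equations, tested with the solution
  have hphase := h.solution.phase t ht _ _ (hR.μ_h1 t ht)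
  -- The rate `φ_t` is admissible because it is both in `H¹` and continuous up to the boundary.
  have hchem := h.solution.chem t ht _ _ (hR.φt_h1 t ht) (h.phit_slice ht)
  have hmom := h.solution.momentum t ht _ _ (hR.u_h1 t ht) (h.u_slice ht')
    (h.solution.impermeable t ht)
  have hcharge := h.solution.charge t ht _ _ (h.isH1_potential ht)
  have hel := h.displacementRate_identity ht
  have hel2 := h.integral_displacementRate_inner ht
  rw [h.integral_inner_materialDeriv ht] at hmom
  -- Incompressibility removes the work of the pressure.
  have hp : ∫ x in Ω, F.p t x * divg (F.gu t) x = 0 := by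
    rw [← integral_zero (Space d) ℝ (μ := volume.restrict Ω)]
    refine integral_congr_ae ?_
    filter_upwards [h.solution.incompressible t ht] with x hx
    rw [hx, mul_zero]
  have hW : ∀ s, deriv doubleWell s = doubleWellDeriv s := fun s => (hasDerivAt_doubleWell s).deriv
  simp only [hW] at hchem
  have hqV : ∫ x in Ω, F.qt t x * (P.lam * F.q t x + F.V t x)
      = P.lam * (∫ x in Ω, F.qt t x * F.q t x) + ∫ x in Ω, F.qt t x * F.V t x := by
    have hqt := hR.qt_memLp t ht
    rw [← integral_const_mul, ← integral_add
      ((integrable_mul_L2 hqt (hR.q_memLp t ht')).const_mul _)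
      (integrable_mul_L2 hqt ((hR.V_h1 t ht').memLp.mono_measure
        (Measure.restrict_mono h.subset le_rfl)))]
    refine integral_congr_ae (Eventually.of_forall fun x => ?_)
    ring
  have s1 : ∫ x in Ω, inner ℝ (F.q t x) (F.qt t x) = ∫ x in Ω, F.qt t x * F.q t x := by simp
  have s2 : ∫ x in Ω, inner ℝ (F.qt t x) (F.q t x) = ∫ x in Ω, F.qt t x * F.q t x := by
    simp [mul_comm]
  have s3 : ∫ x in Ω, inner ℝ (F.qt t x) (B.V0 t x) = ∫ x in Ω, F.qt t x * B.V0 t x := by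
    simp [mul_comm]
  have s4 : ∫ x in Ω, inner ℝ (F.gφt t x) (F.gφ t x) = ∫ x in Ω, inner ℝ (F.gφ t x) (F.gφt t x) := by
    simp only [real_inner_comm]
  have s5 : ∫ x in Ω, F.μ t x * inner ℝ (F.gφ t x) (F.u t x)
      = ∫ x in Ω, inner ℝ (F.u t x) (F.gφ t x) * F.μ t x := by
    refine integral_congr_ae (Eventually.of_forall fun x => ?_)
    simp only [real_inner_comm (F.u t x)]
    ring
  have s6 : ∫ x in Ω, F.q t x * inner ℝ (P.lam • F.gq t x + F.gV t x) (F.u t x)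
      = ∫ x in Ω, F.q t x * inner ℝ (F.u t x) (P.lam • F.gq t x + F.gV t x) := by
    refine integral_congr_ae (Eventually.of_forall fun x => ?_)
    simp only [real_inner_comm (F.u t x)]
  have s7 : ∫ x in Ω, F.φt t x * F.μ t x = ∫ x in Ω, F.μ t x * F.φt t x := by
    simp only [mul_comm]
  have s8 : ∫ x in Ω, deriv P.ρ (F.φ t x) * F.φt t x * inner ℝ (F.u t x) (F.u t x)
      = ∫ x in Ω, deriv P.ρ (F.φ t x) * ‖F.u t x‖ ^ 2 * F.φt t x := by
    refine integral_congr_ae (Eventually.of_forall fun x => ?_)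
    simp only [real_inner_self_eq_norm_sq]
    ring
  rw [dissipation, h.integral_bulk_dissipation ht, h.integral_boundary_dissipation ht, voltagePower,
    s1, s2, s3, s4]
  rw [s5, s6, s8, hp] at hmom
  rw [s7] at hphase
  rw [hqV] at hcharge
  -- The coefficient `1 / 2` reflects that the derivative of the field energy `½ ∫ ε⋆ |∇V|²` is `∫
  -- (ε⋆ ∇V)_t · ∇V` minus `½ ∫ ε'(φ) φ_t |∇V|²`.
  linear_combination hmom + hphase - hchem + hcharge + hel - 1 / 2 * hel2

end Configuration

end Identity

end Electrowetting

namespace Electrowetting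

/-! ### The energy estimate -/

section Estimate

/-- If `G' = R - D` with `D ≥ 0` and `R` integrable, then `D` is integrable, and the integrated
inequality holds. -/
theorem integrableOn_of_hasDerivAt_sub {T : ℝ} (hT : 0 < T) {G D R : ℝ → ℝ}
    (hG : ContinuousOn G (Icc 0 T)) (hd : ∀ t ∈ Ioo 0 T, HasDerivAt G (R t - D t) t)
    (hD : ∀ t ∈ Ioo 0 T, 0 ≤ D t) (hR : IntegrableOn R (Ioo 0 T)) :
    IntegrableOn D (Ioo 0 T) ∧
      ∀ s ∈ Icc 0 T, ∫ t in (0 : ℝ)..s, D t ≤ G 0 - G s + ∫ t in (0 : ℝ)..s, R t := by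
  -- Measurability of `D` comes from `D = R - G'`, derivatives being measurable.
  have hDm : AEStronglyMeasurable D (volume.restrict (Ioo 0 T)) := by
    refine (hR.1.sub (stronglyMeasurable_deriv G).aestronglyMeasurable).congr ?_
    filter_upwards [ae_restrict_mem measurableSet_Ioo] with t ht
    simp [(hd t ht).deriv]
  -- comparison with minorants of `D`
  have hcomp : ∀ f : ℝ → ℝ, IntegrableOn f (Ioo 0 T) → (∀ t ∈ Ioo 0 T, f t ≤ D t) →
      ∀ s ∈ Icc 0 T, ∫ t in (0 : ℝ)..s, f t ≤ G 0 - G s + ∫ t in (0 : ℝ)..s, R t := by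
    intro f hf hfD s hs
    have hsub : Ioo 0 s ⊆ Ioo 0 T := Ioo_subset_Ioo_right hs.2
    have hf' : IntegrableOn f (Icc 0 s) := by
      rw [integrableOn_Icc_iff_integrableOn_Ioo]
      exact hf.mono_set hsub
    have hR' : IntegrableOn R (Icc 0 s) := by
      rw [integrableOn_Icc_iff_integrableOn_Ioo]
      exact hR.mono_set hsub
    have key := intervalIntegral.integral_le_sub_of_hasDeriv_right_of_le hs.1
      (g := fun t => -G t) (g' := fun t => -(R t - D t)) (φ := fun t => f t - R t)
      (hG.mono (Icc_subset_Icc_right hs.2)).neg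
      (fun t ht => (hd t (hsub ht)).neg.hasDerivWithinAt) (hf'.sub hR')
      (fun t ht => by linarith [hfD t (hsub ht)])
    rw [intervalIntegral.integral_sub] at key
    · linarith
    · exact (intervalIntegrable_iff_integrableOn_Icc_of_le hs.1).2 hf'
    · exact (intervalIntegrable_iff_integrableOn_Icc_of_le hs.1).2 hR'
  have hTm : T ∈ Icc 0 T := ⟨hT.le, le_rfl⟩
  set C := G 0 - G T + ∫ t in (0 : ℝ)..T, R t with hC
  -- The truncations are bounded, hence integrable minorants. Their integrals are bounded by `C`
  -- independently of `N`, and monotone convergence gives integrability of `D`.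
  have htr : ∀ N : ℕ, IntegrableOn (fun t => min (D t) N) (Ioo 0 T) := by
    intro N
    refine Integrable.of_bound (hDm.inf aestronglyMeasurable_const) N ?_
    filter_upwards [ae_restrict_mem measurableSet_Ioo] with t ht
    have h0 : (0 : ℝ) ≤ min (D t) N := le_min (hD t ht) (Nat.cast_nonneg N)
    rw [Real.norm_of_nonneg h0]
    exact min_le_right _ _
  have hle : ∀ N : ℕ, ∫⁻ t in Ioo 0 T, ENNReal.ofReal (min (D t) N) ≤ ENNReal.ofReal C := by
    intro N
    rw [← ofReal_integral_eq_lintegral_ofReal (htr N)]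
    · refine ENNReal.ofReal_le_ofReal ?_
      have := hcomp _ (htr N) (fun t _ => min_le_left _ _) T hTm
      rwa [intervalIntegral.integral_of_le hT.le, integral_Ioc_eq_integral_Ioo] at this
    · filter_upwards [ae_restrict_mem measurableSet_Ioo] with t ht
      exact le_min (hD t ht) (Nat.cast_nonneg N)
  have hlim : Tendsto (fun N : ℕ => ∫⁻ t in Ioo 0 T, ENNReal.ofReal (min (D t) N)) atTop
      (𝓝 (∫⁻ t in Ioo 0 T, ENNReal.ofReal (D t))) := by
    refine lintegral_tendsto_of_tendsto_of_monotone (fun N => (htr N).1.aemeasurable.ennreal_ofReal)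
      ?_ ?_
    · refine Eventually.of_forall fun t i j hij => ENNReal.ofReal_le_ofReal ?_
      exact min_le_min_left _ (Nat.cast_le.2 hij)
    · refine Eventually.of_forall fun t => tendsto_const_nhds.congr' ?_
      obtain ⟨N, hN⟩ := exists_nat_ge (D t)
      filter_upwards [eventually_ge_atTop N] with k hk
      rw [min_eq_left (hN.trans (Nat.cast_le.2 hk))]
  have hDi : IntegrableOn D (Ioo 0 T) := by
    refine ⟨hDm, ?_⟩
    rw [hasFiniteIntegral_iff_ofReal]
    · exact (le_of_tendsto' hlim hle).trans_lt ENNReal.ofReal_lt_top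
    · filter_upwards [ae_restrict_mem measurableSet_Ioo] with t ht using hD t ht
  exact ⟨hDi, hcomp D hDi fun _ _ => le_rfl⟩

/-- Young's inequality for integrals of inner products. -/
theorem abs_integral_inner_le {X E : Type*} [MeasurableSpace X] {m : Measure X}
    [NormedAddCommGroup E] [InnerProductSpace ℝ E] {f g : X → E} (hf : MemLp f 2 m)
    (hg : MemLp g 2 m) {k : ℝ} (hk : 0 < k) :
    |∫ x, inner ℝ (f x) (g x) ∂m|
      ≤ k * (∫ x, inner ℝ (f x) (f x) ∂m) + 1 / (4 * k) * ∫ x, inner ℝ (g x) (g x) ∂m := by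
  rw [← integral_const_mul, ← integral_const_mul,
    ← integral_add ((MemLp.integrable_inner' hf hf).const_mul k)
      ((MemLp.integrable_inner' hg hg).const_mul _), ← Real.norm_eq_abs]
  refine norm_integral_le_of_norm_le (((MemLp.integrable_inner' hf hf).const_mul k).add
      ((MemLp.integrable_inner' hg hg).const_mul _)) (Eventually.of_forall fun x => ?_)
  simp only [real_inner_self_eq_norm_sq]
  refine (norm_inner_le_norm _ _).trans ?_
  have e : k * ‖f x‖ ^ 2 + 1 / (4 * k) * ‖g x‖ ^ 2 - ‖f x‖ * ‖g x‖
      = (2 * k * ‖f x‖ - ‖g x‖) ^ 2 / (4 * k) := by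
    field_simp
    ring
  have : 0 ≤ (2 * k * ‖f x‖ - ‖g x‖) ^ 2 / (4 * k) := by positivity
  linarith

variable {d : ℕ} {P : Params} {T : ℝ} {Ω Ωs : Set (Space d)} {n : Space d → Space d}
  {B : Voltage d} {b : ℝ → Space d → Space d} {F : Fields d}

/-! ### Young inequalities and the splitting of the energies. -/

namespace Configuration

variable (h : Configuration P T Ω Ωs n B b F)
include h

theorem epsStar_pos (t : ℝ) (x : Space d) : 0 < P.epsStar Ω (F.φ t) x := by
  unfold Params.epsStar
  split_ifs
  · exact h.admissible.ε_law.pos _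
  · exact h.admissible.εD_pos

theorem integral_displacement_inner_nonneg (t : ℝ) :
    0 ≤ ∫ x in Ωs, inner ℝ (displacement P Ω F t x) (F.gV t x) :=
  integral_nonneg fun x => by
    simp only [displacement, real_inner_smul_left, real_inner_self_eq_norm_sq, Pi.zero_apply]
    have := h.epsStar_pos t x
    positivity

/-- Young's inequality for the pairing of the displacement with a gradient. -/
theorem abs_integral_displacement_inner_le {t : ℝ} (ht : t ∈ Icc 0 T) {εM : ℝ}
    (hε : ∀ x ∈ Ωs, P.epsStar Ω (F.φ t) x ≤ εM) {g : Space d → Space d}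
    (hg : MemLp g 2 (volume.restrict Ωs)) {k : ℝ} (hk : 0 < k) :
    |∫ x in Ωs, inner ℝ (displacement P Ω F t x) (g x)|
      ≤ k * (∫ x in Ωs, inner ℝ (displacement P Ω F t x) (F.gV t x))
        + 1 / (4 * k) * (εM * ∫ x in Ωs, inner ℝ (g x) (g x)) := by
  have mD := h.curve_displacement'.memLp t ht
  have mV := h.curve_gradV.memLp t ht
  have i1 : Integrable (fun x => k * inner ℝ (displacement P Ω F t x) (F.gV t x))
      (volume.restrict Ωs) := (MemLp.integrable_inner' mD mV).const_mul k
  have i2 : Integrable (fun x => 1 / (4 * k) * (εM * inner ℝ (g x) (g x)))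
      (volume.restrict Ωs) := ((MemLp.integrable_inner' hg hg).const_mul εM).const_mul _
  rw [← integral_const_mul, ← integral_const_mul εM, ← integral_const_mul, ← integral_add i1 i2,
    ← Real.norm_eq_abs]
  refine norm_integral_le_of_norm_le (i1.add i2) ?_
  filter_upwards [ae_restrict_mem h.domain'.isOpen.measurableSet] with x hx
  simp only [displacement, real_inner_smul_left, real_inner_self_eq_norm_sq, norm_mul]
  have hp := h.epsStar_pos t x
  rw [Real.norm_of_nonneg hp.le]
  refine (mul_le_mul_of_nonneg_left (norm_inner_le_norm _ _) hp.le).trans ?_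
  have e : k * (P.epsStar Ω (F.φ t) x * ‖F.gV t x‖ ^ 2)
      + 1 / (4 * k) * (P.epsStar Ω (F.φ t) x * ‖g x‖ ^ 2)
      - P.epsStar Ω (F.φ t) x * (‖F.gV t x‖ * ‖g x‖)
      = P.epsStar Ω (F.φ t) x * ((2 * k * ‖F.gV t x‖ - ‖g x‖) ^ 2 / (4 * k)) := by
    field_simp
    ring
  have e1 : 0 ≤ P.epsStar Ω (F.φ t) x * ((2 * k * ‖F.gV t x‖ - ‖g x‖) ^ 2 / (4 * k)) := by
    positivity
  have e2 : 1 / (4 * k) * (P.epsStar Ω (F.φ t) x * ‖g x‖ ^ 2)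
      ≤ 1 / (4 * k) * (εM * ‖g x‖ ^ 2) := by
    have := hε x hx
    gcongr
  linarith

theorem phaseEnergy_eq {t : ℝ} (ht : t ∈ Icc 0 T) :
    phaseEnergy P Ω F t = P.γ * P.δ / 2 * (∫ x in Ω, inner ℝ (F.gφ t x) (F.gφ t x))
      + P.γ / P.δ * (∫ x in Ω, doubleWell (F.φ t x))
      + P.γ * (∫ x, wallEnergyNorm P.θs (F.φ t x) ∂(surface (frontier Ω))) := by
  have := h.isFiniteMeasure
  have mφ := h.curve_gradPhi.memLp t ht
  have i1 : Integrable (fun x => P.δ / 2 * ‖F.gφ t x‖ ^ 2) (volume.restrict Ω) := by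
    simp only [← real_inner_self_eq_norm_sq]
    exact (MemLp.integrable_inner' mφ mφ).const_mul _
  have i2 : Integrable (fun x => 1 / P.δ * doubleWell (F.φ t x)) (volume.restrict Ω) :=
    ((h.memLp_top (continuous_doubleWell.comp_continuousOn (h.phi_slice ht))).integrable
      le_top).const_mul _
  rw [phaseEnergy, integral_add i1 i2, integral_const_mul, integral_const_mul]
  simp only [real_inner_self_eq_norm_sq]
  ring

theorem integral_bulk_energy_eq {t : ℝ} (ht : t ∈ Icc 0 T) (k : ℝ) :
    ∫ x in Ω, (1 / 2 * P.ρ (F.φ t x) * ‖F.u t x‖ ^ 2 + k * F.q t x ^ 2)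
      = (∫ x in Ω, 1 / 2 * P.ρ (F.φ t x) * ‖F.u t x‖ ^ 2)
        + k * ∫ x in Ω, inner ℝ (F.q t x) (F.q t x) := by
  have := h.isFiniteMeasure
  have mq := h.curve_q.memLp t ht
  have i1 : Integrable (fun x => 1 / 2 * P.ρ (F.φ t x) * ‖F.u t x‖ ^ 2) (volume.restrict Ω) :=
    (h.memLp_top (h.kinetic_slice ht)).integrable le_top
  have e : ∀ x, inner ℝ (F.q t x) (F.q t x) = F.q t x ^ 2 := fun x => by simp [sq]
  have i2 : Integrable (fun x => k * F.q t x ^ 2) (volume.restrict Ω) := by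
    simp only [← e]
    exact (MemLp.integrable_inner' mq mq).const_mul _
  rw [integral_add i1 i2, integral_const_mul]
  simp only [e]

theorem energy_eq {t : ℝ} (ht : t ∈ Icc 0 T) :
    energy P Ω Ωs F t = (∫ x in Ω, 1 / 2 * P.ρ (F.φ t x) * ‖F.u t x‖ ^ 2)
      + P.lam / 4 * (∫ x in Ω, inner ℝ (F.q t x) (F.q t x))
      + phaseEnergy P Ω F t
      + 1 / 4 * ∫ x in Ωs, inner ℝ (displacement P Ω F t x) (F.gV t x) := by
  rw [energy, h.integral_bulk_energy_eq ht, ← integral_const_mul (1 / 4 : ℝ)]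
  congr 1
  refine integral_congr_ae (Eventually.of_forall fun x => ?_)
  simp only [displacement, real_inner_smul_left, real_inner_self_eq_norm_sq]
  ring

theorem initialEnergy_eq (εM : ℝ) :
    initialEnergy P εM Ω Ωs B F = (∫ x in Ω, 1 / 2 * P.ρ (F.φ 0 x) * ‖F.u 0 x‖ ^ 2)
      + (1 + P.lam) / 2 * (∫ x in Ω, inner ℝ (F.q 0 x) (F.q 0 x))
      + 1 / 2 * (∫ x in Ω, inner ℝ (B.V0 0 x) (B.V0 0 x))
      + phaseEnergy P Ω F 0
      + (∫ x in Ωs, inner ℝ (displacement P Ω F 0 x) (F.gV 0 x))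
      + εM * ∫ x in Ωs, inner ℝ (B.gV0 0 x) (B.gV0 0 x) := by
  have := h.isFiniteMeasure
  have h0 : (0 : ℝ) ∈ Icc 0 T := ⟨le_rfl, h.time_pos.le⟩
  have mq := h.curve_q.memLp 0 h0
  have mV0 := h.curve_V0.memLp 0 h0
  have mg := h.curve_gradV0.memLp 0 h0
  have e : ∀ a : ℝ, inner ℝ a a = a ^ 2 := fun x => by simp [sq]
  have i1 : Integrable (fun x => 1 / 2 * P.ρ (F.φ 0 x) * ‖F.u 0 x‖ ^ 2
      + (1 + P.lam) / 2 * F.q 0 x ^ 2) (volume.restrict Ω) := by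
    refine ((h.memLp_top (h.kinetic_slice h0)).integrable le_top).add (Integrable.const_mul ?_ _)
    simp only [← e]
    exact MemLp.integrable_inner' mq mq
  have i2 : Integrable (fun x => 1 / 2 * B.V0 0 x ^ 2) (volume.restrict Ω) := by
    simp only [← e]
    exact (MemLp.integrable_inner' mV0 mV0).const_mul _
  have i3 : Integrable (fun x => P.epsStar Ω (F.φ 0) x * ‖F.gV 0 x‖ ^ 2)
      (volume.restrict Ωs) := by
    simp only [← real_inner_self_eq_norm_sq, ← real_inner_smul_left]
    exact MemLp.integrable_inner' (h.curve_displacement'.memLp 0 h0) (h.curve_gradV.memLp 0 h0)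
  have i4 : Integrable (fun x => εM * ‖B.gV0 0 x‖ ^ 2) (volume.restrict Ωs) := by
    simp only [← real_inner_self_eq_norm_sq]
    exact (MemLp.integrable_inner' mg mg).const_mul _
  rw [initialEnergy, integral_add i1 i2, h.integral_bulk_energy_eq h0, integral_add i3 i4,
    integral_const_mul, integral_const_mul]
  simp only [displacement, real_inner_smul_left, e, real_inner_self_eq_norm_sq]
  ring

omit h in
theorem _root_.Electrowetting.voltageSize_eq (εM t : ℝ) :
    voltageSize P εM Ω Ωs B t = εM * (∫ x in Ωs, inner ℝ (B.gV0 t x) (B.gV0 t x))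
      + 1 / P.lam * ∫ x in Ω, inner ℝ (B.V0 t x) (B.V0 t x) := by
  rw [voltageSize, integral_const_mul, integral_const_mul]
  simp only [real_inner_self_eq_norm_sq, Real.norm_eq_abs, sq_abs]

omit h in
theorem _root_.Electrowetting.voltageRate_eq (εM t : ℝ) :
    voltageRate P εM Ω Ωs B t = εM * (∫ x in Ωs, inner ℝ (B.gV0t t x) (B.gV0t t x))
      + 4 / P.lam * ∫ x in Ω, inner ℝ (B.V0t t x) (B.V0t t x) := by
  rw [voltageRate, integral_const_mul]
  simp only [real_inner_self_eq_norm_sq, Real.norm_eq_abs, sq_abs]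

theorem continuousOn_phaseEnergy : ContinuousOn (phaseEnergy P Ω F) (Icc 0 T) :=
  (((continuousOn_const.mul (h.curve_gradPhi.continuousOn_integral_inner h.curve_gradPhi)).add
    (continuousOn_const.mul h.continuousOn_integral_doubleWell)).add
    (continuousOn_const.mul h.continuousOn_integral_wall)).congr fun _ ht => h.phaseEnergy_eq ht

theorem continuousOn_energy : ContinuousOn (energy P Ω Ωs F) (Icc 0 T) :=
  (((h.continuousOn_integral_kinetic.add
    (continuousOn_const.mul (h.curve_q.continuousOn_integral_inner h.curve_q))).add
    h.continuousOn_phaseEnergy).add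
    (continuousOn_const.mul (h.curve_displacement'.continuousOn_integral_inner
      h.curve_gradV))).congr fun _ ht => h.energy_eq ht

theorem continuousOn_voltageSize (εM : ℝ) :
    ContinuousOn (voltageSize P εM Ω Ωs B) (Icc 0 T) :=
  ((continuousOn_const.mul (h.curve_gradV0.continuousOn_integral_inner h.curve_gradV0)).add
    (continuousOn_const.mul (h.curve_V0.continuousOn_integral_inner h.curve_V0))).congr
    fun _ _ => voltageSize_eq εM _

theorem phaseEnergy_nonneg (t : ℝ) : 0 ≤ phaseEnergy P Ω F t := by
  have hγ := h.admissible.γ_pos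
  have hδ := h.admissible.δ_pos
  have h1 : 0 ≤ ∫ x in Ω, (P.δ / 2 * ‖F.gφ t x‖ ^ 2 + 1 / P.δ * doubleWell (F.φ t x)) :=
    integral_nonneg fun x => by
      have := doubleWell_nonneg (F.φ t x)
      simp only [Pi.zero_apply]
      positivity
  have h2 : 0 ≤ ∫ x, wallEnergyNorm P.θs (F.φ t x) ∂(surface (frontier Ω)) :=
    integral_nonneg fun x => wallEnergyNorm_nonneg _ _
  rw [phaseEnergy]
  positivity

theorem integral_kinetic_nonneg (t : ℝ) :
    0 ≤ ∫ x in Ω, 1 / 2 * P.ρ (F.φ t x) * ‖F.u t x‖ ^ 2 :=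
  integral_nonneg fun x => by
    have := h.admissible.ρ_law.pos (F.φ t x)
    simp only [Pi.zero_apply]
    positivity

omit h in
theorem _root_.Electrowetting.integral_inner_self_nonneg {X E : Type*} [MeasurableSpace X]
    {m : Measure X} [NormedAddCommGroup E] [InnerProductSpace ℝ E] (f : X → E) :
    0 ≤ ∫ x, inner ℝ (f x) (f x) ∂m :=
  integral_nonneg fun _ => real_inner_self_nonneg

/-- The charge and field parts are the only ones to which the applied voltage couples, so they alone
are needed to control the power. -/
theorem charge_field_le_energy {t : ℝ} (ht : t ∈ Icc 0 T) :
    P.lam / 4 * (∫ x in Ω, inner ℝ (F.q t x) (F.q t x))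
      + 1 / 4 * (∫ x in Ωs, inner ℝ (displacement P Ω F t x) (F.gV t x))
      ≤ energy P Ω Ωs F t := by
  rw [h.energy_eq ht]
  linarith [h.integral_kinetic_nonneg t, h.phaseEnergy_nonneg t]

theorem energy_nonneg {t : ℝ} (ht : t ∈ Icc 0 T) : 0 ≤ energy P Ω Ωs F t := by
  refine le_trans ?_ (h.charge_field_le_energy ht)
  have h1 := h.admissible.lam_pos
  have h2 := h.integral_displacement_inner_nonneg t
  have h3 := integral_inner_self_nonneg (m := volume.restrict Ω) (F.q t)
  positivity

theorem dissipation_nonneg (t : ℝ) : 0 ≤ dissipation P Ω n F b t := by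
  have hA := h.admissible
  refine add_nonneg (integral_nonneg fun x => ?_) (integral_nonneg fun x => ?_)
  · have h1 := hA.η_law.pos (F.φ t x)
    have h2 := hA.M_law.pos (F.φ t x)
    have h3 := hA.K_law.pos (F.φ t x)
    have h4 : 0 ≤ symDot (F.gu t) (F.gu t) x :=
      Finset.sum_nonneg fun i _ => Finset.sum_nonneg fun j _ => mul_self_nonneg _
    simp only [Pi.zero_apply]
    positivity
  · have h1 := hA.β_law.pos (F.φ t x)
    have h2 := hA.α_pos
    simp only [Pi.zero_apply]
    positivity

/-- Exhibits the spare halves of the charge and field energies that are available to absorb the two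
coupling terms. -/
theorem relativeEnergy_eq {t : ℝ} (ht : t ∈ Icc 0 T) :
    relativeEnergy P Ω Ωs B F t = energy P Ω Ωs F t
      + P.lam / 4 * (∫ x in Ω, inner ℝ (F.q t x) (F.q t x))
      + 1 / 4 * (∫ x in Ωs, inner ℝ (displacement P Ω F t x) (F.gV t x))
      + (∫ x in Ω, inner ℝ (F.q t x) (B.V0 t x))
      - ∫ x in Ωs, inner ℝ (displacement P Ω F t x) (B.gV0 t x) := by
  rw [relativeEnergy, h.energy_eq ht, h.phaseEnergy_eq ht]
  ring

/-! ### The a priori bounds. -/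

variable {εM : ℝ} (hε : ∀ t ∈ Icc 0 T, ∀ x ∈ Ωs, P.epsStar Ω (F.φ t) x ≤ εM)
include hε

theorem epsM_pos : 0 < εM := by
  obtain ⟨x, hx⟩ := h.domain'.nonempty
  exact (h.epsStar_pos 0 x).trans_le (hε 0 ⟨le_rfl, h.time_pos.le⟩ x hx)

/-- The Young weights `λ / 4` and `1 / 4` are those of the spare charge and field energies, which
they use up exactly; the remainders form `voltageSize`. -/
theorem energy_le_relativeEnergy {t : ℝ} (ht : t ∈ Icc 0 T) :
    energy P Ω Ωs F t ≤ relativeEnergy P Ω Ωs B F t + voltageSize P εM Ω Ωs B t := by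
  have hl := h.admissible.lam_pos
  have h1 := (abs_le.1 (abs_integral_inner_le (h.curve_q.memLp t ht) (h.curve_V0.memLp t ht)
    (k := P.lam / 4) (by positivity))).1
  have h2 := (abs_le.1 (h.abs_integral_displacement_inner_le ht (hε t ht)
    (h.curve_gradV0.memLp t ht) (k := 1 / 4) (by norm_num))).2
  rw [show 1 / (4 * (P.lam / 4)) = 1 / P.lam by field_simp] at h1
  rw [show 1 / (4 * (1 / 4 : ℝ)) = 1 by norm_num] at h2
  rw [h.relativeEnergy_eq ht, voltageSize_eq]
  linarith

/-- Young's inequality with weight `1 / 2` raises the charge coefficient to `(1 + λ) / 2` and the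
field coefficient to `1`. The gradient term leaves a surplus of `εM / 2`. -/
theorem relativeEnergy_zero_le : relativeEnergy P Ω Ωs B F 0 ≤ initialEnergy P εM Ω Ωs B F := by
  have h0 : (0 : ℝ) ∈ Icc 0 T := ⟨le_rfl, h.time_pos.le⟩
  have h1 := (abs_le.1 (abs_integral_inner_le (h.curve_q.memLp 0 h0) (h.curve_V0.memLp 0 h0)
    (k := 1 / 2) (by norm_num))).2
  have h2 := (abs_le.1 (h.abs_integral_displacement_inner_le h0 (hε 0 h0)
    (h.curve_gradV0.memLp 0 h0) (k := 1 / 2) (by norm_num))).1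
  have h3 : 0 ≤ εM * ∫ x in Ωs, inner ℝ (B.gV0 0 x) (B.gV0 0 x) :=
    mul_nonneg (h.epsM_pos hε).le (integral_inner_self_nonneg _)
  rw [show 1 / (4 * (1 / 2 : ℝ)) = 1 / 2 by norm_num] at h1 h2
  rw [h.relativeEnergy_eq h0, h.energy_eq h0, h.initialEnergy_eq]
  linarith

/-- The weights are chosen so that the energy appears with factor `1 / (4T)`, which integrates to `1
/ 4` over `(0, T)` and can later be absorbed. -/
theorem abs_voltagePower_le {t : ℝ} (ht : t ∈ Ioo 0 T) :
    |voltagePower P Ω Ωs B F t|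
      ≤ 1 / (4 * T) * energy P Ω Ωs F t + 4 * T * voltageRate P εM Ω Ωs B t := by
  have hT := h.time_pos
  have hl := h.admissible.lam_pos
  have ht' := Ioo_subset_Icc_self ht
  have h1 := abs_integral_inner_le (h.curve_q.memLp t ht') (h.curve_V0.memLp' t ht)
    (k := P.lam / (16 * T)) (by positivity)
  have h2 := h.abs_integral_displacement_inner_le ht' (hε t ht')
    (h.curve_gradV0.memLp' t ht) (k := 1 / (16 * T)) (by positivity)
  have h3 := mul_le_mul_of_nonneg_left (h.charge_field_le_energy ht')
    (by positivity : 0 ≤ 1 / (4 * T))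
  -- Young's inequality produces `4T / λ`, whereas `4T` times the rate carries `16T / λ`; the
  -- difference is discarded.
  have h4 : 0 ≤ T / P.lam * ∫ x in Ω, inner ℝ (B.V0t t x) (B.V0t t x) :=
    mul_nonneg (by positivity) (integral_inner_self_nonneg _)
  have e1 : 1 / (4 * (P.lam / (16 * T))) = 4 * (T / P.lam) := by field_simp; norm_num
  have e2 : 1 / (4 * (1 / (16 * T))) = 4 * T := by field_simp; norm_num
  rw [e1] at h1
  rw [e2] at h2
  refine (abs_sub _ _).trans ?_
  rw [voltageRate_eq]
  have e3 : 1 / (4 * T) * (P.lam / 4 * (∫ x in Ω, inner ℝ (F.q t x) (F.q t x))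
      + 1 / 4 * (∫ x in Ωs, inner ℝ (displacement P Ω F t x) (F.gV t x)))
      = P.lam / (16 * T) * (∫ x in Ω, inner ℝ (F.q t x) (F.q t x))
      + 1 / (16 * T) * (∫ x in Ωs, inner ℝ (displacement P Ω F t x) (F.gV t x)) := by
    ring
  rw [e3] at h3
  have e4 : 4 * T * (εM * (∫ x in Ωs, inner ℝ (B.gV0t t x) (B.gV0t t x))
      + 4 / P.lam * ∫ x in Ω, inner ℝ (B.V0t t x) (B.V0t t x))
      = 4 * T * (εM * (∫ x in Ωs, inner ℝ (B.gV0t t x) (B.gV0t t x)))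
      + 16 * (T / P.lam * ∫ x in Ω, inner ℝ (B.V0t t x) (B.V0t t x)) := by ring
  rw [e4]
  linarith

omit hε in
theorem intervalIntegrable_voltageRate :
    IntervalIntegrable (voltageRate P εM Ω Ωs B) volume 0 T := by
  have h1 := (h.voltage.sq_int_grad.const_mul εM).add (h.voltage.sq_int.const_mul (4 / P.lam))
  refine h1.congr (fun t _ => ?_)
  simp only [voltageRate, integral_const_mul]

theorem voltageRate_nonneg (t : ℝ) : 0 ≤ voltageRate P εM Ω Ωs B t := by
  have h1 := h.epsM_pos hε
  have h2 := h.admissible.lam_pos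
  have h3 := integral_inner_self_nonneg (m := volume.restrict Ωs) (B.gV0t t)
  have h4 := integral_inner_self_nonneg (m := volume.restrict Ω) (B.V0t t)
  rw [voltageRate_eq]
  positivity

omit hε in
theorem bddAbove_energy : BddAbove (energy P Ω Ωs F '' Ioc 0 T) :=
  (isCompact_Icc.bddAbove_image h.continuousOn_energy).mono (image_mono Ioc_subset_Icc_self)

/-- The energy is bounded, being continuous on the closed interval, so the bound on the power is an
integrable majorant. -/
theorem integrableOn_voltagePower : IntegrableOn (voltagePower P Ω Ωs B F) (Ioo 0 T) := by
  have hm : AEStronglyMeasurable (voltagePower P Ω Ωs B F) (volume.restrict (Ioo 0 T)) :=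
    (h.curve_q.aestronglyMeasurable_integral_inner h.curve_V0).sub
      (h.curve_displacement'.aestronglyMeasurable_integral_inner h.curve_gradV0)
  obtain ⟨C, hC⟩ := h.bddAbove_energy
  have hr : IntegrableOn (voltageRate P εM Ω Ωs B) (Ioo 0 T) :=
    ((intervalIntegrable_iff_integrableOn_Ioo_of_le h.time_pos.le).1
      h.intervalIntegrable_voltageRate)
  have hb : IntegrableOn (fun t => 1 / (4 * T) * C + 4 * T * voltageRate P εM Ω Ωs B t)
      (Ioo 0 T) := (integrable_const _).add (hr.const_mul _)
  refine hb.mono' hm ?_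
  filter_upwards [ae_restrict_mem measurableSet_Ioo] with t ht
  refine (h.abs_voltagePower_le hε ht).trans ?_
  have h1 : energy P Ω Ωs F t ≤ C := hC ⟨t, Ioo_subset_Ioc_self ht, rfl⟩
  have h2 : 0 ≤ 1 / (4 * T) := by
    have := h.time_pos
    positivity
  gcongr

/-- Write `A` for initial data plus voltage supremum plus `4T` times the integrated rate. The energy
law gives `E(s) + ∫₀ˢ D ≤ A + sup E / 4` for every `s`, and the supremum on the right is absorbed on
the left. -/
theorem stability_estimate :
    BddAbove (energy P Ω Ωs F '' Ioc 0 T) ∧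
      IntervalIntegrable (dissipation P Ω n F b) volume 0 T ∧
      sSup (energy P Ω Ωs F '' Ioc 0 T) + ∫ t in (0 : ℝ)..T, dissipation P Ω n F b t
        ≤ 4 * (initialEnergy P εM Ω Ωs B F + sSup (voltageSize P εM Ω Ωs B '' Icc 0 T))
          + 16 * T * ∫ t in (0 : ℝ)..T, voltageRate P εM Ω Ωs B t := by
  have hT := h.time_pos
  have hTm : T ∈ Ioc 0 T := ⟨hT, le_rfl⟩
  have hbd := h.bddAbove_energy
  obtain ⟨hDi, hDle⟩ := integrableOn_of_hasDerivAt_sub hT h.continuousOn_relativeEnergy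
    (fun _ ht => h.energy_identity ht) (fun t _ => h.dissipation_nonneg t)
    (h.integrableOn_voltagePower hε)
  refine ⟨hbd, (intervalIntegrable_iff_integrableOn_Ioo_of_le hT.le).2 hDi, ?_⟩
  set Em := sSup (energy P Ω Ωs F '' Ioc 0 T) with hEm
  set S := sSup (voltageSize P εM Ω Ωs B '' Icc 0 T) with hS
  set I := ∫ t in (0 : ℝ)..T, voltageRate P εM Ω Ωs B t with hI
  have hEle : ∀ t ∈ Ioc 0 T, energy P Ω Ωs F t ≤ Em := fun t ht => le_csSup hbd ⟨t, ht, rfl⟩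
  have hE0 : 0 ≤ Em := (h.energy_nonneg (Ioc_subset_Icc_self hTm)).trans (hEle T hTm)
  have hSle : ∀ t ∈ Icc 0 T, voltageSize P εM Ω Ωs B t ≤ S := fun t ht =>
    le_csSup (isCompact_Icc.bddAbove_image (h.continuousOn_voltageSize εM)) ⟨t, ht, rfl⟩
  have hrate := h.intervalIntegrable_voltageRate (εM := εM)
  have hpow : ∀ s ∈ Ioc 0 T, ∫ t in (0 : ℝ)..s, voltagePower P Ω Ωs B F t
      ≤ 1 / 4 * Em + 4 * T * I := by
    intro s hs
    have hbi : IntegrableOn (fun t => 1 / (4 * T) * Em + 4 * T * voltageRate P εM Ω Ωs B t)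
        (Ioo 0 T) := (integrable_const _).add
      (((intervalIntegrable_iff_integrableOn_Ioo_of_le hT.le).1 hrate).const_mul _)
    have hval : ∫ t in Ioo 0 T, (1 / (4 * T) * Em + 4 * T * voltageRate P εM Ω Ωs B t)
        = 1 / 4 * Em + 4 * T * I := by
      rw [← integral_Ioc_eq_integral_Ioo, ← intervalIntegral.integral_of_le hT.le,
        intervalIntegral.integral_add intervalIntegrable_const (hrate.const_mul _),
        intervalIntegral.integral_const, intervalIntegral.integral_const_mul, ← hI, smul_eq_mul,
        sub_zero]
      field_simp
    rw [← hval, intervalIntegral.integral_of_le hs.1.le, integral_Ioc_eq_integral_Ioo]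
    have hsub : Ioo 0 s ⊆ Ioo 0 T := Ioo_subset_Ioo_right hs.2
    -- The majorant is nonnegative, so its integral may be extended from `(0, s)` to `(0, T)`, which
    -- makes the bound uniform in `s`.
    refine (setIntegral_mono_on ((h.integrableOn_voltagePower hε).mono_set hsub)
      (hbi.mono_set hsub) measurableSet_Ioo fun t ht => ?_).trans
      (setIntegral_mono_set hbi (Eventually.of_forall fun t => ?_) hsub.eventuallyLE)
    · refine (le_abs_self _).trans ((h.abs_voltagePower_le hε (hsub ht)).trans ?_)
      have := hEle t (Ioo_subset_Ioc_self (hsub ht))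
      gcongr
    · have := h.voltageRate_nonneg hε t
      simp only [Pi.zero_apply]
      positivity
  have hmain : ∀ s ∈ Ioc 0 T, energy P Ω Ωs F s + ∫ t in (0 : ℝ)..s, dissipation P Ω n F b t
      ≤ initialEnergy P εM Ω Ωs B F + S + (1 / 4 * Em + 4 * T * I) := by
    intro s hs
    have hs' := Ioc_subset_Icc_self hs
    linarith [h.energy_le_relativeEnergy hε hs', h.relativeEnergy_zero_le hε, hSle s hs',
      hDle s hs', hpow s hs]
  have hsup : Em ≤ initialEnergy P εM Ω Ωs B F + S + (1 / 4 * Em + 4 * T * I) := by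
    refine csSup_le (Set.Nonempty.image _ ⟨T, hTm⟩) ?_
    rintro _ ⟨s, hs, rfl⟩
    have h0 : 0 ≤ ∫ t in (0 : ℝ)..s, dissipation P Ω n F b t :=
      intervalIntegral.integral_nonneg hs.1.le fun t _ => h.dissipation_nonneg t
    linarith [hmain s hs]
  have hTT := hmain T hTm
  have hET := h.energy_nonneg (Ioc_subset_Icc_self hTm)
  have hD0 : 0 ≤ ∫ t in (0 : ℝ)..T, dissipation P Ω n F b t :=
    intervalIntegral.integral_nonneg hT.le fun t _ => h.dissipation_nonneg t
  -- With `A` the right side of `hsup` without `Em / 4`, one has `Em ≤ 4A / 3`, hence `A ≥ 0` and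
  -- also `∫ D ≤ 4A / 3`. The sum is at most `8A / 3 ≤ 4A`.
  linarith

end Configuration

end Estimate

end Electrowetting

theorem mainTheorem1 :
    ∃ c : ℝ, 0 < c ∧
      ∀ (d : ℕ), (d = 2 ∨ d = 3) →
      ∀ (P : Electrowetting.Params), P.Admissible →
      ∀ (Ω Ωs : Set (Electrowetting.Space d)),
        Electrowetting.IsConvexDomain Ω → Electrowetting.IsConvexDomain Ωs → Ω ⊆ Ωs →
      ∀ (n : Electrowetting.Space d → Electrowetting.Space d), Measurable n →
        (∀ᵐ x ∂(Electrowetting.surface (frontier Ω)), Electrowetting.IsOuterUnitNormal Ω x (n x)) →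
      ∀ (T : ℝ), 0 < T →
      ∀ (B : Electrowetting.Voltage d), B.Regular T Ω Ωs →
      ∀ (b : ℝ → Electrowetting.Space d → Electrowetting.Space d) (F : Electrowetting.Fields d),
        Electrowetting.IsSolution P T Ω Ωs n B b F →
      ∀ (εM : ℝ), (∀ t ∈ Set.Icc 0 T, ∀ x ∈ Ωs, P.epsStar Ω (F.φ t) x ≤ εM) →
        BddAbove (Electrowetting.energy P Ω Ωs F '' Set.Ioc 0 T) ∧
        IntervalIntegrable (Electrowetting.dissipation P Ω n F b) MeasureTheory.volume 0 T ∧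
        sSup (Electrowetting.energy P Ω Ωs F '' Set.Ioc 0 T)
            + ∫ t in (0 : ℝ)..T, Electrowetting.dissipation P Ω n F b t
          ≤ 4 * (Electrowetting.initialEnergy P εM Ω Ωs B F
                + sSup (Electrowetting.voltageSize P εM Ω Ωs B '' Set.Icc 0 T))
            + c * T * ∫ t in (0 : ℝ)..T, Electrowetting.voltageRate P εM Ω Ωs B t := by
  -- The constant is the outer factor `4` times the factor `4` from Young's inequality for the
  -- power.
  refine ⟨16, by norm_num, ?_⟩
  intro d hd P hP Ω Ωs hΩ hΩs hsub n hn hnor T hT B hB b F hF εM hε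
  have h : Electrowetting.Configuration P T Ω Ωs n B b F :=
    ⟨by omega, hP, hΩ, hΩs, hsub, hn, hnor, hT, hB, hF⟩
  exact h.stability_estimate hε
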